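/- For real $a,b,c,e>-1$ and real $d$ with $d<c+2+\min\{a,b,e\}$ put $$J_3=J_3(a,b,c,d,e;0)=\iiint_{(0,1)^3}\frac{x^{b}(1-x)^{c}y^{e}(1-y)^{a}z^{a}(1-z)^{c}}{(1-(1-xy)z)^{d}}\,dx\,dy\,dz .$$ This integral converges absolutely, and the following hold. (i) If $d\notin\{0,-1,-2,\dots\}$, then $$J_3=\frac{\Gamma(1+a)\Gamma(1+c)}{\Gamma(d)\Gamma(2+a+c-d)}\;G^{2,4}_{4,4}\bigg(1\biggm|\begin{matrix}1-d,\,-a,\,-b,\,-e\\ 1-d+c,\,0;\,-1-b-c,\,-1-e-a\end{matrix}\bigg),$$ where the Meijer $G$-function is $$\frac1{2\pi i}\int_L\frac{\Gamma(d+t)\Gamma(1+a+t)\Gamma(1+b+t)\Gamma(1+e+t)\,\Gamma(-t)\Gamma(1+c-d-t)}{\Gamma(2+a+e+t)\Gamma(2+b+c+t)}\,dt,$$ with an absolutely convergent integral over a contour $L$ from $-i\infty$ to $+i\infty$ that has the poles of $\Gamma(d+t)$, $\Gamma(1+a+t)$, $\Gamma(1+b+t)$, $\Gamma(1+e+t)$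 on its left and those of $\Gamma(-t)$, $\Gamma(1+c-d-t)$ on its right. (ii) If $c-d\notin\mathbb Z$, then both hypergeometric series below converge absolutely and $$\begin{aligned} J_3=\frac{\pi}{\sin\pi(d-c)}\biggl(&\frac{\Gamma(a+1)^2\Gamma(b+1)\Gamma(c+1)\Gamma(e+1)}{\Gamma(d-c)\Gamma(a+e+2)\Gamma(b+c+2)\Gamma(a+c-d+2)}\;{}_4F_3\biggl(\begin{matrix}a+1,\,b+1,\,d,\,e+1\\ d-c,\,a+e+2,\,b+c+2\end{matrix}\biggm|1\biggr)\\ &-\frac{\Gamma(a+1)\Gamma(c+1)^2\Gamma(b+c-d+2)\Gamma(e+c-d+2)}{\Gamma(d)\Gamma(c-d+2)\Gamma(a+e+c-d+3)\Gamma(b+2c-d+3)}\;{}_4F_3\biggl(\begin{matrix}a+c-d+2,\,b+c-d+2,\,c+1,\,e+c-d+2\\ c-d+2,\,a+e+c-d+3,\,b+2c-d+3\end{matrix}\biggm|1\biggr)\biggr), \end{aligned}$$ where $1/\Gamma(d)$ is read as $0$ if $d\in\{0,-1,-2,\dots\}$. -/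

import Mathlib

open Real Set Filter Topology MeasureTheory

/-- The integrand of the triple Beukers-type integral `J₃(a,b,c,d,e;n)` at the point `(x, y, z)`. -/
noncomputable def beukersIntegrand (a b c d e : ℝ) (n : ℕ) (w : ℝ × ℝ × ℝ) : ℝ :=
  (w.1 ^ (n + b) * (1 - w.1) ^ (n + c) * w.2.1 ^ (n + e) * (1 - w.2.1) ^ (n + a)
      * w.2.2 ^ (n + a) * (1 - w.2.2) ^ (n + c))
    / (1 - (1 - w.1 * w.2.1) * w.2.2) ^ (n + d)

/-- The open unit cube. -/
def unitCube : Set (ℝ × ℝ × ℝ) := Ioo 0 1 ×ˢ Ioo 0 1 ×ˢ Ioo 0 1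

/-- The triple Beukers-type integral `J₃(a,b,c,d,e;n)`. -/
noncomputable def J3 (a b c d e : ℝ) (n : ℕ) : ℝ :=
  ∫ w in unitCube, beukersIntegrand a b c d e n w

/-- The `k`-th term of the generalized hypergeometric series `pFq(a; b | z)`. -/
noncomputable def pFqTerm {p q : ℕ} (a : Fin p → ℝ) (b : Fin q → ℝ) (z : ℝ) (k : ℕ) : ℝ :=
  (∏ i, (ascPochhammer ℝ k).eval (a i)) / (∏ j, (ascPochhammer ℝ k).eval (b j))
    * (z ^ k / (Nat.factorial k : ℝ))

/-- The sum of the generalized hypergeometric series `pFq(a; b | z)`. -/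
noncomputable def pFq {p q : ℕ} (a : Fin p → ℝ) (b : Fin q → ℝ) (z : ℝ) : ℝ :=
  ∑' k, pFqTerm a b z k

/-- The contour integral of `f` along the straight segment from `u` to `v`. -/
noncomputable def segmentIntegral (f : ℂ → ℂ) (u v : ℂ) : ℂ :=
  (v - u) * ∫ t in (0 : ℝ)..1, f (u + t * (v - u))

/-- The contour integral of `f` along the polygonal path with the given consecutive vertices. -/
noncomputable def polygonIntegral (f : ℂ → ℂ) : List ℂ → ℂ
  | [] => 0
  | [_] => 0
  | u :: v :: l => segmentIntegral f u v + polygonIntegral f (v :: l)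

/-- The image of the polygonal path with the given consecutive vertices. -/
def polygonTrace : List ℂ → Set ℂ
  | [] => ∅
  | [u] => {u}
  | u :: v :: l => segment ℝ u v ∪ polygonTrace (v :: l)

/-- A polygonal contour from `-i∞` to `+i∞`: the vertical ray from `start - i∞` up to `start`, then
the polygonal path through `start` and the vertices in `rest`, then the vertical ray from its last
vertex up to `+i∞`. -/
structure BarnesContour where
  start : ℂ
  rest : List ℂ

namespace BarnesContour

/-- The last vertex. -/
def last (L : BarnesContour) : ℂ := L.rest.getLastD L.start

/-- The vertices of the contour with both rays cut off at length `R`. -/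
noncomputable def truncate (L : BarnesContour) (R : ℝ) : List ℂ :=
  (L.start - R * Complex.I) :: L.start :: (L.rest ++ [L.last + R * Complex.I])

/-- The point `p` is not on the contour. -/
def Avoids (L : BarnesContour) (p : ℂ) : Prop :=
  ∀ R : ℝ, 0 < R → p ∉ polygonTrace (L.truncate R)

/-- The point `p` lies off the contour and to its left: the argument of `s - p` increases by a total
of `π` while `s` runs along the contour from `-i∞` to `+i∞`, that is, `∫ ds / (s - p) = π i`. -/
def HasOnLeft (L : BarnesContour) (p : ℂ) : Prop :=
  L.Avoids p ∧ Tendsto (fun R : ℝ => polygonIntegral (fun s => (s - p)⁻¹) (L.truncate R)) atTop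
    (𝓝 (π * Complex.I))

/-- The point `p` lies off the contour and to its right: the argument of `s - p` decreases by a
total of `π` while `s` runs along the contour, that is, `∫ ds / (s - p) = -π i`. -/
def HasOnRight (L : BarnesContour) (p : ℂ) : Prop :=
  L.Avoids p ∧ Tendsto (fun R : ℝ => polygonIntegral (fun s => (s - p)⁻¹) (L.truncate R)) atTop
    (𝓝 (-(π * Complex.I)))

/-- Absolute convergence, along the two rays, of the integral of `f` over the contour. -/
def IntegrableOnRays (L : BarnesContour) (f : ℂ → ℂ) : Prop :=
  IntegrableOn (fun τ : ℝ => f (L.start + τ * Complex.I)) (Iic 0) ∧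
    IntegrableOn (fun τ : ℝ => f (L.last + τ * Complex.I)) (Ici 0)

/-- The integral of `f` over the whole contour. -/
noncomputable def integral (L : BarnesContour) (f : ℂ → ℂ) : ℂ :=
  Complex.I * (∫ τ in Iic (0 : ℝ), f (L.start + τ * Complex.I))
    + polygonIntegral f (L.start :: L.rest)
    + Complex.I * (∫ τ in Ici (0 : ℝ), f (L.last + τ * Complex.I))

end BarnesContour

/-- The integrand of the Meijer function `G^{m,n}_{p,q}(z | a; b)`:
`∏_{j ≤ m} Γ(b_j - s) ∏_{j ≤ n} Γ(1 - a_j + s) z^s`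
divided by `∏_{j > m} Γ(1 - b_j + s) ∏_{j > n} Γ(a_j - s)`. -/
noncomputable def meijerIntegrand (m n : ℕ) {p q : ℕ} (z : ℂ) (a : Fin p → ℂ) (b : Fin q → ℂ)
    (s : ℂ) : ℂ :=
  (∏ j : Fin q, if (j : ℕ) < m then Complex.Gamma (b j - s)
      else (Complex.Gamma (1 - b j + s))⁻¹)
    * (∏ j : Fin p, if (j : ℕ) < n then Complex.Gamma (1 - a j + s)
      else (Complex.Gamma (a j - s))⁻¹)
    * z ^ s

/-- The contour separates the poles of the factors `Γ(1 - a_j + s)`, `j ≤ n` (on its left) from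
those of the factors `Γ(b_j - s)`, `j ≤ m` (on its right). -/
def IsMeijerContour (m n : ℕ) {p q : ℕ} (a : Fin p → ℂ) (b : Fin q → ℂ)
    (L : BarnesContour) : Prop :=
  (∀ j : Fin p, (j : ℕ) < n → ∀ k : ℕ, L.HasOnLeft (a j - 1 - k)) ∧
    (∀ j : Fin q, (j : ℕ) < m → ∀ k : ℕ, L.HasOnRight (b j + k))

/-- `g` is the value of the Meijer function `G^{m,n}_{p,q}(z | a; b)`: it is `1 / (2πi)` times the
absolutely convergent integral of the integrand over a contour from `-i∞` to `+i∞` that separates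
the two families of poles. By Cauchy's theorem the value does not depend on the contour; there is no
value if the two families of poles meet. -/
def IsMeijerG (m n : ℕ) {p q : ℕ} (z : ℂ) (a : Fin p → ℂ) (b : Fin q → ℂ) (g : ℂ) : Prop :=
  ∃ L : BarnesContour, IsMeijerContour m n a b L ∧
    L.IntegrableOnRays (meijerIntegrand m n z a b) ∧
    g = (2 * π * Complex.I)⁻¹ * L.integral (meijerIntegrand m n z a b)

/-! Since 1 − (1 − xy)z = (1 − z)(1 + X) with X = xyz/(1 − z), the denominator of the integrand
becomes a power of 1 − z times (1 + X)^d. Mellin inversion of a Beta integral writes Γ(d)(1 +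
X)^(−d), for d > 0, as (2πi)⁻¹ ∫ Γ(d + s)Γ(−s)X^s ds over a line Re s = σ with −d < σ < 0. After
Fubini the variables x, y, z separate into three Beta integrals, and these supply the remaining
Gamma factors of the Meijer integrand.

If d < 0, no vertical line has the poles of Γ(d + s) on its left and those of Γ(−s) on its right.
For N − 1 < −d < N, repeated integration of the representation for d + 1 gives a line −d < σ < N
together with the residues at 0, …, N − 1 (`Gamma_mul_one_add_rpow`, `Gamma_mul_J3_eq_line`). The
contour in (i) is that line with a clockwise loop attached around each of these N poles; the loops
contribute exactly the residues (`rectIntegral_Gamma_neg_mul`, `exists_isMeijerG`).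

For (ii) the z-integral is expanded first, with w = xy in (0, 1) fixed. Put q = c − d + 1. The line
is moved to the right across the poles at k and at q + k, which are simple because c − d is not an
integer. Far to the right, a unit step multiplies the integrand by roughly w, so the line integrals
die out geometrically and polynomial bounds for Γ suffice. The outcome is two series, in w^k and in
w^(q+k) (`Gamma_mul_euler_integral_eq_tsum`); if d is 0, −1, −2, …, the binomial theorem takes the
place of this argument (`hasSum_euler_integral`). Integrating over x and y term by term gives the
two ₄F₃ series at 1, and the interchange is legitimate because these converge absolutely
(`summable_pFqTerm_one`, `Gamma_mul_J3_eq_tsum`). -/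

/-! ### Residues on rectangles and shifts of vertical lines -/

/-- The integral of `f` over the boundary of the rectangle `[x₁, x₂] × [y₁, y₂]`, counterclockwise. -/
noncomputable def rectIntegral (f : ℂ → ℂ) (x₁ x₂ y₁ y₂ : ℝ) : ℂ :=
  (∫ x in x₁..x₂, f (x + y₁ * Complex.I)) - (∫ x in x₁..x₂, f (x + y₂ * Complex.I))
    + Complex.I * (∫ y in y₁..y₂, f (x₂ + y * Complex.I))
    - Complex.I * (∫ y in y₁..y₂, f (x₁ + y * Complex.I))

theorem rectIntegral_eq_zero {f : ℂ → ℂ} {x₁ x₂ y₁ y₂ : ℝ} (hx : x₁ ≤ x₂) (hy : y₁ ≤ y₂)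
    (hf : DifferentiableOn ℂ f (Icc x₁ x₂ ×ℂ Icc y₁ y₂)) : rectIntegral f x₁ x₂ y₁ y₂ = 0 := by
  have h := Complex.integral_boundary_rect_eq_zero_of_differentiableOn f ⟨x₁, y₁⟩ ⟨x₂, y₂⟩
    (by simpa [uIcc_of_le hx, uIcc_of_le hy] using hf)
  simpa [rectIntegral] using h

theorem integral_horizontal_inv {p y : ℝ} (hy : y ≠ 0) (x₁ x₂ : ℝ) :
    ∫ x in x₁..x₂, ((x : ℂ) + y * Complex.I - p)⁻¹ =
      Complex.log (x₂ + y * Complex.I - p) - Complex.log (x₁ + y * Complex.I - p) := by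
  have hs : ∀ x : ℝ, (x : ℂ) + y * Complex.I - p ∈ Complex.slitPlane := fun x =>
    Complex.mem_slitPlane_iff.2 (Or.inr (by simpa using hy))
  refine intervalIntegral.integral_eq_sub_of_hasDerivAt
    (f := fun x : ℝ => Complex.log (x + y * Complex.I - p)) (fun x _ => ?_) ?_
  · have h : HasDerivAt (fun x : ℝ => (x : ℂ) + y * Complex.I - p) 1 x :=
      ((Complex.ofRealCLM.hasDerivAt (x := x)).add_const _).sub_const _
    simpa using h.clog_real (hs x)
  · refine ContinuousOn.intervalIntegrable fun x _ => ContinuousAt.continuousWithinAt ?_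
    exact ContinuousAt.inv₀ (by fun_prop) (Complex.slitPlane_ne_zero (hs x))

theorem integral_vertical_inv_of_lt {p x : ℝ} (hx : p < x) (y₁ y₂ : ℝ) :
    Complex.I * ∫ y in y₁..y₂, ((x : ℂ) + y * Complex.I - p)⁻¹ =
      Complex.log (x + y₂ * Complex.I - p) - Complex.log (x + y₁ * Complex.I - p) := by
  have hs : ∀ y : ℝ, (x : ℂ) + y * Complex.I - p ∈ Complex.slitPlane := fun y =>
    Complex.mem_slitPlane_iff.2 (Or.inl (by simpa using hx))
  rw [← intervalIntegral.integral_const_mul]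
  refine intervalIntegral.integral_eq_sub_of_hasDerivAt
    (f := fun y : ℝ => Complex.log (x + y * Complex.I - p)) (fun y _ => ?_) ?_
  · have h : HasDerivAt (fun y : ℝ => (x : ℂ) + y * Complex.I - p) (1 * Complex.I) y :=
      (((Complex.ofRealCLM.hasDerivAt (x := y)).mul_const _).const_add _).sub_const _
    simpa [div_eq_mul_inv] using h.clog_real (hs y)
  · refine ContinuousOn.intervalIntegrable fun y _ => ContinuousAt.continuousWithinAt ?_
    exact continuousAt_const.mul
      (ContinuousAt.inv₀ (by fun_prop) (Complex.slitPlane_ne_zero (hs y)))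

/-- To the left of p the edge crosses the cut of the logarithm of z − p, so log(−(z − p)) serves as
primitive. -/
theorem integral_vertical_inv_of_gt {p x : ℝ} (hx : x < p) (y₁ y₂ : ℝ) :
    Complex.I * ∫ y in y₁..y₂, ((x : ℂ) + y * Complex.I - p)⁻¹ =
      Complex.log (-(x + y₂ * Complex.I - p)) - Complex.log (-(x + y₁ * Complex.I - p)) := by
  have hs : ∀ y : ℝ, -((x : ℂ) + y * Complex.I - p) ∈ Complex.slitPlane := fun y =>
    Complex.mem_slitPlane_iff.2 (Or.inl (by simpa using hx))
  rw [← intervalIntegral.integral_const_mul]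
  refine intervalIntegral.integral_eq_sub_of_hasDerivAt
    (f := fun y : ℝ => Complex.log (-(x + y * Complex.I - p))) (fun y _ => ?_) ?_
  · have h : HasDerivAt (fun y : ℝ => -((x : ℂ) + y * Complex.I - p)) (-(1 * Complex.I)) y :=
      ((((Complex.ofRealCLM.hasDerivAt (x := y)).mul_const _).const_add _).sub_const _).neg
    have h2 := h.clog_real (hs y)
    rwa [one_mul, neg_div_neg_eq, div_eq_mul_inv] at h2
  · refine ContinuousOn.intervalIntegrable fun y _ => ContinuousAt.continuousWithinAt ?_
    refine continuousAt_const.mul (ContinuousAt.inv₀ (by fun_prop) ?_)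
    exact neg_ne_zero.1 (Complex.slitPlane_ne_zero (hs y))

theorem Complex.log_neg_of_im_pos {z : ℂ} (hz : 0 < z.im) :
    Complex.log (-z) = Complex.log z - π * Complex.I := by
  apply Complex.ext
  · simp [Complex.log_re]
  · simp [Complex.log_im, Complex.arg_neg_eq_arg_sub_pi_of_im_pos hz]

theorem Complex.log_neg_of_im_neg {z : ℂ} (hz : z.im < 0) :
    Complex.log (-z) = Complex.log z + π * Complex.I := by
  apply Complex.ext
  · simp [Complex.log_re]
  · simp [Complex.log_im, Complex.arg_neg_eq_arg_add_pi_of_im_neg hz]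

/-- Three edges use log(z − p) and the left one log(−(z − p)). At the two left corners these differ
by ±πi, and the two differences add up to 2πi. -/
theorem rectIntegral_inv {p x₁ x₂ y₁ y₂ : ℝ} (h1 : x₁ < p) (h2 : p < x₂) (h3 : y₁ < 0)
    (h4 : 0 < y₂) : rectIntegral (fun z => (z - p)⁻¹) x₁ x₂ y₁ y₂ = 2 * π * Complex.I := by
  rw [rectIntegral, integral_horizontal_inv h3.ne, integral_horizontal_inv h4.ne',
    integral_vertical_inv_of_lt h2, integral_vertical_inv_of_gt h1,
    Complex.log_neg_of_im_pos (by simpa using h4), Complex.log_neg_of_im_neg (by simpa using h3)]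
  ring

theorem continuous_horizontal (y : ℝ) : Continuous fun x : ℝ => (x : ℂ) + y * Complex.I := by
  fun_prop

theorem continuous_vertical (x : ℝ) : Continuous fun y : ℝ => (x : ℂ) + y * Complex.I := by
  fun_prop

/-- `f` is continuous on the boundary of a rectangle. -/
def ContinuousOnRect (f : ℂ → ℂ) (x₁ x₂ y₁ y₂ : ℝ) : Prop :=
  ContinuousOn (fun x : ℝ => f (x + y₁ * Complex.I)) (uIcc x₁ x₂) ∧
  ContinuousOn (fun x : ℝ => f (x + y₂ * Complex.I)) (uIcc x₁ x₂) ∧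
  ContinuousOn (fun y : ℝ => f (x₂ + y * Complex.I)) (uIcc y₁ y₂) ∧
  ContinuousOn (fun y : ℝ => f (x₁ + y * Complex.I)) (uIcc y₁ y₂)

theorem rectIntegral_add {f g : ℂ → ℂ} {x₁ x₂ y₁ y₂ : ℝ} (hf : ContinuousOnRect f x₁ x₂ y₁ y₂)
    (hg : ContinuousOnRect g x₁ x₂ y₁ y₂) :
    rectIntegral (fun z => f z + g z) x₁ x₂ y₁ y₂ =
      rectIntegral f x₁ x₂ y₁ y₂ + rectIntegral g x₁ x₂ y₁ y₂ := by
  simp only [rectIntegral]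
  rw [intervalIntegral.integral_add hf.1.intervalIntegrable hg.1.intervalIntegrable,
    intervalIntegral.integral_add hf.2.1.intervalIntegrable hg.2.1.intervalIntegrable,
    intervalIntegral.integral_add hf.2.2.1.intervalIntegrable hg.2.2.1.intervalIntegrable,
    intervalIntegral.integral_add hf.2.2.2.intervalIntegrable hg.2.2.2.intervalIntegrable]
  ring

theorem rectIntegral_const_mul (c : ℂ) (f : ℂ → ℂ) (x₁ x₂ y₁ y₂ : ℝ) :
    rectIntegral (fun z => c * f z) x₁ x₂ y₁ y₂ = c * rectIntegral f x₁ x₂ y₁ y₂ := by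
  simp only [rectIntegral, intervalIntegral.integral_const_mul]
  ring

theorem rectIntegral_congr {f g : ℂ → ℂ} {x₁ x₂ y₁ y₂ : ℝ} (hx : x₁ ≤ x₂) (hy : y₁ ≤ y₂)
    (h : ∀ z : ℂ, z.re ∈ Icc x₁ x₂ → z.im ∈ Icc y₁ y₂ →
      (z.re = x₁ ∨ z.re = x₂ ∨ z.im = y₁ ∨ z.im = y₂) → f z = g z) :
    rectIntegral f x₁ x₂ y₁ y₂ = rectIntegral g x₁ x₂ y₁ y₂ := by
  simp only [rectIntegral]
  congr 2
  · refine congrArg₂ _ ?_ ?_ <;> refine intervalIntegral.integral_congr fun t ht => ?_ <;>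
      rw [uIcc_of_le hx] at ht <;> apply h <;> simp [ht.1, ht.2, hy]
  · congr 1; refine intervalIntegral.integral_congr fun t ht => ?_
    rw [uIcc_of_le hy] at ht; apply h <;> simp [ht.1, ht.2, hx]
  · refine intervalIntegral.integral_congr fun t ht => ?_
    rw [uIcc_of_le hy] at ht; apply h <;> simp [ht.1, ht.2, hx]

theorem continuousOnRect_of_continuousOn {f : ℂ → ℂ} {x₁ x₂ y₁ y₂ : ℝ} (hx : x₁ ≤ x₂)
    (hy : y₁ ≤ y₂) (hf : ContinuousOn f {z | z.re ∈ Icc x₁ x₂ ∧ z.im ∈ Icc y₁ y₂ ∧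
      (z.re = x₁ ∨ z.re = x₂ ∨ z.im = y₁ ∨ z.im = y₂)}) : ContinuousOnRect f x₁ x₂ y₁ y₂ := by
  refine ⟨?_, ?_, ?_, ?_⟩
  · refine hf.comp (continuous_horizontal y₁).continuousOn fun t ht => ?_
    rw [uIcc_of_le hx] at ht; simp [ht.1, ht.2, hy]
  · refine hf.comp (continuous_horizontal y₂).continuousOn fun t ht => ?_
    rw [uIcc_of_le hx] at ht; simp [ht.1, ht.2, hy]
  · refine hf.comp (continuous_vertical x₂).continuousOn fun t ht => ?_
    rw [uIcc_of_le hy] at ht; simp [ht.1, ht.2, hx]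
  · refine hf.comp (continuous_vertical x₁).continuousOn fun t ht => ?_
    rw [uIcc_of_le hy] at ht; simp [ht.1, ht.2, hx]

/-- Cauchy's integral formula for a rectangle and a point on the real line. -/
theorem rectIntegral_div_sub {g : ℂ → ℂ} {p x₁ x₂ y₁ y₂ : ℝ} (h1 : x₁ < p) (h2 : p < x₂)
    (h3 : y₁ < 0) (h4 : 0 < y₂) (hg : DifferentiableOn ℂ g (Icc x₁ x₂ ×ℂ Icc y₁ y₂)) :
    rectIntegral (fun z => g z / (z - p)) x₁ x₂ y₁ y₂ = 2 * π * Complex.I * g p := by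
  have hx := (h1.trans h2).le
  have hy := (h3.trans h4).le
  have hnhds : Icc x₁ x₂ ×ℂ Icc y₁ y₂ ∈ 𝓝 (p : ℂ) := by
    refine mem_of_superset ((isOpen_Ioo.reProdIm isOpen_Ioo).mem_nhds ?_)
      (inter_subset_inter (preimage_mono (Ioo_subset_Icc_self (a := x₁) (b := x₂)))
        (preimage_mono (Ioo_subset_Icc_self (a := y₁) (b := y₂))))
    exact ⟨⟨by simpa using h1, by simpa using h2⟩, ⟨by simpa using h3, by simpa using h4⟩⟩
  -- The divided difference of g at p is holomorphic, so g(z)/(z − p) is a holomorphic function plus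
  -- g(p)/(z − p).
  have hd := (Complex.differentiableOn_dslope hnhds).2 hg
  have hne : ∀ z : ℂ, (z.re = x₁ ∨ z.re = x₂ ∨ z.im = y₁ ∨ z.im = y₂) → z ≠ p := by
    rintro z hz rfl
    simp only [Complex.ofReal_re, Complex.ofReal_im] at hz
    rcases hz with h | h | h | h <;> linarith
  have key : rectIntegral (fun z => g z / (z - p)) x₁ x₂ y₁ y₂ =
      rectIntegral (fun z => dslope g p z + g p * (z - p)⁻¹) x₁ x₂ y₁ y₂ := by
    refine rectIntegral_congr hx hy fun z _ _ hz => ?_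
    have := sub_ne_zero.2 (hne z hz)
    rw [dslope_of_ne _ (hne z hz), slope_def_field]
    field_simp
    ring
  rw [key, rectIntegral_add, rectIntegral_const_mul, rectIntegral_inv h1 h2 h3 h4,
    rectIntegral_eq_zero hx hy hd]
  · ring
  · exact continuousOnRect_of_continuousOn hx hy (hd.continuousOn.mono fun z hz => ⟨hz.1, hz.2.1⟩)
  · refine continuousOnRect_of_continuousOn hx hy fun z hz => ContinuousAt.continuousWithinAt ?_
    exact continuousAt_const.mul
      (ContinuousAt.inv₀ (by fun_prop) (sub_ne_zero.2 (hne z hz.2.2)))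

/-- The residue theorem for a rectangle and two simple poles on the real line. -/
theorem rectIntegral_div_sub_mul_sub {g : ℂ → ℂ} {p q x₁ x₂ y₁ y₂ : ℝ} (h1 : x₁ < p) (h2 : p < x₂)
    (k1 : x₁ < q) (k2 : q < x₂) (hpq : p ≠ q) (h3 : y₁ < 0) (h4 : 0 < y₂)
    (hg : DifferentiableOn ℂ g (Icc x₁ x₂ ×ℂ Icc y₁ y₂)) :
    rectIntegral (fun z => g z / ((z - p) * (z - q))) x₁ x₂ y₁ y₂ =
      2 * π * Complex.I * ((g p - g q) / (p - q)) := by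
  have hx := (h1.trans h2).le
  have hy := (h3.trans h4).le
  have hne : ∀ r : ℝ, x₁ < r → r < x₂ → ∀ z : ℂ,
      (z.re = x₁ ∨ z.re = x₂ ∨ z.im = y₁ ∨ z.im = y₂) → z - r ≠ 0 := by
    intro r hr1 hr2 z hz h0
    rw [sub_eq_zero] at h0
    subst h0
    simp only [Complex.ofReal_re, Complex.ofReal_im] at hz
    rcases hz with h | h | h | h <;> linarith
  have hpq' : (p : ℂ) - q ≠ 0 := sub_ne_zero.2 (by exact_mod_cast hpq)
  have hcont : ∀ r : ℝ, x₁ < r → r < x₂ → ContinuousOnRect (fun z => g z / (z - r)) x₁ x₂ y₁ y₂ :=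
    fun r hr1 hr2 => continuousOnRect_of_continuousOn hx hy
      ((hg.continuousOn.mono fun z hz => ⟨hz.1, hz.2.1⟩).div (by fun_prop)
        fun z hz => hne r hr1 hr2 z hz.2.2)
  -- Partial fractions reduce to one pole at a time.
  have key : rectIntegral (fun z => g z / ((z - p) * (z - q))) x₁ x₂ y₁ y₂ =
      rectIntegral (fun z => ((p : ℂ) - q)⁻¹ * (g z / (z - p) + -1 * (g z / (z - q))))
        x₁ x₂ y₁ y₂ := by
    refine rectIntegral_congr hx hy fun z _ _ hz => ?_
    have e1 := hne p h1 h2 z hz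
    have e2 := hne q k1 k2 z hz
    field_simp
    ring
  rw [key, rectIntegral_const_mul, rectIntegral_add (hcont p h1 h2), rectIntegral_const_mul,
    rectIntegral_div_sub h1 h2 h3 h4 hg, rectIntegral_div_sub k1 k2 h3 h4 hg]
  · field_simp
    ring
  · obtain ⟨c1, c2, c3, c4⟩ := hcont q k1 k2
    exact ⟨continuousOn_const.mul c1, continuousOn_const.mul c2, continuousOn_const.mul c3,
      continuousOn_const.mul c4⟩

/-- Shifting a vertical line of integration across two simple poles on the real line. -/
theorem integral_line_sub_integral_line {f g : ℂ → ℂ} {p q x₁ x₂ C : ℝ} (h1 : x₁ < p) (h2 : p < x₂)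
    (k1 : x₁ < q) (k2 : q < x₂) (hpq : p ≠ q)
    (hg : DifferentiableOn ℂ g {z | z.re ∈ Icc x₁ x₂})
    (hfg : ∀ z : ℂ, z.re ∈ Icc x₁ x₂ → z ≠ p → z ≠ q → f z = g z / ((z - p) * (z - q)))
    (hbound : ∀ z : ℂ, z.re ∈ Icc x₁ x₂ → 1 ≤ |z.im| → ‖f z‖ ≤ C / z.im ^ 2)
    (hf1 : Integrable fun y : ℝ => f (x₁ + y * Complex.I))
    (hf2 : Integrable fun y : ℝ => f (x₂ + y * Complex.I)) :
    (∫ y : ℝ, f (x₂ + y * Complex.I)) - ∫ y : ℝ, f (x₁ + y * Complex.I) =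
      2 * π * ((g p - g q) / (p - q)) := by
  have hx := (h1.trans h2).le
  have hrect : ∀ T : ℝ, 0 < T → rectIntegral f x₁ x₂ (-T) T =
      2 * π * Complex.I * ((g p - g q) / (p - q)) := by
    intro T hT
    rw [← rectIntegral_div_sub_mul_sub h1 h2 k1 k2 hpq (neg_lt_zero.2 hT) hT
      (hg.mono fun z hz => hz.1)]
    refine rectIntegral_congr hx (by linarith) fun z hz _ hb => hfg z hz ?_ ?_ <;>
    · rintro rfl
      simp only [Complex.ofReal_re, Complex.ofReal_im] at hb
      rcases hb with h | h | h | h <;> linarith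
  -- The horizontal edges at height ±T contribute O(1/T²); the sign s treats both together.
  have hhor : ∀ s : ℝ, s = 1 ∨ s = -1 → Tendsto (fun T : ℝ =>
      ∫ x in x₁..x₂, f (x + (s * T : ℝ) * Complex.I)) atTop (𝓝 0) := by
    intro s hs
    have hs2 : s ^ 2 = 1 := by rcases hs with rfl | rfl <;> norm_num
    have hsa : |s| = 1 := by rcases hs with rfl | rfl <;> norm_num
    have hlim : Tendsto (fun T : ℝ => C / T ^ 2 * |x₂ - x₁|) atTop (𝓝 0) := by
      have := (tendsto_const_nhds (x := C)).div_atTop (tendsto_pow_atTop (α := ℝ) two_ne_zero)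
      simpa using this.mul_const |x₂ - x₁|
    refine squeeze_zero_norm' ?_ hlim
    filter_upwards [eventually_ge_atTop 1] with T hT
    refine intervalIntegral.norm_integral_le_of_norm_le_const fun x hxm => ?_
    rw [uIoc_of_le hx] at hxm
    refine (hbound _ (by simpa using ⟨hxm.1.le, hxm.2⟩) ?_).trans_eq ?_
    · simpa [abs_mul, hsa] using hT.trans (le_abs_self T)
    · simp [mul_pow, hs2]
  have hv : ∀ x : ℝ, Integrable (fun y : ℝ => f (x + y * Complex.I)) →
      Tendsto (fun T : ℝ => ∫ y in (-T)..T, f (x + y * Complex.I)) atTop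
        (𝓝 (∫ y : ℝ, f (x + y * Complex.I))) := fun x hxi =>
    intervalIntegral_tendsto_integral hxi tendsto_neg_atTop_atBot tendsto_id
  have hlim : Tendsto (fun T : ℝ => rectIntegral f x₁ x₂ (-T) T) atTop
      (𝓝 (0 - 0 + Complex.I * (∫ y : ℝ, f (x₂ + y * Complex.I))
        - Complex.I * ∫ y : ℝ, f (x₁ + y * Complex.I))) := by
    refine (((?_ : Tendsto _ _ _).sub ?_).add ((hv x₂ hf2).const_mul _)).sub ((hv x₁ hf1).const_mul _)
    · simpa using hhor (-1) (Or.inr rfl)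
    · simpa using hhor 1 (Or.inl rfl)
  have huniq := tendsto_nhds_unique hlim (tendsto_const_nhds.congr'
    ((eventually_gt_atTop 0).mono fun T hT => (hrect T hT).symm))
  have hI : Complex.I * ((∫ y : ℝ, f (x₂ + y * Complex.I)) - ∫ y : ℝ, f (x₁ + y * Complex.I)) =
      Complex.I * (2 * π * ((g p - g q) / (p - q))) := by
    rw [mul_sub]; linear_combination huniq
  exact mul_left_cancel₀ Complex.I_ne_zero hI

/-! ### Polynomial decay of Γ along vertical lines -/

theorem Complex.norm_Gamma_le {z : ℂ} (hz : 0 < z.re) : ‖Complex.Gamma z‖ ≤ Real.Gamma z.re := by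
  rw [Complex.Gamma_eq_integral hz, Real.Gamma_eq_integral hz, Complex.GammaIntegral]
  refine (norm_integral_le_integral_norm _).trans_eq (setIntegral_congr_fun measurableSet_Ioi ?_)
  intro x hx
  have hx : 0 < x := hx
  simp only [norm_mul, Complex.norm_cpow_eq_rpow_re_of_pos hx, Complex.norm_real, Real.norm_eq_abs,
    abs_of_pos (Real.exp_pos _), Complex.sub_re, Complex.one_re]

/-- Γ(z) = Γ(z + 1)/z with |z| ≥ |Im z|, applied n times. Decay of order two is all that the
integrals below need. -/
theorem Complex.norm_Gamma_le_div_pow (n : ℕ) : ∀ {z : ℂ}, 0 < z.re + n → z.im ≠ 0 →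
    ‖Complex.Gamma z‖ ≤ Real.Gamma (z.re + n) / |z.im| ^ n := by
  induction n with
  | zero => intro z hz _; simpa using Complex.norm_Gamma_le (by simpa using hz)
  | succ n ih =>
    intro z hz him
    have hz0 : z ≠ 0 := fun h => him (by simp [h])
    have h := ih (z := z + 1) (by push_cast at hz; simp only [Complex.add_re, Complex.one_re]; linarith) (by simpa using him)
    rw [Complex.Gamma_add_one z hz0, norm_mul] at h
    simp only [Complex.add_re, Complex.one_re, Complex.add_im, Complex.one_im, add_zero] at h
    have hpos : 0 < |z.im| := abs_pos.2 him
    rw [pow_succ, ← div_div, le_div_iff₀ hpos, mul_comm]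
    push_cast
    rw [show z.re + (n + 1 : ℝ) = z.re + 1 + n by ring]
    exact (mul_le_mul_of_nonneg_right (Complex.abs_im_le_norm z) (norm_nonneg _)).trans h

/-- Shifting by k + m moves the strip into the right half-plane, where Γ is bounded by its values on
a compact real interval. The m surplus powers of |Im z| ≥ 1 are dropped. -/
theorem Complex.exists_norm_Gamma_le (x₁ x₂ : ℝ) (k : ℕ) : ∃ C : ℝ, 0 ≤ C ∧ ∀ z : ℂ,
    z.re ∈ Icc x₁ x₂ → 1 ≤ |z.im| → ‖Complex.Gamma z‖ ≤ C / |z.im| ^ k := by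
  obtain ⟨m, hm⟩ := exists_nat_gt (-x₁)
  have hpos : ∀ x ∈ Icc x₁ x₂, 0 < x + (k + m : ℕ) := by
    intro x hx
    have := hx.1
    push_cast
    have hk : (0 : ℝ) ≤ k := k.cast_nonneg
    linarith
  have hcont : ContinuousOn (fun x : ℝ => Real.Gamma (x + (k + m : ℕ))) (Icc x₁ x₂) :=
    Real.differentiableOn_Gamma_Ioi.continuousOn.comp (by fun_prop) hpos
  obtain ⟨C, hC⟩ := isCompact_Icc.exists_bound_of_continuousOn hcont
  refine ⟨max C 0, le_max_right _ _, fun z hz him => ?_⟩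
  have him0 : 0 < |z.im| := by linarith
  refine (Complex.norm_Gamma_le_div_pow (k + m) (hpos _ hz) (abs_pos.1 him0)).trans ?_
  refine div_le_div₀ (le_max_right _ _) ?_ (by positivity) (pow_le_pow_right₀ him (by omega))
  exact (le_abs_self _).trans ((hC _ hz).trans (le_max_left _ _))

theorem integrable_of_continuous_of_norm_le {f : ℝ → ℂ} (hf : Continuous f) {C : ℝ}
    (hC : ∀ y : ℝ, 1 ≤ |y| → ‖f y‖ ≤ C / y ^ 2) : Integrable f := by
  obtain ⟨M, hM⟩ := (isCompact_Icc (a := (-1 : ℝ)) (b := 1)).exists_bound_of_continuousOn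
    hf.continuousOn
  -- The factor 2 serves both ranges: 1 + y² ≤ 2 for |y| ≤ 1 and 1 + y² ≤ 2y² for |y| ≥ 1.
  refine ((integrable_inv_one_add_sq.const_mul (2 * max M C))).mono' hf.aestronglyMeasurable
    (Eventually.of_forall fun y => ?_)
  have hpos : 0 < 1 + y ^ 2 := by positivity
  rw [← div_eq_mul_inv, le_div_iff₀ hpos]
  have hn := norm_nonneg (f y)
  rcases le_total |y| 1 with hy | hy
  · have h1 : y ^ 2 ≤ 1 := (sq_le_one_iff_abs_le_one y).2 hy
    have h2 : ‖f y‖ ≤ max M C := (hM y (abs_le.1 hy)).trans (le_max_left _ _)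
    nlinarith
  · have h1 : 1 ≤ y ^ 2 := (one_le_sq_iff_one_le_abs y).2 hy
    have h2 := hC y hy
    rw [le_div_iff₀ (by positivity)] at h2
    have h3 := le_max_right M C
    nlinarith

theorem continuous_Gamma_line {x : ℝ} (hx : ∀ m : ℕ, x ≠ -m) (s : ℝ) :
    Continuous fun y : ℝ => Complex.Gamma (x + (s * y : ℝ) * Complex.I) := by
  refine continuous_iff_continuousAt.2 fun y => ?_
  refine ContinuousAt.comp (f := fun y : ℝ => (x : ℂ) + (s * y : ℝ) * Complex.I)
    (Complex.continuousAt_Gamma _ fun m h => hx m ?_) (by fun_prop)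
  simpa using congrArg Complex.re h

/-! ### The Mellin–Barnes representation of a binomial power -/

/-- Written as exponentials, products of powers can be compared through linear identities between
exponents. -/
theorem ofReal_cpow_eq_exp {x : ℝ} (hx : 0 < x) (s : ℂ) :
    (x : ℂ) ^ s = Complex.exp (s * (Real.log x : ℝ)) := by
  rw [Complex.cpow_def_of_ne_zero (by exact_mod_cast hx.ne'), Complex.ofReal_log hx.le, mul_comm]

theorem ofReal_rpow_eq_exp {x : ℝ} (hx : 0 < x) (s : ℝ) :
    ((x ^ s : ℝ) : ℂ) = Complex.exp (s * (Real.log x : ℝ)) := by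
  rw [Complex.ofReal_cpow hx.le, ofReal_cpow_eq_exp hx]

/-- Interchanging a vertical line integral of powers with another integration. -/
theorem integral_mul_integral_cpow {α : Type*} [MeasurableSpace α] {μ : Measure α} [SFinite μ]
    {X : α → ℝ} (hX : Measurable X) (hpos : ∀ᵐ v ∂μ, 0 < X v) {W : α → ℂ}
    (hW : Measurable W) {σ : ℝ} (hWX : Integrable (fun v => ‖W v‖ * X v ^ σ) μ) {G : ℝ → ℂ}
    (hG : Integrable G) :
    Integrable (fun v => W v * ∫ y : ℝ, G y * (X v : ℂ) ^ (σ + y * Complex.I)) μ ∧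
    Integrable (fun y : ℝ => G y * ∫ v, W v * (X v : ℂ) ^ (σ + y * Complex.I) ∂μ) ∧
    ∫ v, W v * (∫ y : ℝ, G y * (X v : ℂ) ^ (σ + y * Complex.I)) ∂μ =
      ∫ y : ℝ, G y * ∫ v, W v * (X v : ℂ) ^ (σ + y * Complex.I) ∂μ := by
  -- The modulus of X^(σ + iy) is X^σ for every y, so the integrand on the product is dominated by a
  -- product of integrable functions.
  have hint : Integrable (Function.uncurry fun (v : α) (y : ℝ) =>
      W v * (G y * (X v : ℂ) ^ (σ + y * Complex.I))) (μ.prod volume) := by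
    refine (hWX.mul_prod hG.norm).mono' ?_ ?_
    · refine (hW.comp measurable_fst).aestronglyMeasurable.mul
        (hG.aestronglyMeasurable.comp_snd.mul (Measurable.aestronglyMeasurable ?_))
      exact (Complex.measurable_ofReal.comp (hX.comp measurable_fst)).pow (by fun_prop)
    · have h := Measure.quasiMeasurePreserving_fst (μ := μ) (ν := (volume : Measure ℝ)) |>.ae hpos
      filter_upwards [h] with v hv
      simp only [Function.uncurry, norm_mul, Complex.norm_cpow_eq_rpow_re_of_pos hv]
      simp only [Complex.add_re, Complex.ofReal_re, Complex.mul_re, Complex.I_re, mul_zero,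
        Complex.ofReal_im, Complex.I_im, mul_one, sub_self, add_zero]
      exact le_of_eq (by ring)
  refine ⟨?_, ?_, ?_⟩
  · simpa only [Function.uncurry, integral_const_mul] using hint.integral_prod_left
  · have h := hint.integral_prod_right
    refine h.congr (Eventually.of_forall fun y => ?_)
    simp only [Function.uncurry]
    rw [← integral_const_mul]
    exact integral_congr_ae (Eventually.of_forall fun v => by ring)
  · simp only [← integral_const_mul]
    rw [integral_integral_swap hint]
    exact integral_congr_ae (Eventually.of_forall fun y => integral_congr_ae
      (Eventually.of_forall fun v => by ring))

theorem image_div_one_sub : (fun u : ℝ => u / (1 - u)) '' Ioo 0 1 = Ioi 0 := by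
  ext x
  constructor
  · rintro ⟨u, ⟨h0, h1⟩, rfl⟩
    exact div_pos h0 (by linarith)
  · intro hx
    have hx : 0 < x := hx
    refine ⟨x / (1 + x), ⟨by positivity, (div_lt_one (by positivity)).2 (by linarith)⟩, ?_⟩
    field_simp
    ring

/-- The substitution x = u/(1 − u) turns the Mellin integral into the Beta integral B(s, d − s). -/
theorem mellin_one_add_rpow {d : ℝ} {s : ℂ} (hs : 0 < s.re) (hsd : s.re < d) :
    MellinConvergent (fun x : ℝ => (((1 + x) ^ (-d) : ℝ) : ℂ)) s ∧
      mellin (fun x : ℝ => (((1 + x) ^ (-d) : ℝ) : ℂ)) s =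
        Complex.Gamma s * Complex.Gamma (d - s) / Complex.Gamma d := by
  have hderiv : ∀ u ∈ Ioo (0 : ℝ) 1,
      HasDerivWithinAt (fun u : ℝ => u / (1 - u)) (1 / (1 - u) ^ 2) (Ioo 0 1) u := by
    intro u hu
    have hu1 : 1 - u ≠ 0 := by linarith [hu.2]
    have h := (hasDerivAt_id u).div ((hasDerivAt_id u).const_sub 1) hu1
    refine (h.congr_deriv ?_).hasDerivWithinAt
    simp
  have hinj : InjOn (fun u : ℝ => u / (1 - u)) (Ioo 0 1) := by
    intro u hu v hv h
    have hu1 : 1 - u ≠ 0 := by linarith [hu.2]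
    have hv1 : 1 - v ≠ 0 := by linarith [hv.2]
    simp only at h
    rw [div_eq_div_iff hu1 hv1] at h
    linarith
  have hpt : EqOn (fun u : ℝ => |1 / (1 - u) ^ 2| • (((u / (1 - u) : ℝ) : ℂ) ^ (s - 1) •
      (((1 + u / (1 - u)) ^ (-d) : ℝ) : ℂ)))
      (fun u : ℝ => (u : ℂ) ^ (s - 1) * (1 - (u : ℂ)) ^ ((d - s) - 1)) (Ioo 0 1) := by
    intro u hu
    have hu0 : 0 < u := hu.1
    have hu1 : 0 < 1 - u := by linarith [hu.2]
    have e1 : 1 + u / (1 - u) = (1 - u)⁻¹ := by field_simp; ring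
    have e2 : |1 / (1 - u) ^ 2| = (1 - u) ^ (-2 : ℝ) := by
      rw [abs_of_pos (by positivity), Real.rpow_neg hu1.le]; norm_num
    simp only [Complex.real_smul, smul_eq_mul]
    rw [e1, e2, show (1 : ℂ) - u = ((1 - u : ℝ) : ℂ) by push_cast; ring,
      ofReal_rpow_eq_exp hu1, ofReal_rpow_eq_exp (inv_pos.2 hu1),
      ofReal_cpow_eq_exp (div_pos hu0 hu1), ofReal_cpow_eq_exp hu0, ofReal_cpow_eq_exp hu1,
      Real.log_div hu0.ne' hu1.ne', Real.log_inv, ← Complex.exp_add, ← Complex.exp_add,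
      ← Complex.exp_add]
    congr 1
    push_cast
    ring
  have hds : 0 < ((d : ℂ) - s).re := by simpa using hsd
  have hbeta := Complex.betaIntegral_convergent hs hds
  rw [intervalIntegrable_iff_integrableOn_Ioo_of_le zero_le_one] at hbeta
  constructor
  · rw [MellinConvergent, ← image_div_one_sub,
      integrableOn_image_iff_integrableOn_abs_deriv_smul measurableSet_Ioo hderiv hinj]
    exact hbeta.congr_fun hpt.symm measurableSet_Ioo
  · rw [mellin, ← image_div_one_sub,
      integral_image_eq_integral_abs_deriv_smul measurableSet_Ioo hderiv hinj,
      setIntegral_congr_fun measurableSet_Ioo hpt, ← integral_Ioc_eq_integral_Ioo,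
      ← intervalIntegral.integral_of_le zero_le_one]
    have := Complex.betaIntegral_eq_Gamma_mul_div s (d - s) hs hds
    rw [add_sub_cancel] at this
    exact this

/-- The factor Γ(d + s) is bounded by Γ(d + σ) on the line, and Γ(−s) supplies the decay 1/y². -/
theorem integrable_Gamma_mul_Gamma_line {d σ : ℝ} (h1 : -d < σ) (h2 : ∀ m : ℕ, σ ≠ m) :
    Integrable fun y : ℝ => Complex.Gamma (d + (σ + y * Complex.I)) *
      Complex.Gamma (-(σ + y * Complex.I)) := by
  obtain ⟨C, hC0, hC⟩ := Complex.exists_norm_Gamma_le (-σ) (-σ) 2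
  refine integrable_of_continuous_of_norm_le (C := Real.Gamma (d + σ) * C) ?_ fun y hy => ?_
  · have c1 := continuous_Gamma_line (x := d + σ) (fun m h => by
      have : (0 : ℝ) ≤ m := m.cast_nonneg
      linarith) 1
    have c2 := continuous_Gamma_line (x := -σ) (fun m h => h2 m (by linarith)) (-1)
    refine (c1.mul c2).congr fun y => ?_
    simp only [Pi.mul_apply]
    congr 2 <;> push_cast <;> ring
  · rw [norm_mul, mul_div_assoc]
    have g1 := Complex.norm_Gamma_le (z := d + (σ + y * Complex.I)) (by simp; linarith)
    have g2 := hC (-(σ + y * Complex.I)) (by simp) (by simpa using hy)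
    simp only [Complex.neg_im, Complex.add_im, Complex.ofReal_im, Complex.mul_im, Complex.ofReal_re,
      Complex.I_im, mul_one, Complex.I_re, mul_zero, add_zero, zero_add, abs_neg, sq_abs] at g2
    simp only [Complex.add_re, Complex.ofReal_re, Complex.mul_re, Complex.I_re, mul_zero,
        Complex.ofReal_im, Complex.I_im, mul_one, sub_self, add_zero] at g1
    exact mul_le_mul g1 g2 (norm_nonneg _) ((norm_nonneg _).trans g1)

/-- Mellin inversion on the abscissa −σ, which lies in the strip (0, d); replacing y by −y changes
X^(−s) into X^s. -/
theorem Gamma_mul_one_add_rpow_of_neg {d σ : ℝ} (h1 : -d < σ) (h2 : σ < 0) {x : ℝ} (hx : 0 < x) :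
    Complex.Gamma d * (((1 + x) ^ (-d) : ℝ) : ℂ) =
      1 / (2 * π) * ∫ y : ℝ, Complex.Gamma (d + (σ + y * Complex.I)) *
        Complex.Gamma (-(σ + y * Complex.I)) * (x : ℂ) ^ (σ + y * Complex.I) := by
  have hd : 0 < d := by linarith
  have hGd : Complex.Gamma d ≠ 0 := Complex.Gamma_ne_zero_of_re_pos (by simpa using hd)
  have hm : ∀ y : ℝ, mellin (fun x : ℝ => (((1 + x) ^ (-d) : ℝ) : ℂ)) ((-σ : ℝ) + y * Complex.I) =
      Complex.Gamma (-(σ + (-y : ℝ) * Complex.I)) * Complex.Gamma (d + (σ + (-y : ℝ) * Complex.I))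
        / Complex.Gamma d := by
    intro y
    rw [(mellin_one_add_rpow (d := d) (by simpa using h2) (by simp; linarith)).2]
    congr 3 <;> push_cast <;> ring
  have hint := integrable_Gamma_mul_Gamma_line h1 (fun m h => by
      have : (0 : ℝ) ≤ m := m.cast_nonneg
      linarith)
  have hvert : Complex.VerticalIntegrable (mellin fun x : ℝ => (((1 + x) ^ (-d) : ℝ) : ℂ)) (-σ)
      volume := by
    rw [Complex.VerticalIntegrable]
    refine (hint.comp_neg.div_const (Complex.Gamma d)).congr (Eventually.of_forall fun y => ?_)
    simp only [hm]
    ring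
  have hinv := mellinInv_mellin_eq (-σ) (fun x : ℝ => (((1 + x) ^ (-d) : ℝ) : ℂ)) hx
    (mellin_one_add_rpow (d := d) (by simpa using h2) (by simp; linarith)).1 hvert
    (Complex.continuous_ofReal.continuousAt.comp
      (ContinuousAt.rpow_const (by fun_prop) (Or.inl (by positivity))))
  rw [mellinInv] at hinv
  simp only [hm] at hinv
  rw [← hinv, ← integral_neg_eq_self (fun y : ℝ => Complex.Gamma (d + (σ + y * Complex.I)) *
        Complex.Gamma (-(σ + y * Complex.I)) * (x : ℂ) ^ (σ + y * Complex.I)), Complex.real_smul,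
    mul_left_comm, ← integral_const_mul]
  push_cast
  congr 1
  refine integral_congr_ae (Eventually.of_forall fun y => ?_)
  simp only [smul_eq_mul]
  rw [show -(-(σ : ℂ) + y * Complex.I) = σ + -y * Complex.I by ring]
  field_simp

theorem ne_natCast_of_lt_of_lt {N : ℕ} {σ : ℝ} (h1 : σ < N) (h2 : N = 0 ∨ (N : ℝ) - 1 < σ) (m : ℕ) :
    σ ≠ m := by
  rintro rfl
  rw [Nat.cast_lt] at h1
  rcases h2 with h2 | h2
  · omega
  · have : (N : ℝ) < (m + 1 : ℕ) := by push_cast; linarith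
    rw [Nat.cast_lt] at this
    omega

/-- By Γ(d + 1) = dΓ(d), the function −Γ(d)(1 + v)^(−d) is a primitive. This lets a representation
for d + 1 be integrated to one for d. -/
theorem integral_Gamma_mul_one_add_rpow {d x : ℝ} (hd : d ≠ 0) (hx : 0 ≤ x) :
    ∫ v in (0 : ℝ)..x, Complex.Gamma (d + 1 : ℝ) * (((1 + v) ^ (-(d + 1)) : ℝ) : ℂ) =
      Complex.Gamma d - Complex.Gamma d * (((1 + x) ^ (-d) : ℝ) : ℂ) := by
  have hG : Complex.Gamma (d + 1 : ℝ) = d * Complex.Gamma d := by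
    rw [Complex.ofReal_add, Complex.ofReal_one, Complex.Gamma_add_one _ (by exact_mod_cast hd)]
  have hpos : ∀ v ∈ uIcc 0 x, 0 < 1 + v := by
    intro v hv
    rw [uIcc_of_le hx] at hv
    linarith [hv.1]
  rw [intervalIntegral.integral_eq_sub_of_hasDerivAt
    (f := fun v : ℝ => -(Complex.Gamma d * (((1 + v) ^ (-d) : ℝ) : ℂ)))]
  · simp
    ring
  · intro v hv
    have h1 : HasDerivAt (fun v : ℝ => (1 + v) ^ (-d)) (-d * (1 + v) ^ (-d - 1)) v := by
      have := ((hasDerivAt_id v).const_add 1).rpow_const (p := -d) (Or.inl (hpos v hv).ne')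
      simpa using this
    have h2 := (h1.ofReal_comp.const_mul (Complex.Gamma d)).neg
    refine h2.congr_deriv ?_
    rw [hG, show -(d + 1) = -d - 1 by ring]
    push_cast
    ring
  · refine ContinuousOn.intervalIntegrable fun v hv => ContinuousAt.continuousWithinAt ?_
    refine continuousAt_const.mul (Complex.continuous_ofReal.continuousAt.comp ?_)
    exact ContinuousAt.rpow_const (by fun_prop) (Or.inl (hpos v hv).ne')

/-- The Mellin–Barnes representation of `(1 + x) ^ (-d)`. -/
theorem Gamma_mul_one_add_rpow (N : ℕ) : ∀ {d σ : ℝ}, -d < σ → σ < N → (N = 0 ∨ (N : ℝ) - 1 < -d) →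
    ∀ {x : ℝ}, 0 < x → Complex.Gamma d * (((1 + x) ^ (-d) : ℝ) : ℂ) =
      ∑ k ∈ Finset.range N, Complex.Gamma (d + k) * (-1) ^ k / (Nat.factorial k : ℂ) * (x : ℂ) ^ k +
      1 / (2 * π) * ∫ y : ℝ, Complex.Gamma (d + (σ + y * Complex.I)) *
        Complex.Gamma (-(σ + y * Complex.I)) * (x : ℂ) ^ (σ + y * Complex.I) := by
  -- N counts the poles of Γ(−s) to the left of the line. The step integrates the case (d + 1, σ −
  -- 1, N) over (0, x): the power v^(s−1) becomes x^s/s, and Γ(1 − s)/s = −Γ(−s) restores the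
  -- integrand.
  induction N with
  | zero =>
    intro d σ h1 h2 _ x hx
    simpa using Gamma_mul_one_add_rpow_of_neg h1 (by simpa using h2) hx
  | succ N ih =>
    intro d σ h1 h2 h3 x hx
    have hN : (N : ℝ) < -d := by
      rcases h3 with h | h
      · omega
      · push_cast at h; linarith
    have hN0 : (0 : ℝ) ≤ N := N.cast_nonneg
    push_cast at h2
    have hσ : 0 < σ := by linarith
    have ih' := fun {v : ℝ} (hv : 0 < v) => ih (d := d + 1) (σ := σ - 1) (by linarith) (by linarith)
      (Or.inr (by linarith)) hv
    have hG := integrable_Gamma_mul_Gamma_line (d := d + 1) (σ := σ - 1) (by linarith)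
      (ne_natCast_of_lt_of_lt (N := N) (by linarith) (Or.inr (by linarith)))
    have hWX : Integrable (fun v : ℝ => ‖(1 : ℂ)‖ * v ^ (σ - 1)) (volume.restrict (Ioc 0 x)) := by
      have := intervalIntegral.intervalIntegrable_rpow' (a := 0) (b := x)
        (show -1 < σ - 1 by linarith)
      rw [intervalIntegrable_iff_integrableOn_Ioc_of_le hx.le] at this
      simp only [norm_one, one_mul]
      exact this
    obtain ⟨i1, -, i2⟩ := integral_mul_integral_cpow (μ := volume.restrict (Ioc 0 x)) (X := id)
      (W := fun _ => 1) (σ := σ - 1) measurable_id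
      ((ae_restrict_mem measurableSet_Ioc).mono fun v hv => hv.1) measurable_const hWX hG
    simp only [one_mul, id_eq] at i1 i2
    have hinner : ∀ y : ℝ, ∫ v in Ioc 0 x, (v : ℂ) ^ (((σ - 1 : ℝ) : ℂ) + y * Complex.I) =
        (x : ℂ) ^ (σ + y * Complex.I) / (σ + y * Complex.I) := by
      intro y
      rw [← intervalIntegral.integral_of_le hx.le, integral_cpow (Or.inl (by simp [hσ]))]
      have e : ((σ - 1 : ℝ) : ℂ) + y * Complex.I + 1 = σ + y * Complex.I := by push_cast; ring
      rw [e, Complex.ofReal_zero, Complex.zero_cpow, sub_zero]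
      intro h
      have := congrArg Complex.re h
      simp at this
      linarith
    have hL := integral_Gamma_mul_one_add_rpow (d := d) (x := x) (by linarith) hx.le
    rw [intervalIntegral.integral_of_le hx.le, setIntegral_congr_fun measurableSet_Ioc
      (fun v hv => ih' hv.1), integral_add, integral_const_mul, i2] at hL
    · have hsum : ∫ v in Ioc 0 x, ∑ k ∈ Finset.range N, Complex.Gamma ((d + 1 : ℝ) + k) * (-1) ^ k /
          (Nat.factorial k : ℂ) * (v : ℂ) ^ k = ∑ k ∈ Finset.range N,
          Complex.Gamma ((d + 1 : ℝ) + k) * (-1) ^ k / (Nat.factorial (k + 1) : ℂ) *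
            (x : ℂ) ^ (k + 1) := by
        rw [← intervalIntegral.integral_of_le hx.le, intervalIntegral.integral_finsetSum]
        · refine Finset.sum_congr rfl fun k _ => ?_
          have hk : (∫ v in (0 : ℝ)..x, (v : ℂ) ^ k) = (x : ℂ) ^ (k + 1) / (k + 1) := by
            have := integral_pow (a := 0) (b := x) k
            have h2 := congrArg (fun r : ℝ => (r : ℂ)) this
            simp only [← intervalIntegral.integral_ofReal] at h2
            push_cast at h2
            rw [h2]; simp
          rw [intervalIntegral.integral_const_mul, hk, Nat.factorial_succ]
          have hk1 : (k : ℂ) + 1 ≠ 0 := by exact_mod_cast k.succ_ne_zero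
          have hk2 : (Nat.factorial k : ℂ) ≠ 0 := by exact_mod_cast k.factorial_ne_zero
          push_cast
          field_simp
        · intro k _
          exact (Continuous.intervalIntegrable (by fun_prop) _ _)
      have hline : ∫ y : ℝ, Complex.Gamma ((d + 1 : ℝ) + ((σ - 1 : ℝ) + y * Complex.I)) *
          Complex.Gamma (-((σ - 1 : ℝ) + y * Complex.I)) *
            ∫ v in Ioc 0 x, (v : ℂ) ^ (((σ - 1 : ℝ) : ℂ) + y * Complex.I) =
          -∫ y : ℝ, Complex.Gamma (d + (σ + y * Complex.I)) *
            Complex.Gamma (-(σ + y * Complex.I)) * (x : ℂ) ^ (σ + y * Complex.I) := by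
        rw [← integral_neg]
        refine integral_congr_ae (Eventually.of_forall fun y => ?_)
        have ht : (σ : ℂ) + y * Complex.I ≠ 0 := by
          intro h
          have := congrArg Complex.re h
          simp at this
          linarith
        have e1 : ((d + 1 : ℝ) : ℂ) + ((σ - 1 : ℝ) + y * Complex.I) = d + (σ + y * Complex.I) := by
          push_cast; ring
        have e2 : -(((σ - 1 : ℝ) : ℂ) + y * Complex.I) = -(σ + y * Complex.I) + 1 := by
          push_cast; ring
        simp only
        rw [hinner, e1, e2, Complex.Gamma_add_one _ (neg_ne_zero.2 ht)]
        field_simp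
      rw [hsum, hline] at hL
      -- The term k = 0 is the boundary value Γ(d) at v = 0; the others are the integrated terms of
      -- the previous sum, with index raised by one.
      rw [Finset.sum_range_succ']
      have hshift : ∑ k ∈ Finset.range N, Complex.Gamma (d + (k + 1 : ℕ)) * (-1) ^ (k + 1) /
          (Nat.factorial (k + 1) : ℂ) * (x : ℂ) ^ (k + 1) = -∑ k ∈ Finset.range N,
          Complex.Gamma ((d + 1 : ℝ) + k) * (-1) ^ k / (Nat.factorial (k + 1) : ℂ) *
            (x : ℂ) ^ (k + 1) := by
        rw [← Finset.sum_neg_distrib]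
        refine Finset.sum_congr rfl fun k _ => ?_
        have e : (d : ℂ) + (k + 1 : ℕ) = (d + 1 : ℝ) + k := by push_cast; ring
        rw [e]
        ring
      rw [hshift]
      simp only [Nat.cast_zero, add_zero, pow_zero, Nat.factorial_zero, Nat.cast_one, mul_one,
        div_one]
      linear_combination hL
    · refine Continuous.integrableOn_Ioc ?_
      fun_prop
    · exact i1.const_mul _

/-! ### Beta integrals and the integration over z -/

theorem betaIntegral_Ioo {u v : ℂ} (hu : 0 < u.re) (hv : 0 < v.re) :
    IntegrableOn (fun x : ℝ => (x : ℂ) ^ (u - 1) * ((1 - x : ℝ) : ℂ) ^ (v - 1)) (Ioo 0 1) ∧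
    ∫ x in Ioo (0 : ℝ) 1, (x : ℂ) ^ (u - 1) * ((1 - x : ℝ) : ℂ) ^ (v - 1) =
      Complex.Gamma u * Complex.Gamma v / Complex.Gamma (u + v) := by
  have h1 := Complex.betaIntegral_convergent hu hv
  have h2 := Complex.betaIntegral_eq_Gamma_mul_div u v hu hv
  rw [intervalIntegrable_iff_integrableOn_Ioo_of_le zero_le_one] at h1
  rw [Complex.betaIntegral, intervalIntegral.integral_of_le zero_le_one,
    integral_Ioc_eq_integral_Ioo] at h2
  push_cast
  exact ⟨h1, h2⟩

/-- The Beta integral with a weight and a power. -/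
theorem integral_weight_mul_cpow {b c : ℝ} {s : ℂ} (hs : 0 < b + 1 + s.re) (hc : -1 < c) :
    IntegrableOn (fun x : ℝ => ((x ^ b * (1 - x) ^ c : ℝ) : ℂ) * (x : ℂ) ^ s) (Ioo 0 1) ∧
    ∫ x in Ioo (0 : ℝ) 1, ((x ^ b * (1 - x) ^ c : ℝ) : ℂ) * (x : ℂ) ^ s =
      Complex.Gamma (b + 1 + s) * Complex.Gamma (c + 1) / Complex.Gamma (b + c + 2 + s) := by
  have h := betaIntegral_Ioo (u := b + 1 + s) (v := c + 1) (by simpa using hs)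
    (by simp; linarith)
  have hpt : EqOn (fun x : ℝ => (x : ℂ) ^ ((b + 1 + s : ℂ) - 1) * ((1 - x : ℝ) : ℂ) ^ ((c + 1 : ℂ) - 1))
      (fun x : ℝ => ((x ^ b * (1 - x) ^ c : ℝ) : ℂ) * (x : ℂ) ^ s) (Ioo 0 1) := by
    intro x hx
    have hx1 : 0 < 1 - x := by linarith [hx.2]
    simp only
    rw [Complex.ofReal_mul, ofReal_rpow_eq_exp hx.1, ofReal_rpow_eq_exp hx1,
      ofReal_cpow_eq_exp hx.1, ofReal_cpow_eq_exp hx.1, ofReal_cpow_eq_exp hx1, ← Complex.exp_add,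
      ← Complex.exp_add, ← Complex.exp_add]
    congr 1
    ring
  refine ⟨h.1.congr_fun hpt measurableSet_Ioo, ?_⟩
  rw [← setIntegral_congr_fun measurableSet_Ioo hpt, h.2]
  congr 2
  ring

theorem integral_weight_mul_cpow_div {a r w : ℝ} {s : ℂ} (hw : 0 < w) (hs : 0 < a + 1 + s.re)
    (hr : 0 < r + 1 - s.re) :
    IntegrableOn (fun z : ℝ => ((z ^ a * (1 - z) ^ r : ℝ) : ℂ) * ((w * z / (1 - z) : ℝ) : ℂ) ^ s)
      (Ioo 0 1) ∧
    ∫ z in Ioo (0 : ℝ) 1, ((z ^ a * (1 - z) ^ r : ℝ) : ℂ) * ((w * z / (1 - z) : ℝ) : ℂ) ^ s =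
      Complex.Gamma (a + 1 + s) * Complex.Gamma (r + 1 - s) / Complex.Gamma (a + r + 2)
        * (w : ℂ) ^ s := by
  have h := betaIntegral_Ioo (u := a + 1 + s) (v := r + 1 - s) (by simpa using hs)
    (by simpa using hr)
  have hpt : EqOn (fun x : ℝ => (x : ℂ) ^ ((a + 1 + s : ℂ) - 1) *
      ((1 - x : ℝ) : ℂ) ^ ((r + 1 - s : ℂ) - 1) * (w : ℂ) ^ s)
      (fun z : ℝ => ((z ^ a * (1 - z) ^ r : ℝ) : ℂ) * ((w * z / (1 - z) : ℝ) : ℂ) ^ s)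
      (Ioo 0 1) := by
    intro x hx
    have hx0 : 0 < x := hx.1
    have hx1 : 0 < 1 - x := by linarith [hx.2]
    simp only
    rw [Complex.ofReal_mul, ofReal_rpow_eq_exp hx0, ofReal_rpow_eq_exp hx1,
      ofReal_cpow_eq_exp hx0, ofReal_cpow_eq_exp hx1, ofReal_cpow_eq_exp hw,
      ofReal_cpow_eq_exp (by positivity), ← Complex.exp_add,
      ← Complex.exp_add, ← Complex.exp_add, ← Complex.exp_add,
      Real.log_div (by positivity) hx1.ne', Real.log_mul hw.ne' hx0.ne']
    congr 1
    push_cast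
    ring
  refine ⟨IntegrableOn.congr_fun (h.1.mul_const _) hpt measurableSet_Ioo, ?_⟩
  rw [← setIntegral_congr_fun measurableSet_Ioo hpt, integral_mul_const, h.2]
  congr 3
  ring

/-- 1 − (1 − w)z = (1 − z)(1 + wz/(1 − z)). This is what makes the binomial representation
applicable, at wz/(1 − z). -/
theorem rpow_mul_one_sub_rpow_div_eq {a c d w z : ℝ} (hw : 0 < w) (hz : z ∈ Ioo (0 : ℝ) 1) :
    z ^ a * (1 - z) ^ c / (1 - (1 - w) * z) ^ d =
      z ^ a * (1 - z) ^ (c - d) * (1 + w * z / (1 - z)) ^ (-d) := by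
  have hz0 := hz.1
  have hz1 : 0 < 1 - z := by linarith [hz.2]
  have e2 : 1 + w * z / (1 - z) = (1 - (1 - w) * z) / (1 - z) := by
    field_simp
    ring
  have e3 : 0 < 1 - (1 - w) * z := by nlinarith [mul_pos hw hz.1]
  rw [e2, Real.rpow_neg (by positivity), Real.div_rpow e3.le hz1.le, Real.rpow_sub hz1]
  have : (1 - z) ^ d ≠ 0 := (Real.rpow_pos_of_pos hz1 d).ne'
  have : (1 - (1 - w) * z) ^ d ≠ 0 := (Real.rpow_pos_of_pos e3 d).ne'
  field_simp

/-- The Mellin–Barnes representation of the Euler integral for a Gauss hypergeometric function. -/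
theorem Gamma_mul_euler_integral {N : ℕ} {a c d σ w : ℝ} (h1 : -d < σ) (h2 : σ < N)
    (h3 : N = 0 ∨ (N : ℝ) - 1 < -d) (ha : -1 < a) (h4 : -(a + 1) < σ)
    (h5 : σ < c - d + 1) (hw : 0 < w) :
    Complex.Gamma d * Complex.Gamma (a + c - d + 2) *
      ((∫ z in Ioo (0 : ℝ) 1, z ^ a * (1 - z) ^ c / (1 - (1 - w) * z) ^ d : ℝ) : ℂ) =
    ∑ k ∈ Finset.range N, Complex.Gamma (d + k) * (-1) ^ k / (Nat.factorial k : ℂ) *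
        (Complex.Gamma (a + 1 + k) * Complex.Gamma (c - d + 1 - k)) * (w : ℂ) ^ (k : ℂ) +
      1 / (2 * π) * ∫ y : ℝ, Complex.Gamma (d + (σ + y * Complex.I)) *
        Complex.Gamma (-(σ + y * Complex.I)) * (Complex.Gamma (a + 1 + (σ + y * Complex.I)) *
          Complex.Gamma (c - d + 1 - (σ + y * Complex.I))) * (w : ℂ) ^ (σ + y * Complex.I) := by
  set W : ℝ → ℂ := fun z => ((z ^ a * (1 - z) ^ (c - d) : ℝ) : ℂ) with hW
  set X : ℝ → ℝ := fun z => w * z / (1 - z) with hX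
  have hXpos : ∀ z ∈ Ioo (0 : ℝ) 1, 0 < X z := fun z hz =>
    div_pos (mul_pos hw hz.1) (by linarith [hz.2])
  have hB : ∀ s : ℂ, -(a + 1) < s.re → s.re < c - d + 1 → _ := fun s hs1 hs2 =>
    integral_weight_mul_cpow_div (a := a) (r := c - d) (w := w) (s := s) hw (by linarith)
      (by linarith)
  -- If k < N then 0 ≤ k ≤ N − 1 < −d < σ < c − d + 1, so the Beta integrals of the residue terms
  -- converge too.
  have hk : ∀ k ∈ Finset.range N, -(a + 1) < ((k : ℕ) : ℂ).re ∧ ((k : ℕ) : ℂ).re < c - d + 1 := by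
    intro k hkN
    have hkN : ((k + 1 : ℕ) : ℝ) ≤ N := by exact_mod_cast Finset.mem_range.1 hkN
    have hk0 : (0 : ℝ) ≤ k := k.cast_nonneg
    push_cast at hkN
    rw [Complex.natCast_re]
    rcases h3 with h3 | h3
    · subst h3
      simp at hkN
      linarith
    · constructor <;> linarith
  have hGne : Complex.Gamma (a + c - d + 2) ≠ 0 :=
    Complex.Gamma_ne_zero_of_re_pos (by simp; linarith)
  have hp : (a : ℂ) + ((c - d : ℝ) : ℂ) + 2 = a + c - d + 2 := by push_cast; ring
  have hlineB : ∀ y : ℝ, ∫ z in Ioo (0 : ℝ) 1, W z * (X z : ℂ) ^ (σ + y * Complex.I) =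
      Complex.Gamma (a + 1 + (σ + y * Complex.I)) * Complex.Gamma (c - d + 1 - (σ + y * Complex.I))
        / Complex.Gamma (a + c - d + 2) * (w : ℂ) ^ (σ + y * Complex.I) := by
    intro y
    rw [(hB (σ + y * Complex.I) (by simpa using h4) (by simpa using h5)).2, hp]
    push_cast
    rfl
  have hG := integrable_Gamma_mul_Gamma_line h1 (ne_natCast_of_lt_of_lt h2
    (h3.imp id fun h => h.trans h1))
  have hWX : Integrable (fun z : ℝ => ‖W z‖ * X z ^ σ) (volume.restrict (Ioo 0 1)) := by
    refine (hB σ (by simpa using h4) (by simpa using h5)).1.norm.congr ?_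
    filter_upwards [ae_restrict_mem measurableSet_Ioo] with z hz
    rw [norm_mul, Complex.norm_cpow_eq_rpow_re_of_pos (hXpos z hz), Complex.ofReal_re]
  obtain ⟨i1, -, i2⟩ := integral_mul_integral_cpow (μ := volume.restrict (Ioo 0 1)) (X := X)
    (W := W) (σ := σ) (by fun_prop)
    ((ae_restrict_mem measurableSet_Ioo).mono hXpos) (by fun_prop) hWX hG
  have hpt : EqOn (fun z : ℝ => Complex.Gamma d *
        ((z ^ a * (1 - z) ^ c / (1 - (1 - w) * z) ^ d : ℝ) : ℂ))
      (fun z : ℝ => ∑ k ∈ Finset.range N, Complex.Gamma (d + k) * (-1) ^ k / (Nat.factorial k : ℂ) *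
          (W z * (X z : ℂ) ^ (k : ℂ)) + 1 / (2 * π) * (W z * ∫ y : ℝ,
          Complex.Gamma (d + (σ + y * Complex.I)) *
        Complex.Gamma (-(σ + y * Complex.I)) * (X z : ℂ) ^ (σ + y * Complex.I))) (Ioo 0 1) := by
    intro z hz
    have h := Gamma_mul_one_add_rpow N h1 h2 h3 (hXpos z hz)
    simp only
    rw [rpow_mul_one_sub_rpow_div_eq hw hz, Complex.ofReal_mul, mul_left_comm, h, mul_add, Finset.mul_sum]
    congr 1
    · refine Finset.sum_congr rfl fun k _ => ?_
      rw [Complex.cpow_natCast]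
      ring
    · simp only [hW]
      ring
  rw [mul_comm (Complex.Gamma (d : ℂ)), mul_assoc, ← integral_complex_ofReal, ← integral_const_mul]
  rw [setIntegral_congr_fun measurableSet_Ioo hpt, integral_add, integral_const_mul, i2,
    integral_finsetSum]
  · rw [mul_add, Finset.mul_sum]
    congr 1
    · refine Finset.sum_congr rfl fun k hkN => ?_
      rw [integral_const_mul, (hB k (hk k hkN).1 (hk k hkN).2).2, hp]
      push_cast
      field_simp
    · rw [mul_left_comm, ← integral_const_mul]
      congr 1
      refine integral_congr_ae (Eventually.of_forall fun y => ?_)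
      simp only
      rw [hlineB]
      field_simp
  · intro k hkN
    exact (hB k (hk k hkN).1 (hk k hkN).2).1.const_mul _
  · exact integrable_finsetSum _ fun k hkN => (hB k (hk k hkN).1 (hk k hkN).2).1.const_mul _
  · exact i1.const_mul _

/-! ### Absolute convergence of the triple integral -/

theorem integrableOn_rpow_mul_one_sub_rpow {u v : ℝ} (hu : -1 < u) (hv : -1 < v) :
    IntegrableOn (fun x : ℝ => x ^ u * (1 - x) ^ v) (Ioo 0 1) := by
  have h := (integral_weight_mul_cpow (b := u) (c := v) (s := 0) (by simp; linarith) hv).1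
  simpa [IntegrableOn] using h.re

theorem unitCube_eq : unitCube = Ioo (0 : ℝ) 1 ×ˢ (Ioo (0 : ℝ) 1 ×ˢ Ioo (0 : ℝ) 1) := rfl

theorem beukersIntegrand_zero (a b c d e x y z : ℝ) :
    beukersIntegrand a b c d e 0 (x, y, z) =
      (x ^ b * (1 - x) ^ c * (y ^ e * (1 - y) ^ a)) *
        (z ^ a * (1 - z) ^ c / (1 - (1 - x * y) * z) ^ d) := by
  simp only [beukersIntegrand, Nat.cast_zero, zero_add]
  ring

/-- The base D = (1 − z) + xyz lies in (0, 1] and is at least 1 − z and at least xyz. Hence D^(−d) ≤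
D^(−s−r) ≤ (1 − z)^(−s)(xyz)^(−r), and the majorant is a product of one-variable Beta integrands. -/
theorem integrableOn_beukersIntegrand_of_le {a b c d e r s : ℝ} (ha : -1 < a) (hc : -1 < c)
    (hr : 0 ≤ r) (hs : 0 ≤ s) (hrs : d ≤ s + r) (har : -1 < a - r) (hbr : -1 < b - r)
    (her : -1 < e - r) (hcs : -1 < c - s) :
    IntegrableOn (beukersIntegrand a b c d e 0) unitCube := by
  have hdom : IntegrableOn (fun w : ℝ × ℝ × ℝ => (w.1 ^ (b - r) * (1 - w.1) ^ c) *
      ((w.2.1 ^ (e - r) * (1 - w.2.1) ^ a) * (w.2.2 ^ (a - r) * (1 - w.2.2) ^ (c - s)))) unitCube := by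
    rw [unitCube_eq, IntegrableOn, Measure.volume_eq_prod, Measure.volume_eq_prod,
      ← Measure.prod_restrict, ← Measure.prod_restrict]
    exact Integrable.mul_prod (f := fun x : ℝ => x ^ (b - r) * (1 - x) ^ c)
      (g := fun w : ℝ × ℝ => (w.1 ^ (e - r) * (1 - w.1) ^ a) * (w.2 ^ (a - r) * (1 - w.2) ^ (c - s)))
      (integrableOn_rpow_mul_one_sub_rpow hbr hc)
      (Integrable.mul_prod (f := fun x : ℝ => x ^ (e - r) * (1 - x) ^ a)
        (g := fun x : ℝ => x ^ (a - r) * (1 - x) ^ (c - s))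
        (integrableOn_rpow_mul_one_sub_rpow her ha) (integrableOn_rpow_mul_one_sub_rpow har hcs))
  have hmeas : MeasurableSet unitCube :=
    measurableSet_Ioo.prod (measurableSet_Ioo.prod measurableSet_Ioo)
  refine Integrable.mono' hdom ?_ ?_
  · refine Measurable.aestronglyMeasurable ?_
    unfold beukersIntegrand
    fun_prop
  · filter_upwards [ae_restrict_mem hmeas] with w hw
    obtain ⟨x, y, z⟩ := w
    obtain ⟨⟨hx0, hx1⟩, ⟨hy0, hy1⟩, hz0, hz1⟩ := hw
    simp only at hx0 hx1 hy0 hy1 hz0 hz1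
    have hx1' : 0 < 1 - x := by linarith
    have hy1' : 0 < 1 - y := by linarith
    have hz1' : 0 < 1 - z := by linarith
    have hxyz : 0 < x * y * z := by positivity
    have hxy : x * y < 1 := by nlinarith
    have hD : 0 < 1 - (1 - x * y) * z := by nlinarith
    have hD1 : 1 - (1 - x * y) * z ≤ 1 := by nlinarith
    rw [beukersIntegrand_zero, Real.norm_eq_abs, abs_of_nonneg (by positivity)]
    have key : ((1 - (1 - x * y) * z) ^ d)⁻¹ ≤ (1 - z) ^ (-s) * (x * y * z) ^ (-r) := by
      rw [← Real.rpow_neg hD.le]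
      calc (1 - (1 - x * y) * z) ^ (-d) ≤ (1 - (1 - x * y) * z) ^ (-s + -r) :=
            Real.rpow_le_rpow_of_exponent_ge hD hD1 (by linarith)
        _ = (1 - (1 - x * y) * z) ^ (-s) * (1 - (1 - x * y) * z) ^ (-r) := Real.rpow_add hD _ _
        _ ≤ _ := by
          refine mul_le_mul ?_ ?_ (by positivity) (by positivity)
          · exact Real.rpow_le_rpow_of_nonpos hz1' (by nlinarith) (by linarith)
          · exact Real.rpow_le_rpow_of_nonpos hxyz (by nlinarith) (by linarith)
    rw [div_eq_mul_inv]
    refine (mul_le_mul_of_nonneg_left (mul_le_mul_of_nonneg_left key (by positivity))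
      (by positivity)).trans_eq ?_
    rw [Real.mul_rpow (by positivity) hz0.le, Real.mul_rpow hx0.le hy0.le, sub_eq_add_neg b,
      sub_eq_add_neg e, sub_eq_add_neg a, sub_eq_add_neg c, Real.rpow_add hx0, Real.rpow_add hy0,
      Real.rpow_add hz0, Real.rpow_add hz1']
    ring

theorem integrableOn_beukersIntegrand {a b c d e t : ℝ} (ha : -1 < a) (hb : -1 < b) (hc : -1 < c)
    (he : -1 < e) (hat : -(a + 1) < t) (hbt : -(b + 1) < t) (het : -(e + 1) < t)
    (ht : t < c - d + 1) : IntegrableOn (beukersIntegrand a b c d e 0) unitCube := by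
  -- As much as is needed of the exponent, −t if positive, goes to xyz, and what remains of d to 1 −
  -- z; then c − s > −1 follows from r ≥ −t > d − c − 1.
  refine integrableOn_beukersIntegrand_of_le (r := max (-t) 0) (s := max (d - max (-t) 0) 0) ha hc
    (le_max_right _ _) (le_max_right _ _) ?_ ?_ ?_ ?_ ?_
  · linarith [le_max_left (d - max (-t) 0) 0]
  · rcases max_choice (-t) 0 with h | h <;> rw [h] <;> linarith
  · rcases max_choice (-t) 0 with h | h <;> rw [h] <;> linarith
  · rcases max_choice (-t) 0 with h | h <;> rw [h] <;> linarith
  · rcases max_choice (d - max (-t) 0) 0 with h | h <;> rw [h]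
    · linarith [le_max_left (-t) 0]
    · linarith

/-- Fubini with z innermost: the inner integral then depends on x and y only through their product.
-/
theorem J3_eq_integral {a b c d e : ℝ}
    (h : IntegrableOn (beukersIntegrand a b c d e 0) unitCube) :
    J3 a b c d e 0 = ∫ w in Ioo (0 : ℝ) 1 ×ˢ Ioo (0 : ℝ) 1,
      (w.1 ^ b * (1 - w.1) ^ c * (w.2 ^ e * (1 - w.2) ^ a)) *
        ∫ z in Ioo (0 : ℝ) 1, z ^ a * (1 - z) ^ c / (1 - (1 - w.1 * w.2) * z) ^ d := by
  have hmp := volume_preserving_prodAssoc (α₁ := ℝ) (β₁ := ℝ) (γ₁ := ℝ)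
  have hpre : MeasurableEquiv.prodAssoc ⁻¹' unitCube =
      (Ioo (0 : ℝ) 1 ×ˢ Ioo (0 : ℝ) 1) ×ˢ Ioo (0 : ℝ) 1 := by
    ext w
    simp [unitCube, MeasurableEquiv.prodAssoc, Equiv.prodAssoc, and_assoc]
  have hi := (hmp.integrableOn_comp_preimage (MeasurableEquiv.measurableEmbedding _)).2 h
  rw [J3, ← hmp.setIntegral_preimage_emb (MeasurableEquiv.measurableEmbedding _)]
  rw [hpre] at hi ⊢
  rw [Measure.volume_eq_prod] at hi ⊢
  refine (setIntegral_prod _ hi).trans ?_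
  refine integral_congr_ae (Eventually.of_forall fun w => ?_)
  simp only
  rw [← integral_const_mul]
  refine integral_congr_ae (Eventually.of_forall fun z => ?_)
  exact beukersIntegrand_zero a b c d e w.1 w.2 z

/-! ### The integration over x and y -/

/-- The product of two Beta functions that arises from the integration over `x` and `y`. -/
noncomputable def betaProd (a b c e : ℝ) (s : ℂ) : ℂ :=
  Complex.Gamma (b + 1 + s) * Complex.Gamma (c + 1) / Complex.Gamma (b + c + 2 + s) *
    (Complex.Gamma (e + 1 + s) * Complex.Gamma (a + 1) / Complex.Gamma (e + a + 2 + s))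

theorem integral_square_weight_mul_cpow {a b c e : ℝ} {s : ℂ} (ha : -1 < a) (hc : -1 < c)
    (hb : 0 < b + 1 + s.re) (he : 0 < e + 1 + s.re) :
    IntegrableOn (fun w : ℝ × ℝ => ((w.1 ^ b * (1 - w.1) ^ c * (w.2 ^ e * (1 - w.2) ^ a) : ℝ) : ℂ) *
      ((w.1 * w.2 : ℝ) : ℂ) ^ s) (Ioo (0 : ℝ) 1 ×ˢ Ioo (0 : ℝ) 1) ∧
    ∫ w in Ioo (0 : ℝ) 1 ×ˢ Ioo (0 : ℝ) 1,
      ((w.1 ^ b * (1 - w.1) ^ c * (w.2 ^ e * (1 - w.2) ^ a) : ℝ) : ℂ) *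
        ((w.1 * w.2 : ℝ) : ℂ) ^ s = betaProd a b c e s := by
  have h1 := integral_weight_mul_cpow hb hc
  have h2 := integral_weight_mul_cpow he ha
  have hpt : EqOn (fun w : ℝ × ℝ => (((w.1 ^ b * (1 - w.1) ^ c : ℝ) : ℂ) * (w.1 : ℂ) ^ s) *
      (((w.2 ^ e * (1 - w.2) ^ a : ℝ) : ℂ) * (w.2 : ℂ) ^ s))
      (fun w : ℝ × ℝ => ((w.1 ^ b * (1 - w.1) ^ c * (w.2 ^ e * (1 - w.2) ^ a) : ℝ) : ℂ) *
      ((w.1 * w.2 : ℝ) : ℂ) ^ s) (Ioo (0 : ℝ) 1 ×ˢ Ioo (0 : ℝ) 1) := by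
    rintro ⟨x, y⟩ ⟨hx, hy⟩
    simp only
    rw [Complex.ofReal_mul x y, Complex.mul_cpow_ofReal_nonneg hx.1.le hy.1.le]
    push_cast
    ring
  have hms : MeasurableSet (Ioo (0 : ℝ) 1 ×ˢ Ioo (0 : ℝ) 1) := measurableSet_Ioo.prod measurableSet_Ioo
  constructor
  · refine IntegrableOn.congr_fun ?_ hpt hms
    rw [IntegrableOn, Measure.volume_eq_prod, ← Measure.prod_restrict]
    exact h1.1.mul_prod h2.1
  · rw [← setIntegral_congr_fun hms hpt, Measure.volume_eq_prod,
      setIntegral_prod_mul (fun x : ℝ => ((x ^ b * (1 - x) ^ c : ℝ) : ℂ) * (x : ℂ) ^ s)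
        (fun x : ℝ => ((x ^ e * (1 - x) ^ a : ℝ) : ℂ) * (x : ℂ) ^ s), h1.2, h2.2]
    rfl

theorem integrable_four_Gamma_line {a d q σ : ℝ} (h1 : -d < σ) (h2 : ∀ m : ℕ, σ ≠ m)
    (h4 : -(a + 1) < σ) (h5 : σ < q) :
    Integrable fun y : ℝ => Complex.Gamma (d + (σ + y * Complex.I)) *
        Complex.Gamma (-(σ + y * Complex.I)) * (Complex.Gamma (a + 1 + (σ + y * Complex.I)) *
          Complex.Gamma (q - (σ + y * Complex.I))) := by
  refine (integrable_Gamma_mul_Gamma_line h1 h2).mul_bdd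
    (c := Real.Gamma (a + 1 + σ) * Real.Gamma (q - σ)) ?_ (Eventually.of_forall fun y => ?_)
  · have c1 := continuous_Gamma_line (x := a + 1 + σ) (fun m h => by
      have : (0 : ℝ) ≤ m := m.cast_nonneg
      linarith) 1
    have c2 := continuous_Gamma_line (x := q - σ) (fun m h => by
      have : (0 : ℝ) ≤ m := m.cast_nonneg
      linarith) (-1)
    refine ((c1.mul c2).congr fun y => ?_).aestronglyMeasurable
    simp only [Pi.mul_apply]
    congr 2 <;> push_cast <;> ring
  · rw [norm_mul]
    have g1 := Complex.norm_Gamma_le (z := a + 1 + (σ + y * Complex.I)) (by simp; linarith)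
    have g2 := Complex.norm_Gamma_le (z := q - (σ + y * Complex.I)) (by simp; linarith)
    simp only [Complex.add_re, Complex.sub_re, Complex.ofReal_re, Complex.mul_re, Complex.I_re,
      mul_zero, Complex.ofReal_im, Complex.I_im, mul_one, sub_self, add_zero, Complex.one_re]
      at g1 g2
    exact mul_le_mul g1 g2 (norm_nonneg _) ((norm_nonneg _).trans g1)

/-- `J₃` as a line integral and finitely many residues. -/
theorem Gamma_mul_J3_eq_line {N : ℕ} {a b c d e σ : ℝ} (ha : -1 < a) (hb : -1 < b) (hc : -1 < c)
    (he : -1 < e) (h1 : -d < σ) (h2 : σ < N) (h3 : N = 0 ∨ (N : ℝ) - 1 < -d) (h4 : -(a + 1) < σ)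
    (h5 : σ < c - d + 1) (h6 : -(b + 1) < σ) (h7 : -(e + 1) < σ) :
    Integrable (fun y : ℝ => Complex.Gamma (d + (σ + y * Complex.I)) *
        Complex.Gamma (-(σ + y * Complex.I)) * (Complex.Gamma (a + 1 + (σ + y * Complex.I)) *
          Complex.Gamma (c - d + 1 - (σ + y * Complex.I))) * betaProd a b c e (σ + y * Complex.I)) ∧
    Complex.Gamma d * Complex.Gamma (a + c - d + 2) * (J3 a b c d e 0 : ℂ) =
    ∑ k ∈ Finset.range N, Complex.Gamma (d + k) * (-1) ^ k / (Nat.factorial k : ℂ) *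
        (Complex.Gamma (a + 1 + k) * Complex.Gamma (c - d + 1 - k)) * betaProd a b c e k +
      1 / (2 * π) * ∫ y : ℝ, Complex.Gamma (d + (σ + y * Complex.I)) *
        Complex.Gamma (-(σ + y * Complex.I)) * (Complex.Gamma (a + 1 + (σ + y * Complex.I)) *
          Complex.Gamma (c - d + 1 - (σ + y * Complex.I))) *
            betaProd a b c e (σ + y * Complex.I) := by
  set W : ℝ × ℝ → ℂ := fun w =>
    ((w.1 ^ b * (1 - w.1) ^ c * (w.2 ^ e * (1 - w.2) ^ a) : ℝ) : ℂ) with hW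
  set S : Set (ℝ × ℝ) := Ioo (0 : ℝ) 1 ×ˢ Ioo (0 : ℝ) 1 with hS
  have hSm : MeasurableSet S := measurableSet_Ioo.prod measurableSet_Ioo
  have hpos : ∀ w ∈ S, 0 < w.1 * w.2 := fun w hw => mul_pos hw.1.1 hw.2.1
  have hG := integrable_four_Gamma_line (q := c - d + 1) h1 (ne_natCast_of_lt_of_lt h2
    (h3.imp id fun h => h.trans h1)) h4 h5
  have hB : ∀ y : ℝ, _ := fun y : ℝ => integral_square_weight_mul_cpow (a := a) (b := b) (c := c)
    (e := e) (s := σ + y * Complex.I) ha hc (by simp; linarith) (by simp; linarith)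
  have hBk : ∀ k : ℕ, _ := fun k : ℕ => integral_square_weight_mul_cpow (a := a) (b := b) (c := c)
    (e := e) (s := k) ha hc (by simp; linarith [k.cast_nonneg (α := ℝ)])
    (by simp; linarith [k.cast_nonneg (α := ℝ)])
  have hWX : Integrable (fun w : ℝ × ℝ => ‖W w‖ * (w.1 * w.2) ^ σ) (volume.restrict S) := by
    refine (hB 0).1.norm.congr ?_
    filter_upwards [ae_restrict_mem hSm] with w hw
    rw [norm_mul, Complex.norm_cpow_eq_rpow_re_of_pos (hpos w hw)]
    simp [hW]
  obtain ⟨i1, i2, i3⟩ := integral_mul_integral_cpow (μ := volume.restrict S)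
    (X := fun w : ℝ × ℝ => w.1 * w.2) (W := W) (σ := σ) (by fun_prop)
    ((ae_restrict_mem hSm).mono hpos) (by fun_prop) hWX hG
  have hB2 : ∀ y : ℝ, ∫ w in S, W w * ((w.1 * w.2 : ℝ) : ℂ) ^ (σ + y * Complex.I) =
      betaProd a b c e (σ + y * Complex.I) := fun y => (hB y).2
  have hq : ((c - d + 1 : ℝ) : ℂ) = c - d + 1 := by push_cast; ring
  simp only [hB2] at i2 i3
  simp only [hq] at i1 i2 i3
  refine ⟨i2, ?_⟩
  have hJ := J3_eq_integral (integrableOn_beukersIntegrand ha hb hc he h4 h6 h7 h5)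
  rw [hJ, ← integral_complex_ofReal, ← integral_const_mul]
  -- Once the inner integral is replaced by its Mellin–Barnes representation, x and y enter through
  -- the powers (xy)^s only, which integrate to `betaProd`.
  have hpt : EqOn (fun w : ℝ × ℝ => Complex.Gamma d * Complex.Gamma (a + c - d + 2) *
      (((w.1 ^ b * (1 - w.1) ^ c * (w.2 ^ e * (1 - w.2) ^ a)) *
        ∫ z in Ioo (0 : ℝ) 1, z ^ a * (1 - z) ^ c / (1 - (1 - w.1 * w.2) * z) ^ d : ℝ) : ℂ))
      (fun w => ∑ k ∈ Finset.range N, Complex.Gamma (d + k) * (-1) ^ k / (Nat.factorial k : ℂ) *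
        (Complex.Gamma (a + 1 + k) * Complex.Gamma (c - d + 1 - k)) *
          (W w * ((w.1 * w.2 : ℝ) : ℂ) ^ (k : ℂ)) +
      1 / (2 * π) * (W w * ∫ y : ℝ, Complex.Gamma (d + (σ + y * Complex.I)) *
        Complex.Gamma (-(σ + y * Complex.I)) * (Complex.Gamma (a + 1 + (σ + y * Complex.I)) *
          Complex.Gamma (c - d + 1 - (σ + y * Complex.I))) *
            ((w.1 * w.2 : ℝ) : ℂ) ^ (σ + y * Complex.I))) S := by
    intro w hw
    have h := Gamma_mul_euler_integral h1 h2 h3 ha h4 h5 (hpos w hw)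
    simp only
    rw [Complex.ofReal_mul (w.1 ^ b * (1 - w.1) ^ c * (w.2 ^ e * (1 - w.2) ^ a)), mul_left_comm, h,
      mul_add, Finset.mul_sum]
    congr 1
    · refine Finset.sum_congr rfl fun k _ => ?_
      simp only [hW]
      ring
    · simp only [hW]
      push_cast
      ring
  rw [setIntegral_congr_fun hSm hpt, integral_add, integral_const_mul, integral_finsetSum]
  · congr 1
    · refine Finset.sum_congr rfl fun k _ => ?_
      rw [integral_const_mul, (hBk k).2]
    · congr 1
  · intro k _
    exact (hBk k).1.const_mul _
  · exact integrable_finsetSum _ fun k _ => (hBk k).1.const_mul _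
  · exact i1.const_mul _

/-! ### A vertical line with loops, and its winding about real points -/

theorem segmentIntegral_horizontal (f : ℂ → ℂ) (x₁ x₂ y : ℝ) :
    segmentIntegral f (x₁ + y * Complex.I) (x₂ + y * Complex.I) =
      ∫ x in x₁..x₂, f (x + y * Complex.I) := by
  have h := intervalIntegral.smul_integral_comp_add_mul (a := 0) (b := 1)
    (fun x : ℝ => f (x + y * Complex.I)) (x₂ - x₁) x₁
  rw [mul_zero, mul_one, add_zero, add_sub_cancel] at h
  rw [← h, segmentIntegral, Complex.real_smul]
  congr 1
  · push_cast; ring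
  · refine intervalIntegral.integral_congr fun t _ => ?_
    congr 1
    push_cast
    ring

theorem segmentIntegral_vertical (f : ℂ → ℂ) (x y₁ y₂ : ℝ) :
    segmentIntegral f (x + y₁ * Complex.I) (x + y₂ * Complex.I) =
      Complex.I * ∫ y in y₁..y₂, f (x + y * Complex.I) := by
  have h := intervalIntegral.smul_integral_comp_add_mul (a := 0) (b := 1)
    (fun y : ℝ => f (x + y * Complex.I)) (y₂ - y₁) y₁
  rw [mul_zero, mul_one, add_zero, add_sub_cancel] at h
  rw [← h, segmentIntegral, Complex.real_smul, ← mul_assoc]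
  congr 1
  · push_cast; ring
  · refine intervalIntegral.integral_congr fun t _ => ?_
    congr 1
    push_cast
    ring

/-- The base point, one unit below the point `σ` of the real line. -/
noncomputable def basePoint (σ : ℝ) : ℂ := σ + ((-1 : ℝ) : ℂ) * Complex.I

/-- The vertices of clockwise rectangular loops around `0, …, N - 1`, based at `basePoint σ`. -/
noncomputable def loopVertices (σ δ : ℝ) : ℕ → List ℂ
  | 0 => []
  | k + 1 => (((k - δ : ℝ) : ℂ) + ((-1 : ℝ) : ℂ) * Complex.I) ::
      (((k - δ : ℝ) : ℂ) + ((1 : ℝ) : ℂ) * Complex.I) ::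
      (((k + δ : ℝ) : ℂ) + ((1 : ℝ) : ℂ) * Complex.I) ::
      (((k + δ : ℝ) : ℂ) + ((-1 : ℝ) : ℂ) * Complex.I) :: basePoint σ :: loopVertices σ δ k

/-- The vertical line through `σ`, with clockwise loops around `0, …, N - 1` attached. -/
noncomputable def loopContour (σ δ : ℝ) (N : ℕ) : BarnesContour := ⟨basePoint σ, loopVertices σ δ N⟩

theorem getLastD_loopVertices (σ δ : ℝ) (N : ℕ) :
    (loopVertices σ δ N).getLastD (basePoint σ) = basePoint σ := by
  induction N with
  | zero => rfl
  | succ k ih => simpa only [loopVertices, List.getLastD_cons] using ih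

theorem last_loopContour (σ δ : ℝ) (N : ℕ) : (loopContour σ δ N).last = basePoint σ :=
  getLastD_loopVertices σ δ N

/-- The way out to a loop and the way back both run along Im s = −1. Together with the missing
bottom edge they cancel, leaving minus the counterclockwise integral. -/
theorem polygonIntegral_loopVertices_append {f : ℂ → ℂ}
    (hf : Continuous fun x : ℝ => f (x + ((-1 : ℝ) : ℂ) * Complex.I)) (σ δ : ℝ) (N : ℕ)
    (l : List ℂ) : polygonIntegral f (basePoint σ :: (loopVertices σ δ N ++ l)) =
      -∑ k ∈ Finset.range N, rectIntegral f (k - δ) (k + δ) (-1) 1 +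
        polygonIntegral f (basePoint σ :: l) := by
  induction N with
  | zero => simp [loopVertices]
  | succ k ih =>
    simp only [loopVertices, List.cons_append, polygonIntegral]
    rw [ih, Finset.sum_range_succ, basePoint, segmentIntegral_horizontal, segmentIntegral_vertical,
      segmentIntegral_horizontal, segmentIntegral_vertical, segmentIntegral_horizontal, rectIntegral,
      intervalIntegral.integral_symm (-1 : ℝ) 1,
      ← intervalIntegral.integral_add_adjacent_intervals (hf.intervalIntegrable σ (k + δ))
        (hf.intervalIntegrable (k + δ) (k - δ)), intervalIntegral.integral_symm σ (k + δ),
      intervalIntegral.integral_symm (k - δ) (k + δ)]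
    push_cast
    ring

theorem re_eq_of_mem_segment {u v p : ℂ} {r : ℝ} (hp : p ∈ segment ℝ u v) (hu : u.re = r)
    (hv : v.re = r) : p.re = r := by
  obtain ⟨s, t, -, -, hst, rfl⟩ := hp
  simp [hu, hv, ← add_mul, hst]

theorem im_eq_of_mem_segment {u v p : ℂ} {r : ℝ} (hp : p ∈ segment ℝ u v) (hu : u.im = r)
    (hv : v.im = r) : p.im = r := by
  obtain ⟨s, t, -, -, hst, rfl⟩ := hp
  simp [hu, hv, ← add_mul, hst]

/-- Horizontal edges have height ±1, so a real point can lie only on the vertical edges, at k ± δ.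
-/
theorem notMem_polygonTrace_loopVertices_append {σ δ p : ℝ} {N : ℕ} {l : List ℂ}
    (hp : ∀ k < N, p ≠ k - δ ∧ p ≠ k + δ) (hl : (p : ℂ) ∉ polygonTrace (basePoint σ :: l)) :
    (p : ℂ) ∉ polygonTrace (basePoint σ :: (loopVertices σ δ N ++ l)) := by
  induction N with
  | zero => simpa [loopVertices] using hl
  | succ k ih =>
    simp only [loopVertices, List.cons_append, polygonTrace, mem_union, not_or]
    refine ⟨fun h => ?_, fun h => ?_, fun h => ?_, fun h => ?_, fun h => ?_,
      ih fun j hj => hp j (hj.trans k.lt_succ_self)⟩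
    · simpa using im_eq_of_mem_segment (r := -1) h (by simp [basePoint]) (by simp)
    · exact (hp k k.lt_succ_self).1 (re_eq_of_mem_segment h (by simp) (by simp))
    · simpa using im_eq_of_mem_segment (r := 1) h (by simp) (by simp)
    · exact (hp k k.lt_succ_self).2 (re_eq_of_mem_segment h (by simp) (by simp))
    · simpa using im_eq_of_mem_segment (r := -1) h (by simp) (by simp [basePoint])

theorem avoids_loopContour {σ δ p : ℝ} {N : ℕ} (hp : ∀ k < N, p ≠ k - δ ∧ p ≠ k + δ)
    (hσ : p ≠ σ) : (loopContour σ δ N).Avoids p := by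
  intro R _
  rw [BarnesContour.truncate, last_loopContour]
  simp only [loopContour, polygonTrace, mem_union, not_or]
  refine ⟨fun h => hσ (re_eq_of_mem_segment h (by simp [basePoint]) (by simp [basePoint])),
    notMem_polygonTrace_loopVertices_append hp ?_⟩
  simp only [polygonTrace, mem_union, not_or]
  refine ⟨fun h => hσ (re_eq_of_mem_segment h (by simp [basePoint]) (by simp [basePoint])),
    fun h => hσ ?_⟩
  have := congrArg Complex.re (mem_singleton_iff.1 h)
  simpa [basePoint] using this

theorem polygonIntegral_truncate_loopContour {f : ℂ → ℂ}
    (hf : Continuous fun x : ℝ => f (x + ((-1 : ℝ) : ℂ) * Complex.I)) {σ : ℝ}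
    (hv : Continuous fun y : ℝ => f (σ + y * Complex.I)) (δ : ℝ) (N : ℕ) (R : ℝ) :
    polygonIntegral f ((loopContour σ δ N).truncate R) =
      Complex.I * (∫ y in (-1 - R)..(-1 + R), f (σ + y * Complex.I)) -
        ∑ k ∈ Finset.range N, rectIntegral f (k - δ) (k + δ) (-1) 1 := by
  rw [BarnesContour.truncate, last_loopContour]
  simp only [loopContour, polygonIntegral]
  rw [polygonIntegral_loopVertices_append hf]
  have e1 : basePoint σ - R * Complex.I = σ + ((-1 - R : ℝ) : ℂ) * Complex.I := by
    rw [basePoint]; push_cast; ring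
  have e2 : basePoint σ + R * Complex.I = σ + ((-1 + R : ℝ) : ℂ) * Complex.I := by
    rw [basePoint]; push_cast; ring
  simp only [polygonIntegral]
  rw [e1, e2, basePoint, segmentIntegral_vertical, segmentIntegral_vertical,
    ← intervalIntegral.integral_add_adjacent_intervals (hv.intervalIntegrable (-1 - R) (-1))
      (hv.intervalIntegrable (-1) (-1 + R))]
  ring

theorem log_add_mul_I_sub {x p R y : ℝ} (hR : 0 < R) (h : ((x - p) / R : ℝ) + (y / R : ℝ) * Complex.I ≠ 0) :
    Complex.log (x + y * Complex.I - p) =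
      Real.log R + Complex.log (((x - p) / R : ℝ) + (y / R : ℝ) * Complex.I) := by
  rw [← Complex.log_ofReal_mul hR h]
  congr 1
  have : (R : ℂ) ≠ 0 := by exact_mod_cast hR.ne'
  push_cast
  field_simp
  ring

/-- Dividing both ends of a truncated line by R changes the two logarithms by the same real number
log R, and the scaled ends tend to ±i. The increment of the logarithm can thus be read off in the
limit. -/
theorem tendsto_log_scaled (u v s : ℝ) (hs : s ≠ 0) :
    Tendsto (fun R : ℝ => Complex.log ((u / R : ℝ) + ((v + s * R) / R : ℝ) * Complex.I)) atTop
      (𝓝 (Complex.log (s * Complex.I))) := by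
  have h1 : Tendsto (fun R : ℝ => u / R) atTop (𝓝 0) := tendsto_const_nhds.div_atTop tendsto_id
  have h2 : Tendsto (fun R : ℝ => (v + s * R) / R) atTop (𝓝 s) := by
    have h3 : Tendsto (fun R : ℝ => v / R + s) atTop (𝓝 (0 + s)) :=
      (tendsto_const_nhds.div_atTop tendsto_id).add tendsto_const_nhds
    rw [zero_add] at h3
    refine h3.congr' ((eventually_gt_atTop 0).mono fun R hR => ?_)
    field_simp
  have h4 : Tendsto (fun R : ℝ => ((u / R : ℝ) : ℂ) + ((v + s * R) / R : ℝ) * Complex.I) atTop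
      (𝓝 ((0 : ℝ) + s * Complex.I)) :=
    ((Complex.continuous_ofReal.tendsto _).comp h1).add
      (((Complex.continuous_ofReal.tendsto _).comp h2).mul_const _)
  simp only [Complex.ofReal_zero, zero_add] at h4
  exact h4.clog (Complex.mem_slitPlane_iff.2 (Or.inr (by simpa using hs)))

theorem scaled_ne_zero {u R : ℝ} (hu : u ≠ 0) (hR : 0 < R) (y : ℝ) :
    ((u / R : ℝ) : ℂ) + (y / R : ℝ) * Complex.I ≠ 0 := by
  intro h
  have := congrArg Complex.re h
  simp [hu, hR.ne'] at this

theorem tendsto_integral_vertical_inv_of_lt {p σ : ℝ} (h : p < σ) :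
    Tendsto (fun R : ℝ => Complex.I * ∫ y in (-1 - R)..(-1 + R), ((σ : ℂ) + y * Complex.I - p)⁻¹)
      atTop (𝓝 (π * Complex.I)) := by
  have h1 := (tendsto_log_scaled (σ - p) (-1) 1 one_ne_zero).sub
    (tendsto_log_scaled (σ - p) (-1) (-1) (neg_ne_zero.2 one_ne_zero))
  have e : Complex.log ((1 : ℝ) * Complex.I) - Complex.log ((-1 : ℝ) * Complex.I) =
      π * Complex.I := by
    simp [Complex.log_I, Complex.log_neg_I]
    ring
  rw [e] at h1
  refine h1.congr' ((eventually_gt_atTop 0).mono fun R hR => ?_)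
  simp only
  rw [integral_vertical_inv_of_lt h, log_add_mul_I_sub hR (scaled_ne_zero (sub_ne_zero.2 h.ne') hR _),
    log_add_mul_I_sub hR (scaled_ne_zero (sub_ne_zero.2 h.ne') hR _), add_sub_add_left_eq_sub]
  simp only [one_mul, neg_mul, sub_eq_add_neg]

theorem tendsto_integral_vertical_inv_of_gt {p σ : ℝ} (h : σ < p) :
    Tendsto (fun R : ℝ => Complex.I * ∫ y in (-1 - R)..(-1 + R), ((σ : ℂ) + y * Complex.I - p)⁻¹)
      atTop (𝓝 (-(π * Complex.I))) := by
  have h1 := (tendsto_log_scaled (p - σ) 1 (-1) (neg_ne_zero.2 one_ne_zero)).sub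
    (tendsto_log_scaled (p - σ) 1 1 one_ne_zero)
  have e : Complex.log ((-1 : ℝ) * Complex.I) - Complex.log ((1 : ℝ) * Complex.I) =
      -(π * Complex.I) := by
    simp [Complex.log_I, Complex.log_neg_I]
    ring
  have e2 : ∀ y : ℝ, -((σ : ℂ) + y * Complex.I - p) = p + (-y : ℝ) * Complex.I - σ := by
    intro y
    push_cast
    ring
  rw [e] at h1
  refine h1.congr' ((eventually_gt_atTop 0).mono fun R hR => ?_)
  simp only
  rw [integral_vertical_inv_of_gt h, e2, e2,
    log_add_mul_I_sub hR (scaled_ne_zero (sub_ne_zero.2 h.ne') hR _),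
    log_add_mul_I_sub hR (scaled_ne_zero (sub_ne_zero.2 h.ne') hR _), add_sub_add_left_eq_sub,
    show -(-1 + R) = 1 + -1 * R by ring, show -(-1 - R) = 1 + 1 * R by ring]

/-- The number m counts how often the loops enclose p; being clockwise, they subtract 2πi each time
from the contribution L of the line. -/
theorem tendsto_polygonIntegral_inv {σ δ p m : ℝ} {N : ℕ} (hσ : p ≠ σ)
    (hm : ∑ k ∈ Finset.range N, rectIntegral (fun s => (s - p)⁻¹) (k - δ) (k + δ) (-1) 1 =
      m * (2 * π * Complex.I)) (L : ℂ)
    (hL : Tendsto (fun R : ℝ => Complex.I * ∫ y in (-1 - R)..(-1 + R),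
      ((σ : ℂ) + y * Complex.I - p)⁻¹) atTop (𝓝 L)) :
    Tendsto (fun R : ℝ => polygonIntegral (fun s => (s - p)⁻¹) ((loopContour σ δ N).truncate R))
      atTop (𝓝 (L - m * (2 * π * Complex.I))) := by
  have hf : Continuous fun x : ℝ => ((x : ℂ) + ((-1 : ℝ) : ℂ) * Complex.I - p)⁻¹ :=
    Continuous.inv₀ (by fun_prop) fun x h => by simpa using congrArg Complex.im h
  have hv : Continuous fun y : ℝ => ((σ : ℂ) + y * Complex.I - p)⁻¹ :=
    Continuous.inv₀ (by fun_prop) fun y h => hσ (by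
      have := congrArg Complex.re h
      simp at this
      linarith)
  simp only [polygonIntegral_truncate_loopContour (f := fun s => (s - p)⁻¹) hf hv, hm]
  exact hL.sub_const _

theorem rectIntegral_inv_eq_zero {p x₁ x₂ : ℝ} (hx : x₁ ≤ x₂) (hp : p < x₁ ∨ x₂ < p) :
    rectIntegral (fun z => (z - p)⁻¹) x₁ x₂ (-1) 1 = 0 := by
  refine rectIntegral_eq_zero hx (by norm_num) ?_
  refine DifferentiableOn.inv (by fun_prop) fun z hz h0 => ?_
  rw [sub_eq_zero] at h0
  subst h0
  have := hz.1
  simp only [mem_preimage, Complex.ofReal_re, mem_Icc] at this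
  rcases hp with h | h <;> linarith

theorem sum_rectIntegral_inv_eq_zero {δ p : ℝ} {N : ℕ} (hδ : 0 < δ)
    (hp : ∀ k < N, p < k - δ ∨ k + δ < p) :
    ∑ k ∈ Finset.range N, rectIntegral (fun s => (s - p)⁻¹) (k - δ) (k + δ) (-1) 1 = 0 :=
  Finset.sum_eq_zero fun k hk =>
    rectIntegral_inv_eq_zero (by linarith) (hp k (Finset.mem_range.1 hk))

theorem hasOnLeft_loopContour {σ δ p : ℝ} {N : ℕ} (hδ : 0 < δ) (hσ : p < σ)
    (hp : ∀ k < N, p < k - δ ∨ k + δ < p) : (loopContour σ δ N).HasOnLeft p := by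
  refine ⟨avoids_loopContour (fun k hk => ?_) hσ.ne, ?_⟩
  · rcases hp k hk with h | h <;> constructor <;> intro h' <;> linarith
  · have := tendsto_polygonIntegral_inv (m := 0) hσ.ne
      (by rw [sum_rectIntegral_inv_eq_zero hδ hp]; simp) _ (tendsto_integral_vertical_inv_of_lt hσ)
    simpa using this

theorem hasOnRight_loopContour {σ δ p : ℝ} {N : ℕ} (hδ : 0 < δ) (hσ : σ < p)
    (hp : ∀ k < N, p < k - δ ∨ k + δ < p) : (loopContour σ δ N).HasOnRight p := by
  refine ⟨avoids_loopContour (fun k hk => ?_) hσ.ne', ?_⟩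
  · rcases hp k hk with h | h <;> constructor <;> intro h' <;> linarith
  · have := tendsto_polygonIntegral_inv (m := 0) hσ.ne'
      (by rw [sum_rectIntegral_inv_eq_zero hδ hp]; simp) _ (tendsto_integral_vertical_inv_of_gt hσ)
    simpa using this

/-- The point j lies left of the line, which contributes πi, and inside exactly one loop, which
contributes −2πi. The total −πi is that of a point on the right. -/
theorem hasOnRight_loopContour_natCast {σ δ : ℝ} {N j : ℕ} (hδ : 0 < δ) (hδ1 : δ < 1) (hj : j < N)
    (hσ : (j : ℝ) < σ) : (loopContour σ δ N).HasOnRight ((j : ℝ) : ℂ) := by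
  have hsep : ∀ k : ℕ, k ≠ j → (j : ℝ) < k - δ ∨ k + δ < (j : ℝ) := by
    intro k hk
    rcases lt_or_gt_of_ne hk with h | h
    · have : ((k + 1 : ℕ) : ℝ) ≤ j := by exact_mod_cast h
      push_cast at this
      right; linarith
    · have : ((j + 1 : ℕ) : ℝ) ≤ k := by exact_mod_cast h
      push_cast at this
      left; linarith
  refine ⟨avoids_loopContour (fun k _ => ?_) hσ.ne, ?_⟩
  · by_cases hk : k = j
    · subst hk
      constructor <;> intro h <;> linarith
    · rcases hsep k hk with h | h <;> constructor <;> intro h' <;> linarith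
  · have hs : ∑ k ∈ Finset.range N,
        rectIntegral (fun s => (s - (j : ℝ))⁻¹) (k - δ) (k + δ) (-1) 1 =
        (1 : ℝ) * (2 * π * Complex.I) := by
      rw [Finset.sum_eq_single_of_mem j (Finset.mem_range.2 hj) fun k _ hk =>
        rectIntegral_inv_eq_zero (by linarith) (hsep k hk),
        rectIntegral_inv (by linarith) (by linarith) (by norm_num) one_pos]
      simp
    have := tendsto_polygonIntegral_inv hσ.ne hs _ (tendsto_integral_vertical_inv_of_lt hσ)
    convert this using 2
    push_cast
    ring

theorem integrableOnRays_loopContour {f : ℂ → ℂ} {σ : ℝ}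
    (hf : Integrable fun y : ℝ => f (σ + y * Complex.I)) (δ : ℝ) (N : ℕ) :
    (loopContour σ δ N).IntegrableOnRays f := by
  have h : Integrable fun y : ℝ => f (basePoint σ + y * Complex.I) := by
    refine (hf.comp_sub_right 1).congr (Eventually.of_forall fun y => ?_)
    simp only [basePoint]
    congr 1
    push_cast
    ring
  refine ⟨h.integrableOn, ?_⟩
  rw [last_loopContour]
  exact h.integrableOn

theorem integral_loopContour {f : ℂ → ℂ} {σ : ℝ}
    (hc : Continuous fun x : ℝ => f (x + ((-1 : ℝ) : ℂ) * Complex.I))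
    (hf : Integrable fun y : ℝ => f (σ + y * Complex.I)) (δ : ℝ) (N : ℕ) :
    (loopContour σ δ N).integral f = Complex.I * (∫ y : ℝ, f (σ + y * Complex.I)) -
      ∑ k ∈ Finset.range N, rectIntegral f (k - δ) (k + δ) (-1) 1 := by
  -- The rays start at the base point, one unit below the real axis, hence the translation by 1.
  have e : ∀ y : ℝ, f (basePoint σ + y * Complex.I) = f (σ + (y - 1 : ℝ) * Complex.I) := by
    intro y
    rw [basePoint]
    congr 1
    push_cast
    ring
  have hi := hf.comp_sub_right 1
  have hp := polygonIntegral_loopVertices_append hc σ δ N []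
  rw [List.append_nil] at hp
  rw [BarnesContour.integral, last_loopContour]
  simp only [loopContour, e]
  rw [hp, integral_Ici_eq_integral_Ioi,
    ← integral_sub_right_eq_self (fun y : ℝ => f (σ + y * Complex.I)) 1,
    ← intervalIntegral.integral_Iic_add_Ioi (b := 0) hi.integrableOn hi.integrableOn]
  simp only [polygonIntegral]
  ring

/-! ### Residues of Γ(−s) and the value of the Meijer function -/

/-- The quotient `sin (π s) / (s - p)`, without its removable singularity if `sin (π p) = 0`. -/
noncomputable def sinQuotient (p : ℂ) : ℂ → ℂ := dslope (fun s => Complex.sin (π * s)) p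

theorem differentiable_sinQuotient (p : ℂ) : Differentiable ℂ (sinQuotient p) := by
  have h : Differentiable ℂ fun s : ℂ => Complex.sin (π * s) := by fun_prop
  rw [← differentiableOn_univ] at h ⊢
  exact (Complex.differentiableOn_dslope univ_mem).2 h

theorem sin_pi_mul_intCast (m : ℤ) : Complex.sin (π * m) = 0 := by
  rw [mul_comm]; exact Complex.sin_int_mul_pi m

theorem cos_pi_mul_intCast_sq (m : ℤ) : Complex.cos (π * m) ^ 2 = 1 := by
  have h := Complex.sin_sq_add_cos_sq (π * m)
  rwa [sin_pi_mul_intCast, zero_pow two_ne_zero, zero_add] at h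

theorem cos_pi_mul_intCast_ne_zero (m : ℤ) : Complex.cos (π * m) ≠ 0 := fun h => by
  simpa [h] using cos_pi_mul_intCast_sq m

theorem sinQuotient_self (m : ℤ) : sinQuotient m m = π * Complex.cos (π * m) := by
  have h : HasDerivAt (fun s : ℂ => Complex.sin (π * s)) (Complex.cos (π * m) * (π * 1)) m :=
    (Complex.hasDerivAt_sin _).comp (m : ℂ) ((hasDerivAt_id (m : ℂ)).const_mul (π : ℂ))
  rw [sinQuotient, dslope_same, h.deriv]
  ring

theorem sinQuotient_mul_sub (m : ℤ) (s : ℂ) :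
    sinQuotient m s * (s - m) = Complex.sin (π * s) := by
  have h := sub_smul_dslope (fun s : ℂ => Complex.sin (π * s)) (m : ℂ) s
  rw [smul_eq_mul, sin_pi_mul_intCast, sub_zero, mul_comm] at h
  exact h

/-- The zeros of sin(πs) are the integers. The only one within distance 1 of m in real part is m,
where the quotient takes the nonzero value π cos(πm). -/
theorem sinQuotient_ne_zero {m : ℤ} {s : ℂ} (h : |s.re - m| < 1) : sinQuotient m s ≠ 0 := by
  have hpi : (π : ℂ) ≠ 0 := by exact_mod_cast Real.pi_ne_zero
  by_cases hs : s = m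
  · rw [hs, sinQuotient_self]
    exact mul_ne_zero hpi (cos_pi_mul_intCast_ne_zero m)
  · intro h0
    have h1 := sinQuotient_mul_sub m s
    rw [h0, zero_mul, eq_comm, Complex.sin_eq_zero_iff] at h1
    obtain ⟨k, hk⟩ := h1
    rw [mul_comm] at hk
    have hk := mul_right_cancel₀ hpi hk
    rw [hk, Complex.intCast_re] at h
    have : |k - m| < 1 := by exact_mod_cast h
    rw [Int.abs_lt_one_iff, sub_eq_zero] at this
    exact hs (by rw [hk, this])

theorem ne_neg_natCast_of_im_ne_zero {z : ℂ} (hz : z.im ≠ 0) (m : ℕ) : z ≠ -m := by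
  rintro rfl
  simp at hz

theorem ne_neg_natCast_of_re_pos {z : ℂ} (hz : 0 < z.re) (m : ℕ) : z ≠ -m := by
  rintro rfl
  have : (0 : ℝ) ≤ m := m.cast_nonneg
  simp only [Complex.neg_re, Complex.natCast_re] at hz
  linarith

theorem differentiableAt_Gamma_const_add {x s : ℂ} (h : ∀ m : ℕ, x + s ≠ -m) :
    DifferentiableAt ℂ (fun s => Complex.Gamma (x + s)) s :=
  (Complex.differentiableAt_Gamma _ h).comp s (by fun_prop)

theorem differentiableAt_Gamma_const_sub {x s : ℂ} (h : ∀ m : ℕ, x - s ≠ -m) :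
    DifferentiableAt ℂ (fun s => Complex.Gamma (x - s)) s :=
  (Complex.differentiableAt_Gamma _ h).comp s (by fun_prop)

theorem differentiable_Gamma_inv_const_add (x : ℂ) :
    Differentiable ℂ fun s => (Complex.Gamma (x + s))⁻¹ :=
  Complex.differentiable_one_div_Gamma.comp (by fun_prop)

theorem differentiableAt_betaProd {a b c e : ℝ} {s : ℂ} (hb : ∀ m : ℕ, (b : ℂ) + 1 + s ≠ -m)
    (he : ∀ m : ℕ, (e : ℂ) + 1 + s ≠ -m) : DifferentiableAt ℂ (betaProd a b c e) s := by
  unfold betaProd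
  simp only [div_eq_mul_inv]
  exact (((differentiableAt_Gamma_const_add hb).mul_const _).mul
    (differentiable_Gamma_inv_const_add _ s)).mul
    (((differentiableAt_Gamma_const_add he).mul_const _).mul
      (differentiable_Gamma_inv_const_add _ s))

/-- The integrand of the Barnes integral for `J₃`, without the factor `Γ(-s)`. -/
noncomputable def barnesRest (a b c d e : ℝ) (s : ℂ) : ℂ :=
  Complex.Gamma (d + s) * (Complex.Gamma (a + 1 + s) * Complex.Gamma (c - d + 1 - s)) *
    betaProd a b c e s

theorem differentiableAt_barnesRest {a b c d e : ℝ} {s : ℂ} (h1 : ∀ m : ℕ, (d : ℂ) + s ≠ -m)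
    (h2 : ∀ m : ℕ, (a : ℂ) + 1 + s ≠ -m) (h3 : ∀ m : ℕ, (c : ℂ) - d + 1 - s ≠ -m)
    (h4 : ∀ m : ℕ, (b : ℂ) + 1 + s ≠ -m) (h5 : ∀ m : ℕ, (e : ℂ) + 1 + s ≠ -m) :
    DifferentiableAt ℂ (barnesRest a b c d e) s :=
  ((differentiableAt_Gamma_const_add h1).mul ((differentiableAt_Gamma_const_add h2).mul
    (differentiableAt_Gamma_const_sub h3))).mul (differentiableAt_betaProd h4 h5)

/-- The reflection formula, arranged so that the poles sit in the sine and the other factor is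
entire. -/
theorem Gamma_neg_eq {s : ℂ} (hs : ∀ m : ℕ, 1 + s ≠ -m) :
    Complex.Gamma (-s) = -π * (Complex.Gamma (1 + s))⁻¹ / Complex.sin (π * s) := by
  have h := Complex.Gamma_mul_Gamma_one_sub (-s)
  rw [sub_neg_eq_add, mul_neg, Complex.sin_neg, div_neg, ← neg_div] at h
  have hG := Complex.Gamma_ne_zero hs
  rw [eq_div_of_mul_eq hG h]
  field_simp

/-- Γ(−s) has residue −(−1)^k/k! at k, and δ < 1 keeps every other pole out of the box. Replacing
sin(πs) by its quotient with s − k reduces the claim to Cauchy's formula. -/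
theorem rectIntegral_Gamma_neg_mul {g : ℂ → ℂ} {δ : ℝ} (hδ : 0 < δ) (hδ1 : δ < 1) (k : ℕ)
    (hg : ∀ s : ℂ, s.re ∈ Icc (k - δ) (k + δ) → DifferentiableAt ℂ g s) :
    rectIntegral (fun s => Complex.Gamma (-s) * g s) (k - δ) (k + δ) (-1) 1 =
      -(2 * π * Complex.I * ((-1) ^ k / (Nat.factorial k : ℂ) * g k)) := by
  have hpi : (π : ℂ) ≠ 0 := by exact_mod_cast Real.pi_ne_zero
  have hk0 : (0 : ℝ) ≤ k := k.cast_nonneg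
  have hre : ∀ s : ℂ, s.re ∈ Icc (k - δ) (k + δ) → |s.re - (k : ℤ)| < 1 := by
    intro s hs
    rw [Int.cast_natCast, abs_lt]
    constructor <;> linarith [hs.1, hs.2]
  have hpos : ∀ s : ℂ, s.re ∈ Icc (k - δ) (k + δ) → ∀ m : ℕ, 1 + s ≠ -m := fun s hs =>
    ne_neg_natCast_of_re_pos (by simp; linarith [hs.1])
  set G : ℂ → ℂ := fun s => -π * (Complex.Gamma (1 + s))⁻¹ / sinQuotient (k : ℤ) s * g s with hG
  have hGd : DifferentiableOn ℂ G (Icc (k - δ) (k + δ) ×ℂ Icc (-1) 1) := fun s hs =>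
    ((((differentiable_Gamma_inv_const_add 1 s).const_mul _).div (differentiable_sinQuotient _ s)
      (sinQuotient_ne_zero (hre s hs.1))).mul (hg s hs.1)).differentiableWithinAt
  have h := rectIntegral_div_sub (p := (k : ℝ)) (by linarith : (k : ℝ) - δ < k) (by linarith)
    (by norm_num) one_pos hGd
  have hval : G (k : ℝ) = -((-1) ^ k / (Nat.factorial k : ℂ) * g k) := by
    have hc : Complex.cos (π * ((k : ℤ) : ℂ)) = (-1) ^ k := by
      rw [Int.cast_natCast, mul_comm]
      exact_mod_cast congrArg Complex.ofReal (Real.cos_nat_mul_pi k)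
    have hs := sinQuotient_self (k : ℤ)
    rw [hc, Int.cast_natCast] at hs
    have h1 : ((-1 : ℂ) ^ k) * (-1) ^ k = 1 := by rw [← mul_pow]; simp
    have h2 : ((-1 : ℂ) ^ k) ≠ 0 := pow_ne_zero _ (by norm_num)
    have hf : (Nat.factorial k : ℂ) ≠ 0 := by exact_mod_cast k.factorial_ne_zero
    simp only [hG, Int.cast_natCast, Complex.ofReal_natCast]
    rw [hs, add_comm, Complex.Gamma_nat_eq_factorial]
    field_simp
    linear_combination (g k) * h1
  rw [hval] at h
  rw [← mul_neg, ← h]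
  refine rectIntegral_congr (by linarith) (by norm_num) fun s hs _ hb => ?_
  have hne : s - (k : ℝ) ≠ 0 := by
    intro h0
    rw [sub_eq_zero] at h0
    subst h0
    simp only [Complex.ofReal_re, Complex.ofReal_im] at hb
    rcases hb with h | h | h | h <;> linarith
  have hq := sinQuotient_ne_zero (hre s hs)
  rw [Gamma_neg_eq (hpos s hs), ← sinQuotient_mul_sub (k : ℤ)]
  simp only [hG]
  rw [Complex.ofReal_natCast] at hne ⊢
  rw [Int.cast_natCast] at hq ⊢
  field_simp

/-- At z = 1 the Meijer integrand differs from the integrand obtained for J₃ only by the constants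
Γ(c + 1) and Γ(a + 1) contained in `betaProd`. -/
theorem meijerIntegrand_eq (a b c d e : ℝ) (hG : Complex.Gamma (c + 1) * Complex.Gamma (a + 1) ≠ 0)
    (s : ℂ) : meijerIntegrand 2 4 1 ![1 - (d : ℂ), -(a : ℂ), -(b : ℂ), -(e : ℂ)]
      ![1 - (d : ℂ) + c, 0, -1 - (b : ℂ) - c, -1 - (e : ℂ) - a] s =
    Complex.Gamma (-s) * ((Complex.Gamma (c + 1) * Complex.Gamma (a + 1))⁻¹ *
      barnesRest a b c d e s) := by
  have h1 := left_ne_zero_of_mul hG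
  have h2 := right_ne_zero_of_mul hG
  simp only [meijerIntegrand, Fin.prod_univ_four, barnesRest, betaProd]
  simp only [Fin.isValue, Fin.coe_ofNat_eq_mod,
    Matrix.cons_val, Matrix.cons_val_zero, Matrix.cons_val_one, Complex.one_cpow]
  norm_num
  rw [show (1 : ℂ) - d + c - s = c - d + 1 - s by ring,
    show (1 : ℂ) - (-1 - b - c) + s = b + c + 2 + s by ring,
    show (1 : ℂ) - (-1 - e - a) + s = e + a + 2 + s by ring,
    show (1 : ℂ) + a + s = a + 1 + s by ring, show (1 : ℂ) + b + s = b + 1 + s by ring,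
    show (1 : ℂ) + e + s = e + 1 + s by ring]
  field_simp

/-- For N ≥ 1 the poles −d − j of Γ(d + s) are congruent modulo 1 to φ = −d − (N − 1), which lies in
(0, 1). A δ below φ and 1 − φ keeps them all outside the loops. The bound m will keep the loops to
the right of the other left-hand poles. -/
theorem exists_loop_size {d m : ℝ} {N : ℕ} (hm : 0 < m) (h : -d < N)
    (hN : N = 0 ∨ (N : ℝ) - 1 < -d) : ∃ δ : ℝ, 0 < δ ∧ δ < 1 ∧ δ < m ∧
      (∀ k < N, k + δ < -d) ∧ ∀ k < N, ∀ j : ℕ, -d - j < k - δ ∨ k + δ < -d - j := by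
  rcases Nat.eq_zero_or_pos N with h0 | hpos
  · subst h0
    exact ⟨min m 1 / 2, by positivity, by linarith [min_le_right m 1],
      by linarith [min_le_left m 1, lt_min hm one_pos], by simp, by simp⟩
  have hN : (N : ℝ) - 1 < -d := hN.resolve_left hpos.ne'
  set φ := -d - (N - 1) with hφ
  have hφ0 : 0 < φ := by simp only [hφ]; linarith
  have hφ1 : 0 < 1 - φ := by simp only [hφ]; linarith
  have hmin : 0 < min m (min φ (1 - φ)) := lt_min hm (lt_min hφ0 hφ1)
  have e1 : min m (min φ (1 - φ)) ≤ m := min_le_left _ _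
  have e2 : min m (min φ (1 - φ)) ≤ φ := (min_le_right _ _).trans (min_le_left _ _)
  have e3 : min m (min φ (1 - φ)) ≤ 1 - φ := (min_le_right _ _).trans (min_le_right _ _)
  have hkN : ∀ k < N, (k : ℝ) + 1 ≤ N := fun k hk => by exact_mod_cast hk
  refine ⟨min m (min φ (1 - φ)) / 2, by positivity, by linarith, by linarith, fun k hk => ?_,
    fun k hk j => ?_⟩
  · have := hkN k hk
    simp only [hφ] at *
    linarith
  · rcases lt_or_ge ((N : ℤ) - 1 - j - k) 0 with hneg | hge
    · left
      have : (N : ℝ) - 1 - j - k ≤ -1 := by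
        have : (N : ℤ) - 1 - j - k ≤ -1 := by omega
        exact_mod_cast this
      simp only [hφ] at *
      linarith
    · right
      have : (0 : ℝ) ≤ (N : ℝ) - 1 - j - k := by exact_mod_cast hge
      simp only [hφ] at *
      linarith

/-- The residue terms in `Gamma_mul_J3_eq_line` are exactly the contributions of the clockwise
loops, so line and residues combine into one contour integral. -/
theorem exists_isMeijerG {a b c d e t : ℝ} (ha : -1 < a) (hb : -1 < b) (hc : -1 < c) (he : -1 < e)
    (hat : -(a + 1) < t) (hbt : -(b + 1) < t) (het : -(e + 1) < t) (ht : t < c - d + 1)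
    (hd : ∀ k : ℕ, d ≠ -(k : ℝ)) :
    ∃ g : ℂ, IsMeijerG 2 4 1 ![1 - (d : ℂ), -(a : ℂ), -(b : ℂ), -(e : ℂ)]
          ![1 - (d : ℂ) + c, 0, -1 - (b : ℂ) - c, -1 - (e : ℂ) - a] g ∧
        (J3 a b c d e 0 : ℂ) =
          ((Real.Gamma (1 + a) * Real.Gamma (1 + c) /
            (Real.Gamma d * Real.Gamma (2 + a + c - d)) : ℝ) : ℂ) * g := by
  -- The inequality is strict because −d is not a natural number.
  have hN1 : -d < ⌈-d⌉₊ := lt_of_le_of_ne (Nat.le_ceil _) fun h => hd _ (by linarith)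
  have hN2 : ⌈-d⌉₊ = 0 ∨ (⌈-d⌉₊ : ℝ) - 1 < -d := by
    rcases le_or_gt (-d) 0 with h | h
    · exact Or.inl (Nat.ceil_eq_zero.2 h)
    · exact Or.inr (by linarith [Nat.ceil_lt_add_one h.le])
  set N := ⌈-d⌉₊ with hN
  have hN0 : (0 : ℝ) ≤ N := N.cast_nonneg
  -- There is room: −d < c − d + 1 because c > −1, and the other three lower bounds are negative and
  -- lie below t < c − d + 1.
  obtain ⟨σ, hσ1, hσ2⟩ : ∃ σ, max (max (-d) (-(a + 1))) (max (-(b + 1)) (-(e + 1))) < σ ∧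
      σ < min (N : ℝ) (c - d + 1) := by
    apply exists_between
    simp only [max_lt_iff, lt_min_iff]
    refine ⟨⟨⟨?_, ?_⟩, ?_, ?_⟩, ⟨?_, ?_⟩, ?_, ?_⟩ <;> linarith
  simp only [max_lt_iff, lt_min_iff] at hσ1 hσ2
  obtain ⟨⟨hσd, hσa⟩, hσb, hσe⟩ := hσ1
  obtain ⟨hσN, hσq⟩ := hσ2
  obtain ⟨δ, hδ0, hδ1, hδm, hδd, hδj⟩ := exists_loop_size (m := min (a + 1) (min (b + 1) (e + 1)))
    (lt_min (by linarith) (lt_min (by linarith) (by linarith))) hN1 hN2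
  simp only [lt_min_iff] at hδm
  obtain ⟨hδa, hδb, hδe⟩ := hδm
  obtain ⟨hint, hJ⟩ := Gamma_mul_J3_eq_line ha hb hc he hσd hσN hN2 hσa hσq hσb hσe
  have hGa : Complex.Gamma (a + 1) ≠ 0 :=
    Complex.Gamma_ne_zero_of_re_pos (by simp; linarith)
  have hGc : Complex.Gamma (c + 1) ≠ 0 :=
    Complex.Gamma_ne_zero_of_re_pos (by simp; linarith)
  have hGp : Complex.Gamma (a + c - d + 2) ≠ 0 :=
    Complex.Gamma_ne_zero_of_re_pos (by simp; linarith)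
  have hGd : Complex.Gamma d ≠ 0 := Complex.Gamma_ne_zero fun m h => hd m (by exact_mod_cast h)
  set A : ℂ := (Complex.Gamma (c + 1) * Complex.Gamma (a + 1))⁻¹ with hA
  set F : ℂ → ℂ := fun s => Complex.Gamma (-s) * (A * barnesRest a b c d e s) with hF
  have hFm : meijerIntegrand 2 4 1 ![1 - (d : ℂ), -(a : ℂ), -(b : ℂ), -(e : ℂ)]
      ![1 - (d : ℂ) + c, 0, -1 - (b : ℂ) - c, -1 - (e : ℂ) - a] = F :=
    funext fun s => meijerIntegrand_eq a b c d e (mul_ne_zero hGc hGa) s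
  have hFline : ∀ y : ℝ, F (σ + y * Complex.I) = A * (Complex.Gamma (d + (σ + y * Complex.I)) *
        Complex.Gamma (-(σ + y * Complex.I)) * (Complex.Gamma (a + 1 + (σ + y * Complex.I)) *
          Complex.Gamma (c - d + 1 - (σ + y * Complex.I))) *
            betaProd a b c e (σ + y * Complex.I)) := by
    intro y
    simp only [hF, barnesRest]
    ring
  have hFi : Integrable fun y : ℝ => F (σ + y * Complex.I) := by
    simp only [hFline]
    exact hint.const_mul A
  have hFc : Continuous fun x : ℝ => F (x + ((-1 : ℝ) : ℂ) * Complex.I) := by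
    refine continuous_iff_continuousAt.2 fun x => ContinuousAt.comp (f := fun x : ℝ =>
      (x : ℂ) + ((-1 : ℝ) : ℂ) * Complex.I) (g := F) (DifferentiableAt.continuousAt (𝕜 := ℂ) ?_)
      (by fun_prop)
    refine DifferentiableAt.mul ?_ (DifferentiableAt.const_mul (differentiableAt_barnesRest ?_ ?_ ?_ ?_ ?_) A)
    · exact (Complex.differentiableAt_Gamma _ (ne_neg_natCast_of_im_ne_zero (by simp))).comp _
        (by fun_prop)
    all_goals exact ne_neg_natCast_of_im_ne_zero (by simp)
  have hkN : ∀ k < N, (k : ℝ) < σ := fun k hk => by linarith [hδd k hk]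
  refine ⟨_, ⟨loopContour σ δ N, ⟨?_, ?_⟩, ?_, rfl⟩, ?_⟩
  · intro j _ k
    have hk0 : (0 : ℝ) ≤ k := k.cast_nonneg
    fin_cases j
    · have := hasOnLeft_loopContour (σ := σ) (p := -d - k) hδ0 (by linarith) fun l hl => hδj l hl k
      convert this using 1
      simp
    · have := hasOnLeft_loopContour (σ := σ) (N := N) (p := -a - 1 - k) hδ0 (by linarith)
        fun l _ => Or.inl (by linarith [l.cast_nonneg (α := ℝ)])
      convert this using 1
      simp
    · have := hasOnLeft_loopContour (σ := σ) (N := N) (p := -b - 1 - k) hδ0 (by linarith)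
        fun l _ => Or.inl (by linarith [l.cast_nonneg (α := ℝ)])
      convert this using 1
      simp
    · have := hasOnLeft_loopContour (σ := σ) (N := N) (p := -e - 1 - k) hδ0 (by linarith)
        fun l _ => Or.inl (by linarith [l.cast_nonneg (α := ℝ)])
      convert this using 1
      simp
  · intro j hj k
    have hk0 : (0 : ℝ) ≤ k := k.cast_nonneg
    fin_cases j
    · have := hasOnRight_loopContour (σ := σ) (N := N) (p := c - d + 1 + k) hδ0 (by linarith)
        fun l hl => Or.inr (by linarith [hδd l hl])
      convert this using 1
      simp
      ring
    · rcases lt_or_ge k N with hk | hk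
      · have := hasOnRight_loopContour_natCast hδ0 hδ1 hk (hkN k hk)
        convert this using 1
        simp
      · have hk' : (N : ℝ) ≤ k := by exact_mod_cast hk
        have := hasOnRight_loopContour (σ := σ) (N := N) (p := k) hδ0 (by linarith)
          fun l hl => Or.inr (by
            have : (l : ℝ) + 1 ≤ N := by exact_mod_cast hl
            linarith)
        convert this using 1
        simp
    · simp at hj
    · simp at hj
  · rw [hFm]
    exact integrableOnRays_loopContour hFi δ N
  · rw [hFm, integral_loopContour hFc hFi]
    -- Within a loop Γ(−s) is the only singular factor: by the choice of δ the poles of `barnesRest`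
    -- stay outside, those of Γ(c − d + 1 − s) because k + δ < −d < c − d + 1.
    have hrect : ∀ k ∈ Finset.range N, rectIntegral F (k - δ) (k + δ) (-1) 1 =
        -(2 * π * Complex.I * ((-1) ^ k / (Nat.factorial k : ℂ) * (A * barnesRest a b c d e k))) := by
      intro k hk
      rw [Finset.mem_range] at hk
      have hk0 : (0 : ℝ) ≤ k := k.cast_nonneg
      refine rectIntegral_Gamma_neg_mul hδ0 hδ1 k fun s hs => DifferentiableAt.const_mul
        (differentiableAt_barnesRest (fun m h => ?_) (ne_neg_natCast_of_re_pos ?_)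
          (ne_neg_natCast_of_re_pos ?_) (ne_neg_natCast_of_re_pos ?_)
          (ne_neg_natCast_of_re_pos ?_)) A
      · have hre := congrArg Complex.re h
        simp only [Complex.add_re, Complex.ofReal_re, Complex.neg_re, Complex.natCast_re] at hre
        rcases hδj k hk m with h' | h' <;> linarith [hs.1, hs.2]
      · simp; linarith [hs.1]
      · simp; linarith [hs.2, hδd k hk]
      · simp; linarith [hs.1]
      · simp; linarith [hs.1]
    rw [Finset.sum_congr rfl hrect]
    simp only [hFline]
    rw [integral_const_mul]
    have hpi : (π : ℂ) ≠ 0 := by exact_mod_cast Real.pi_ne_zero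
    have hsum : ∑ k ∈ Finset.range N, -(2 * π * Complex.I *
        ((-1) ^ k / (Nat.factorial k : ℂ) * (A * barnesRest a b c d e k))) =
        -(2 * π * Complex.I * A) * ∑ k ∈ Finset.range N, Complex.Gamma (d + k) * (-1) ^ k /
          (Nat.factorial k : ℂ) * (Complex.Gamma (a + 1 + k) * Complex.Gamma (c - d + 1 - k)) *
            betaProd a b c e k := by
      rw [Finset.mul_sum]
      refine Finset.sum_congr rfl fun k _ => ?_
      simp only [barnesRest]
      ring
    rw [hsum]
    push_cast
    rw [← Complex.Gamma_ofReal, ← Complex.Gamma_ofReal, ← Complex.Gamma_ofReal,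
      ← Complex.Gamma_ofReal]
    push_cast
    rw [show (1 : ℂ) + a = a + 1 by ring, show (1 : ℂ) + c = c + 1 by ring,
      show (2 : ℂ) + a + c - d = a + c - d + 2 by ring]
    have hJ' := eq_div_of_mul_eq (mul_ne_zero hGd hGp) ((mul_comm _ _).trans hJ)
    rw [hJ', hA]
    have hI := Complex.I_ne_zero
    generalize (∑ k ∈ Finset.range N, Complex.Gamma (d + k) * (-1) ^ k /
          (Nat.factorial k : ℂ) * (Complex.Gamma (a + 1 + k) * Complex.Gamma (c - d + 1 - k)) *
            betaProd a b c e k) = S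
    generalize (∫ y : ℝ, Complex.Gamma (d + (σ + y * Complex.I)) *
        Complex.Gamma (-(σ + y * Complex.I)) * (Complex.Gamma (a + 1 + (σ + y * Complex.I)) *
          Complex.Gamma (c - d + 1 - (σ + y * Complex.I))) *
            betaProd a b c e (σ + y * Complex.I)) = T
    field_simp
    ring

/-! ### Moving the line to the right for 0 < w < 1 -/

/-- The integrand of the Barnes integral for the Euler integral of a Gauss hypergeometric function. -/
noncomputable def fourGamma (a d q : ℝ) (s : ℂ) : ℂ :=
  Complex.Gamma (d + s) * Complex.Gamma (-s) *
    (Complex.Gamma (a + 1 + s) * Complex.Gamma (q - s))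

/-- The coefficients of the residues of `fourGamma`. -/
noncomputable def residueCoeff (a d q : ℝ) (s : ℂ) : ℂ :=
  Complex.Gamma (d + s) * Complex.Gamma (a + 1 + s) * (Complex.Gamma (1 + s))⁻¹ *
    (Complex.Gamma (1 - q + s))⁻¹

theorem one_add_ne_neg_natCast_of_sin_ne_zero {s : ℂ} (h : Complex.sin (π * s) ≠ 0) (m : ℕ) :
    1 + s ≠ -m := by
  intro hs
  refine h ?_
  rw [show s = ((-m - 1 : ℤ) : ℂ) by push_cast; linear_combination hs]
  exact sin_pi_mul_intCast _

theorem neg_ne_neg_natCast_of_sin_ne_zero {s : ℂ} (h : Complex.sin (π * s) ≠ 0) (m : ℕ) :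
    -s ≠ -m := by
  intro hs
  refine h ?_
  rw [show s = ((m : ℤ) : ℂ) by push_cast; linear_combination -hs]
  exact sin_pi_mul_intCast _

/-- Reflection of Γ(−s) and of Γ(q − s): the poles of both right-hand families are now zeros of the
two sines. -/
theorem fourGamma_eq {a d q : ℝ} {s : ℂ} (h1 : Complex.sin (π * s) ≠ 0)
    (h2 : Complex.sin (π * (s - q)) ≠ 0) :
    fourGamma a d q s = residueCoeff a d q s * π ^ 2 /
      (Complex.sin (π * s) * Complex.sin (π * (s - q))) := by
  have e1 := Gamma_neg_eq (one_add_ne_neg_natCast_of_sin_ne_zero h1)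
  have e2 := Gamma_neg_eq (one_add_ne_neg_natCast_of_sin_ne_zero h2)
  rw [neg_sub, show (1 : ℂ) + (s - q) = 1 - q + s by ring] at e2
  rw [fourGamma, e1, e2, residueCoeff]
  field_simp

theorem sin_pi_mul_ne_zero_of_re {s : ℂ} (h : ∀ m : ℤ, s.re ≠ m) : Complex.sin (π * s) ≠ 0 := by
  intro h0
  rw [Complex.sin_eq_zero_iff] at h0
  obtain ⟨k, hk⟩ := h0
  rw [mul_comm] at hk
  have hk := mul_right_cancel₀ (by exact_mod_cast Real.pi_ne_zero) hk
  exact h k (by rw [hk, Complex.intCast_re])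

theorem exists_norm_fourGamma_mul_cpow_le (a d q : ℝ) {w : ℝ} (hw0 : 0 < w) (hw1 : w ≤ 1)
    (x₁ x₂ : ℝ) : ∃ C : ℝ, ∀ s : ℂ, s.re ∈ Icc x₁ x₂ → 1 ≤ |s.im| →
      ‖fourGamma a d q s * (w : ℂ) ^ s‖ ≤ C / s.im ^ 2 := by
  obtain ⟨C1, p1, h1⟩ := Complex.exists_norm_Gamma_le (d + x₁) (d + x₂) 0
  obtain ⟨C2, p2, h2⟩ := Complex.exists_norm_Gamma_le (-x₂) (-x₁) 2
  obtain ⟨C3, p3, h3⟩ := Complex.exists_norm_Gamma_le (a + 1 + x₁) (a + 1 + x₂) 0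
  obtain ⟨C4, p4, h4⟩ := Complex.exists_norm_Gamma_le (q - x₂) (q - x₁) 0
  refine ⟨C1 * C2 * (C3 * C4) * w ^ x₁, fun s hs him => ?_⟩
  have g1 := h1 (d + s) (by simpa using hs) (by simpa using him)
  have g2 := h2 (-s) (by simpa using hs.symm) (by simpa using him)
  have g3 := h3 (a + 1 + s) (by simpa using hs) (by simpa using him)
  have g4 := h4 (q - s) (by simp only [Complex.sub_re, Complex.ofReal_re, mem_Icc]; constructor <;> linarith [hs.1, hs.2])
    (by simpa using him)
  have g5 : ‖(w : ℂ) ^ s‖ ≤ w ^ x₁ := by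
    rw [Complex.norm_cpow_eq_rpow_re_of_pos hw0]
    exact Real.rpow_le_rpow_of_exponent_ge hw0 hw1 hs.1
  simp only [pow_zero, div_one, Complex.neg_im, abs_neg, sq_abs] at g1 g2 g3 g4
  rw [fourGamma, norm_mul, norm_mul, norm_mul, norm_mul]
  calc _ ≤ C1 * (C2 / s.im ^ 2) * (C3 * C4) * w ^ x₁ := by gcongr
    _ = _ := by ring

theorem differentiableAt_fourGamma {a d q : ℝ} {s : ℂ} (hd : -d < s.re) (ha : -(a + 1) < s.re)
    (h1 : Complex.sin (π * s) ≠ 0) (h2 : Complex.sin (π * (s - q)) ≠ 0) :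
    DifferentiableAt ℂ (fourGamma a d q) s := by
  have h3 := neg_ne_neg_natCast_of_sin_ne_zero h2
  rw [neg_sub] at h3
  refine ((differentiableAt_Gamma_const_add (ne_neg_natCast_of_re_pos ?_)).mul
    ((Complex.differentiableAt_Gamma _ (neg_ne_neg_natCast_of_sin_ne_zero h1)).comp s
      (by fun_prop))).mul ((differentiableAt_Gamma_const_add (ne_neg_natCast_of_re_pos ?_)).mul
        (differentiableAt_Gamma_const_sub h3))
  · simp; linarith
  · simp; linarith

theorem integrable_fourGamma_mul_cpow_line {a d q w x : ℝ} (hw0 : 0 < w) (hw1 : w ≤ 1) (hd : -d < x)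
    (ha : -(a + 1) < x) (h1 : ∀ m : ℤ, x ≠ m) (h2 : ∀ m : ℤ, x - q ≠ m) :
    Integrable fun y : ℝ => fourGamma a d q (x + y * Complex.I) * (w : ℂ) ^ (x + y * Complex.I) := by
  obtain ⟨C, hC⟩ := exists_norm_fourGamma_mul_cpow_le a d q hw0 hw1 x x
  refine integrable_of_continuous_of_norm_le (C := C) ?_ fun y hy => ?_
  · refine continuous_iff_continuousAt.2 fun y => ContinuousAt.comp (f := fun y : ℝ =>
      (x : ℂ) + y * Complex.I) (g := fun s : ℂ => fourGamma a d q s * (w : ℂ) ^ s)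
      (DifferentiableAt.continuousAt (𝕜 := ℂ) ?_) (by fun_prop)
    refine (differentiableAt_fourGamma (by simpa using hd) (by simpa using ha)
      (sin_pi_mul_ne_zero_of_re (by simpa using h1))
      (sin_pi_mul_ne_zero_of_re (by simpa using h2))).mul ?_
    exact (differentiableAt_id).const_cpow (Or.inl (by exact_mod_cast hw0.ne'))
  · simpa using hC (x + y * Complex.I) (by simp) (by simpa using hy)

theorem differentiableAt_residueCoeff {a d q : ℝ} {s : ℂ} (hd : -d < s.re) (ha : -(a + 1) < s.re) :
    DifferentiableAt ℂ (residueCoeff a d q) s := by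
  refine (((differentiableAt_Gamma_const_add (ne_neg_natCast_of_re_pos ?_)).mul
    (differentiableAt_Gamma_const_add (ne_neg_natCast_of_re_pos ?_))).mul
    (differentiable_Gamma_inv_const_add _ s)).mul (differentiable_Gamma_inv_const_add _ s)
  · simp; linarith
  · simp; linarith

theorem sin_pi_mul_intCast_sub (m : ℤ) (z : ℂ) :
    Complex.sin (π * (m - z)) = -(Complex.cos (π * m) * Complex.sin (π * z)) := by
  rw [mul_sub, Complex.sin_sub, sin_pi_mul_intCast]
  ring

theorem sin_pi_mul_add_intCast (m : ℤ) (z : ℂ) :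
    Complex.sin (π * (z + m)) = Complex.cos (π * m) * Complex.sin (π * z) := by
  rw [mul_add, Complex.sin_add, sin_pi_mul_intCast]
  ring

/-- A strip of width one contains a single integer m and a single point q + j, and these differ
because q is not an integer. If m or j is negative there is no pole, but `residueCoeff` vanishes
there, so no case distinction is needed. -/
theorem integral_fourGamma_line_succ_sub {a d q w x : ℝ} {m j : ℤ} (hw0 : 0 < w) (hw1 : w ≤ 1)
    (hd : -d < x) (ha : -(a + 1) < x) (hq : ∀ k : ℤ, q ≠ k) (hm : x < m) (hm1 : m < x + 1)
    (hj : x < q + j) (hj1 : q + j < x + 1) :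
    (∫ y : ℝ, fourGamma a d q ((x + 1 : ℝ) + y * Complex.I) *
        (w : ℂ) ^ (((x + 1 : ℝ) : ℂ) + y * Complex.I)) -
      ∫ y : ℝ, fourGamma a d q (x + y * Complex.I) * (w : ℂ) ^ (x + y * Complex.I) =
    2 * π * (π / Complex.sin (π * q) * (residueCoeff a d q (q + j) * (w : ℂ) ^ ((q : ℂ) + j) -
      residueCoeff a d q m * (w : ℂ) ^ (m : ℂ))) := by
  have hpi : (π : ℂ) ≠ 0 := by exact_mod_cast Real.pi_ne_zero
  have hx1 : ∀ k : ℤ, x ≠ k := by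
    rintro k rfl
    have h3 : k < m := by exact_mod_cast hm
    have h4 : m < k + 1 := by exact_mod_cast hm1
    omega
  have hx2 : ∀ k : ℤ, x - q ≠ k := by
    intro k hk
    have h3 : (k : ℝ) < j := by linarith
    have h4 : (j : ℝ) < k + 1 := by linarith
    have h3 : k < j := by exact_mod_cast h3
    have h4 : j < k + 1 := by exact_mod_cast h4
    omega
  have hsq : Complex.sin (π * q) ≠ 0 := sin_pi_mul_ne_zero_of_re (by simpa using hq)
  have hpq : (m : ℝ) ≠ q + j := fun h => hq (m - j) (by push_cast; linarith)
  obtain ⟨C, hC⟩ := exists_norm_fourGamma_mul_cpow_le a d q hw0 hw1 x (x + 1)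
  have hQ1 : ∀ s : ℂ, s.re ∈ Icc x (x + 1) → sinQuotient m s ≠ 0 := fun s hs =>
    sinQuotient_ne_zero (by rw [abs_lt]; constructor <;> linarith [hs.1, hs.2])
  have hQ2 : ∀ s : ℂ, s.re ∈ Icc x (x + 1) → sinQuotient j (s - q) ≠ 0 := fun s hs =>
    sinQuotient_ne_zero (by
      rw [abs_lt, Complex.sub_re, Complex.ofReal_re]; constructor <;> linarith [hs.1, hs.2])
  set g : ℂ → ℂ := fun s => residueCoeff a d q s * π ^ 2 * (w : ℂ) ^ s /
    (sinQuotient m s * sinQuotient j (s - q)) with hg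
  have key := integral_line_sub_integral_line (p := (m : ℝ)) (q := q + j) (g := g)
    (f := fun s => fourGamma a d q s * (w : ℂ) ^ s) hm hm1 hj hj1 hpq ?_ ?_ hC
    (integrable_fourGamma_mul_cpow_line hw0 hw1 hd ha hx1 hx2)
    (integrable_fourGamma_mul_cpow_line hw0 hw1 (by linarith) (by linarith)
      (fun k hk => hx1 (k - 1) (by push_cast; linarith))
      (fun k hk => hx2 (k - 1) (by push_cast; linarith)))
  · rw [key]
    congr 1
    have hmj : (m : ℂ) - (q + j) ≠ 0 := by
      rw [sub_ne_zero]; exact_mod_cast hpq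
    have hmm := hQ1 ((m : ℝ) : ℂ) (by simpa using ⟨hm.le, hm1.le⟩)
    have hjj := hQ2 ((m : ℝ) : ℂ) (by simpa using ⟨hm.le, hm1.le⟩)
    have hqq := hQ1 ((q + j : ℝ) : ℂ) (by simpa using ⟨hj.le, hj1.le⟩)
    -- At either point the derivative of one sine and the value of the other carry the same cosine,
    -- ±1. It appears squared, so no alternating sign survives.
    have e1 : sinQuotient j ((m : ℂ) - q) * (m - (q + j)) =
        -(Complex.cos (π * m) * Complex.sin (π * q)) := by
      rw [← sin_pi_mul_intCast_sub, ← sinQuotient_mul_sub j, sub_sub]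
    have e2 : sinQuotient m ((q : ℂ) + j) * (m - (q + j)) =
        -(Complex.cos (π * j) * Complex.sin (π * q)) := by
      rw [← sin_pi_mul_add_intCast, ← sinQuotient_mul_sub m]
      ring
    have c1 := cos_pi_mul_intCast_sq m
    have c2 := cos_pi_mul_intCast_sq j
    have c1' := cos_pi_mul_intCast_ne_zero m
    have c2' := cos_pi_mul_intCast_ne_zero j
    simp only [hg]
    push_cast at hmm hjj hqq ⊢
    rw [add_sub_cancel_left, sinQuotient_self, sinQuotient_self]
    rw [sub_div, div_div, div_div,
      show (π : ℂ) * Complex.cos (π * m) * sinQuotient j (m - q) * (m - (q + j)) =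
        π * Complex.cos (π * m) * (sinQuotient j (m - q) * (m - (q + j))) by ring,
      show sinQuotient m ((q : ℂ) + j) * (π * Complex.cos (π * j)) * (m - (q + j)) =
        π * Complex.cos (π * j) * (sinQuotient m ((q : ℂ) + j) * (m - (q + j))) by ring, e1, e2]
    rw [show (π : ℂ) * Complex.cos (π * m) * -(Complex.cos (π * m) * Complex.sin (π * q)) =
      -(π * Complex.cos (π * m) ^ 2 * Complex.sin (π * q)) by ring,
      show (π : ℂ) * Complex.cos (π * j) * -(Complex.cos (π * j) * Complex.sin (π * q)) =
      -(π * Complex.cos (π * j) ^ 2 * Complex.sin (π * q)) by ring, c1, c2]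
    field_simp
    ring
  · intro s hs
    have hs : s.re ∈ Icc x (x + 1) := hs
    refine DifferentiableAt.differentiableWithinAt ?_
    refine DifferentiableAt.div ((DifferentiableAt.mul_const (differentiableAt_residueCoeff
      (by linarith [hs.1]) (by linarith [hs.1])) _).mul ?_) ?_ (mul_ne_zero (hQ1 s hs) (hQ2 s hs))
    · exact (differentiableAt_id).const_cpow (Or.inl (by exact_mod_cast hw0.ne'))
    · exact (differentiable_sinQuotient _ s).mul
        ((differentiable_sinQuotient j (s - q)).comp s (by fun_prop))
  · intro s hs h1 h2
    have n1 := sinQuotient_mul_sub m s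
    have n2 := sinQuotient_mul_sub j (s - q)
    have h1' : s - (m : ℂ) ≠ 0 := sub_ne_zero.2 (by simpa using h1)
    have h2' : s - q - (j : ℂ) ≠ 0 := by
      rw [sub_sub]; exact sub_ne_zero.2 (by simpa using h2)
    have hq1 := hQ1 s hs
    have hq2 := hQ2 s hs
    rw [fourGamma_eq (by rw [← n1]; exact mul_ne_zero hq1 h1')
      (by rw [← n2]; exact mul_ne_zero hq2 h2'), ← n1, ← n2]
    simp only [hg]
    push_cast
    have h3' : s - (q + j : ℂ) ≠ 0 := by rwa [← sub_sub]
    rw [sub_sub s (q : ℂ) j]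
    field_simp

theorem norm_add_le_mul_norm {κ : ℝ} (u v : ℂ) {R : ℝ} (hR : ‖u - v‖ ≤ (κ - 1) * R)
    (hκ : 1 ≤ κ) (hv : R ≤ ‖v‖) : ‖u‖ ≤ κ * ‖v‖ := by
  have h : ‖u‖ ≤ ‖u - v‖ + ‖v‖ := by simpa using norm_add_le (u - v) v
  nlinarith

/-- Far to the right each linear factor on the left is at most κ = w^(−1/4) times its partner, since
the two differ by a constant. The ratio is then at most wκ² = √w < 1, uniformly in Im s. -/
theorem exists_norm_mul_norm_le (a d q : ℝ) {w : ℝ} (hw0 : 0 < w) (hw1 : w < 1) :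
    ∃ ρ R : ℝ, 0 ≤ ρ ∧ ρ < 1 ∧ ∀ s : ℂ, R ≤ s.re →
      w * (‖(d : ℂ) + s‖ * ‖(a : ℂ) + 1 + s‖) ≤ ρ * (‖1 + s‖ * ‖(1 : ℂ) - q + s‖) := by
  set κ := w ^ (-(1 / 4) : ℝ) with hκ
  have hκ1 : 1 < κ := Real.one_lt_rpow_of_pos_of_lt_one_of_neg hw0 hw1 (by norm_num)
  have hκw : w * κ ^ 2 = w ^ (1 / 2 : ℝ) := by
    rw [hκ, ← Real.rpow_natCast, ← Real.rpow_mul hw0.le]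
    nth_rewrite 1 [← Real.rpow_one w]
    rw [← Real.rpow_add hw0]
    norm_num
  refine ⟨w * κ ^ 2, max (‖(d : ℂ) - 1‖ / (κ - 1)) (‖(a : ℂ) + q‖ / (κ - 1) + q), by positivity, ?_,
    fun s hs => ?_⟩
  · rw [hκw]
    exact Real.rpow_lt_one hw0.le hw1 (by norm_num)
  · have hκ0 : 0 < κ - 1 := by linarith
    have h1 := (le_max_left _ _).trans hs
    have h2 := (le_max_right _ _).trans hs
    have n1 : ‖(d : ℂ) + s‖ ≤ κ * ‖1 + s‖ := by
      refine norm_add_le_mul_norm _ _ (R := ‖(d : ℂ) - 1‖ / (κ - 1)) ?_ hκ1.le ?_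
      · rw [mul_div_cancel₀ _ hκ0.ne']
        exact le_of_eq (congrArg _ (by ring))
      · refine le_trans ?_ (Complex.re_le_norm _)
        simp; linarith
    have n2 : ‖(a : ℂ) + 1 + s‖ ≤ κ * ‖(1 : ℂ) - q + s‖ := by
      refine norm_add_le_mul_norm _ _ (R := ‖(a : ℂ) + q‖ / (κ - 1)) ?_ hκ1.le ?_
      · rw [mul_div_cancel₀ _ hκ0.ne']
        exact le_of_eq (congrArg _ (by ring))
      · refine le_trans ?_ (Complex.re_le_norm _)
        simp; linarith
    calc w * (‖(d : ℂ) + s‖ * ‖(a : ℂ) + 1 + s‖)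
        ≤ w * ((κ * ‖1 + s‖) * (κ * ‖(1 : ℂ) - q + s‖)) := by gcongr
      _ = _ := by ring

theorem ne_zero_of_re_pos {z : ℂ} (hz : 0 < z.re) : z ≠ 0 := by
  rintro rfl
  simp at hz

/-- `residueCoeff` and `fourGamma` obey the same recurrence in s. With the bound on its ratio this
makes both the residue series and the shifted line integrals decay geometrically. -/
theorem residueCoeff_add_one {a d q : ℝ} {s : ℂ} (hd : -d < s.re) (ha : -(a + 1) < s.re) :
    residueCoeff a d q (s + 1) * ((1 + s) * (1 - q + s)) =
      residueCoeff a d q s * ((d + s) * (a + 1 + s)) := by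
  have e1 := Complex.Gamma_add_one (d + s) (ne_zero_of_re_pos (by simp; linarith))
  have e2 := Complex.Gamma_add_one (a + 1 + s) (ne_zero_of_re_pos (by simp; linarith))
  have e3 := Complex.one_div_Gamma_eq_self_mul_one_div_Gamma_add_one (1 + s)
  have e4 := Complex.one_div_Gamma_eq_self_mul_one_div_Gamma_add_one (1 - q + s)
  simp only [residueCoeff, ← add_assoc]
  rw [e1, e2, e3, e4]
  ring

theorem fourGamma_add_one {a d q : ℝ} {s : ℂ} (hd : -d < s.re) (ha : -(a + 1) < s.re)
    (h1 : 1 + s ≠ 0) (h2 : (1 : ℂ) - q + s ≠ 0) :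
    fourGamma a d q (s + 1) * ((1 + s) * (1 - q + s)) =
      fourGamma a d q s * ((d + s) * (a + 1 + s)) := by
  have e1 := Complex.Gamma_add_one (d + s) (ne_zero_of_re_pos (by simp; linarith))
  have e2 := Complex.Gamma_add_one (a + 1 + s) (ne_zero_of_re_pos (by simp; linarith))
  have e3 := Complex.Gamma_add_one (-(s + 1)) (by
    rw [neg_ne_zero, add_comm]; exact h1)
  have e4 := Complex.Gamma_add_one (q - (s + 1)) (fun h => h2 (by linear_combination -h))
  rw [show -(s + 1) + 1 = -s by ring] at e3
  rw [show (q : ℂ) - (s + 1) + 1 = q - s by ring] at e4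
  simp only [fourGamma, ← add_assoc]
  rw [e1, e2, e3, e4]
  ring

theorem norm_mul_cpow_add_one_le {w ρ : ℝ} (hw0 : 0 < w) {f0 f1 s A B : ℂ} (hB : 0 < ‖B‖)
    (h : f1 * B = f0 * A) (hAB : w * ‖A‖ ≤ ρ * ‖B‖) :
    ‖f1 * (w : ℂ) ^ (s + 1)‖ ≤ ρ * ‖f0 * (w : ℂ) ^ s‖ := by
  have hn := congrArg norm h
  rw [norm_mul, norm_mul] at hn
  rw [Complex.cpow_add _ _ (by exact_mod_cast hw0.ne'), Complex.cpow_one, norm_mul, norm_mul, norm_mul,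
    Complex.norm_real, Real.norm_eq_abs, abs_of_pos hw0]
  refine le_of_mul_le_mul_right ?_ hB
  calc ‖f1‖ * (‖(w : ℂ) ^ s‖ * w) * ‖B‖ = ‖f0‖ * ‖(w : ℂ) ^ s‖ * (w * ‖A‖) := by
        rw [mul_right_comm, hn]; ring
    _ ≤ ‖f0‖ * ‖(w : ℂ) ^ s‖ * (ρ * ‖B‖) := by gcongr
    _ = _ := by ring

theorem norm_pos_of_re_pos {z : ℂ} (hz : 0 < z.re) : 0 < ‖z‖ := norm_pos_iff.2 (ne_zero_of_re_pos hz)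

/-- The line integrals tend to zero as the line moves to the right. -/
theorem tendsto_integral_fourGamma_line {a d q w σ : ℝ} (hw0 : 0 < w) (hw1 : w < 1) (hd : -d < σ)
    (ha : -(a + 1) < σ) (h1 : ∀ m : ℤ, σ ≠ m) (h2 : ∀ m : ℤ, σ - q ≠ m) :
    Tendsto (fun n : ℕ => ∫ y : ℝ, fourGamma a d q ((σ + n : ℝ) + y * Complex.I) *
      (w : ℂ) ^ (((σ + n : ℝ) : ℂ) + y * Complex.I)) atTop (𝓝 0) := by
  obtain ⟨ρ, R, hρ0, hρ1, hR⟩ := exists_norm_mul_norm_le a d q hw0 hw1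
  have hint : ∀ n : ℕ, Integrable fun y : ℝ => fourGamma a d q ((σ + n : ℝ) + y * Complex.I) *
      (w : ℂ) ^ (((σ + n : ℝ) : ℂ) + y * Complex.I) := fun n => by
    have hn : (0 : ℝ) ≤ n := n.cast_nonneg
    exact integrable_fourGamma_mul_cpow_line hw0 hw1.le (by linarith) (by linarith)
      (fun m hm => h1 (m - n) (by push_cast; linarith))
      (fun m hm => h2 (m - n) (by push_cast; linarith))
  set In : ℕ → ℝ := fun n => ∫ y : ℝ, ‖fourGamma a d q ((σ + n : ℝ) + y * Complex.I) *
      (w : ℂ) ^ (((σ + n : ℝ) : ℂ) + y * Complex.I)‖ with hIn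
  have hIn0 : ∀ n, 0 ≤ In n := fun n => integral_nonneg fun y => norm_nonneg _
  obtain ⟨M, hM⟩ := exists_nat_gt (max R (max 0 q) - σ)
  -- The pointwise ratio bound holds along the whole line, so one unit step multiplies the L¹ norm
  -- by at most ρ.
  have hstep : ∀ n : ℕ, M ≤ n → In (n + 1) ≤ ρ * In n := by
    intro n hn
    have hn' : (M : ℝ) ≤ n := by exact_mod_cast hn
    have hn0 : (0 : ℝ) ≤ n := n.cast_nonneg
    have b1 := le_max_left R (max 0 q)
    have b2 := (le_max_left 0 q).trans (le_max_right R (max 0 q))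
    have b3 := (le_max_right 0 q).trans (le_max_right R (max 0 q))
    rw [hIn, ← integral_const_mul]
    refine integral_mono (hint _).norm ((hint n).norm.const_mul ρ) fun y => ?_
    set s : ℂ := ((σ + n : ℝ) : ℂ) + y * Complex.I with hs
    have hsre : s.re = σ + n := by simp [hs]
    have e : ((σ + (n + 1 : ℕ) : ℝ) : ℂ) + y * Complex.I = s + 1 := by
      simp only [hs]; push_cast; ring
    have p1 : 0 < (1 + s).re := by simp only [Complex.add_re, Complex.one_re, hsre]; linarith
    have p2 : 0 < ((1 : ℂ) - q + s).re := by
      simp only [Complex.add_re, Complex.sub_re, Complex.one_re, Complex.ofReal_re, hsre]; linarith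
    simp only [e]
    refine norm_mul_cpow_add_one_le hw0 (A := (d + s) * (a + 1 + s)) (B := (1 + s) * (1 - q + s)) ?_
      (fourGamma_add_one (by rw [hsre]; linarith) (by rw [hsre]; linarith) (ne_zero_of_re_pos p1)
        (ne_zero_of_re_pos p2)) ?_
    · rw [norm_mul]
      exact mul_pos (norm_pos_of_re_pos p1) (norm_pos_of_re_pos p2)
    · rw [norm_mul, norm_mul]
      exact hR s (by rw [hsre]; linarith)
  have hgeom : ∀ k : ℕ, In (k + M) ≤ ρ ^ k * In M := by
    intro k
    induction k with
    | zero => simp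
    | succ k ih =>
      rw [show k + 1 + M = k + M + 1 by ring, pow_succ', mul_assoc]
      exact (hstep _ (by omega)).trans (mul_le_mul_of_nonneg_left ih hρ0)
  rw [← tendsto_add_atTop_iff_nat M]
  refine squeeze_zero_norm (fun k => (norm_integral_le_integral_norm _).trans (hgeom k)) ?_
  simpa using (tendsto_pow_atTop_nhds_zero_of_lt_one hρ0 hρ1).mul_const (In M)

theorem summable_residueCoeff {a d q w x : ℝ} (hw0 : 0 < w) (hw1 : w < 1) :
    Summable fun n : ℕ => residueCoeff a d q ((x : ℂ) + n) * (w : ℂ) ^ ((x : ℂ) + n) := by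
  obtain ⟨ρ, R, hρ0, hρ1, hR⟩ := exists_norm_mul_norm_le a d q hw0 hw1
  obtain ⟨M, hM⟩ := exists_nat_gt (max (max R (max 0 q)) (max (-d) (-(a + 1))) - x)
  refine summable_of_ratio_norm_eventually_le hρ1 ((eventually_ge_atTop M).mono fun n hn => ?_)
  have hn' : (M : ℝ) ≤ n := by exact_mod_cast hn
  have b0 : max (max R (max 0 q)) (max (-d) (-(a + 1))) < x + n := by linarith
  simp only [max_lt_iff] at b0
  obtain ⟨⟨b1, b2, b3⟩, b4, b5⟩ := b0
  have hre : ((x : ℂ) + n).re = x + n := by simp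
  have p1 : 0 < (1 + ((x : ℂ) + n)).re := by
    simp only [Complex.add_re, Complex.one_re, Complex.ofReal_re, Complex.natCast_re]; linarith
  have p2 : 0 < ((1 : ℂ) - q + ((x : ℂ) + n)).re := by
    simp only [Complex.add_re, Complex.sub_re, Complex.one_re, Complex.ofReal_re,
      Complex.natCast_re]
    linarith
  rw [show (x : ℂ) + (n + 1 : ℕ) = x + n + 1 by push_cast; ring]
  refine norm_mul_cpow_add_one_le hw0 ?_ (residueCoeff_add_one (by rw [hre]; linarith)
    (by rw [hre]; linarith)) ?_
  · rw [norm_mul]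
    exact mul_pos (norm_pos_of_re_pos p1) (norm_pos_of_re_pos p2)
  · rw [norm_mul, norm_mul]
    exact hR _ (by rw [hre]; linarith)

/-- The line may start to the left of 0; the extra terms of negative index are zero. -/
theorem tsum_intCast_add_eq_tsum {u : ℤ → ℂ} (hu : ∀ m < 0, u m = 0) {m₀ : ℤ} (hm : m₀ ≤ 0)
    (hs : Summable fun i : ℕ => u (m₀ + i)) : ∑' i : ℕ, u (m₀ + i) = ∑' i : ℕ, u i := by
  obtain ⟨M, hM⟩ := Int.eq_ofNat_of_zero_le (neg_nonneg.2 hm)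
  rw [← hs.sum_add_tsum_nat_add M, Finset.sum_eq_zero, zero_add]
  · refine tsum_congr fun i => congrArg u ?_
    push_cast
    omega
  · intro i hi
    rw [Finset.mem_range] at hi
    exact hu _ (by omega)

/-- A line integral as the sum of the residues on its right. -/
theorem integral_fourGamma_line_eq_tsum {a d q w σ : ℝ} (hw0 : 0 < w) (hw1 : w < 1) (hd : -d < σ)
    (ha : -(a + 1) < σ) (hq : ∀ k : ℤ, q ≠ k) (h1 : ∀ m : ℤ, σ ≠ m) (h2 : ∀ m : ℤ, σ - q ≠ m) :
    1 / (2 * π) * ∫ y : ℝ, fourGamma a d q (σ + y * Complex.I) * (w : ℂ) ^ (σ + y * Complex.I) =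
      π / Complex.sin (π * q) *
        (∑' i : ℕ, residueCoeff a d q ((⌈σ⌉ : ℝ) + i : ℂ) * (w : ℂ) ^ ((⌈σ⌉ : ℝ) + i : ℂ) -
          ∑' i : ℕ, residueCoeff a d q ((q + ⌈σ - q⌉ : ℝ) + i : ℂ) *
            (w : ℂ) ^ ((q + ⌈σ - q⌉ : ℝ) + i : ℂ)) := by
  have hpi : (π : ℂ) ≠ 0 := by exact_mod_cast Real.pi_ne_zero
  set m₀ := ⌈σ⌉ with hm₀
  set j₀ := ⌈σ - q⌉ with hj₀
  have hm1 : σ < m₀ := lt_of_le_of_ne (Int.le_ceil _) (h1 _)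
  have hm2 : (m₀ : ℝ) < σ + 1 := Int.ceil_lt_add_one _
  have hj1 : σ - q < j₀ := lt_of_le_of_ne (Int.le_ceil _) (h2 _)
  have hj2 : (j₀ : ℝ) < σ - q + 1 := Int.ceil_lt_add_one _
  set L : ℕ → ℂ := fun n => ∫ y : ℝ, fourGamma a d q ((σ + n : ℝ) + y * Complex.I) *
      (w : ℂ) ^ (((σ + n : ℝ) : ℂ) + y * Complex.I) with hL
  set u : ℕ → ℂ := fun i => residueCoeff a d q ((m₀ : ℝ) + i : ℂ) * (w : ℂ) ^ ((m₀ : ℝ) + i : ℂ)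
    with hu
  set v : ℕ → ℂ := fun i => residueCoeff a d q ((q + j₀ : ℝ) + i : ℂ) *
    (w : ℂ) ^ ((q + j₀ : ℝ) + i : ℂ) with hv
  have hstep : ∀ n, L (n + 1) - L n = 2 * π * (π / Complex.sin (π * q) * (v n - u n)) := by
    intro n
    have hn : (0 : ℝ) ≤ n := n.cast_nonneg
    have h := integral_fourGamma_line_succ_sub (a := a) (d := d) (q := q) (w := w) (x := σ + n)
      (m := m₀ + n) (j := j₀ + n) hw0 hw1.le (by linarith) (by linarith) hq
      (by push_cast; linarith) (by push_cast; linarith) (by push_cast; linarith)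
      (by push_cast; linarith)
    have e : σ + n + 1 = σ + (n + 1 : ℕ) := by push_cast; ring
    rw [e] at h
    simp only [hL, h, hu, hv]
    push_cast
    simp only [add_assoc]
  -- Telescoping of the unit shifts; as n grows, the left side tends to 0 and the partial sums to
  -- the two series.
  have htel : ∀ n, L n = L 0 + 2 * π * (π / Complex.sin (π * q) *
      (∑ i ∈ Finset.range n, v i - ∑ i ∈ Finset.range n, u i)) := by
    intro n
    rw [← sub_eq_iff_eq_add', ← Finset.sum_range_sub, ← Finset.sum_sub_distrib, Finset.mul_sum,
      Finset.mul_sum]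
    exact Finset.sum_congr rfl fun i _ => hstep i
  have hsu : Summable u := summable_residueCoeff hw0 hw1
  have hsv : Summable v := summable_residueCoeff hw0 hw1
  have hlim : Tendsto L atTop (𝓝 (L 0 + 2 * π * (π / Complex.sin (π * q) *
      (∑' i, v i - ∑' i, u i)))) := by
    exact Tendsto.congr (fun n => (htel n).symm)
      ((((hsv.hasSum.tendsto_sum_nat.sub hsu.hasSum.tendsto_sum_nat).const_mul _).const_mul
        _).const_add _)
  have h0 := tendsto_nhds_unique hlim (tendsto_integral_fourGamma_line hw0 hw1 hd ha h1 h2)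
  have hL0 : L 0 = ∫ y : ℝ, fourGamma a d q (σ + y * Complex.I) *
      (w : ℂ) ^ (σ + y * Complex.I) := by
    simp [hL]
  rw [← hL0, eq_neg_of_add_eq_zero_left h0]
  field_simp
  ring

/-! ### The connection formula for the integral over z -/

theorem residueCoeff_negInt {a d q : ℝ} {m : ℤ} (hm : m < 0) : residueCoeff a d q m = 0 := by
  obtain ⟨k, hk⟩ := Int.eq_ofNat_of_zero_le (show 0 ≤ -m - 1 by omega)
  have : (1 : ℂ) + m = -k := by
    have : m = -k - 1 := by omega
    rw [this]; push_cast; ring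
  rw [residueCoeff, this, Complex.Gamma_neg_nat_eq_zero]
  simp

theorem residueCoeff_add_negInt {a d q : ℝ} {m : ℤ} (hm : m < 0) :
    residueCoeff a d q (q + m) = 0 := by
  obtain ⟨k, hk⟩ := Int.eq_ofNat_of_zero_le (show 0 ≤ -m - 1 by omega)
  have : (1 : ℂ) - q + (q + m) = -k := by
    have : m = -k - 1 := by omega
    rw [this]; push_cast; ring
  rw [residueCoeff, this, Complex.Gamma_neg_nat_eq_zero]
  simp

theorem Gamma_sub_natCast_eq {q : ℝ} (hq : ∀ k : ℤ, q ≠ k) (k : ℕ) :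
    Complex.Gamma (q - k) = (-1) ^ k * (π / Complex.sin (π * q)) * (Complex.Gamma (1 - q + k))⁻¹ := by
  have hs : Complex.sin (π * ((k : ℂ) - q)) ≠ 0 :=
    sin_pi_mul_ne_zero_of_re fun m hm => hq (k - m) (by
      simp only [Complex.sub_re, Complex.natCast_re, Complex.ofReal_re] at hm
      push_cast; linarith)
  have h := Gamma_neg_eq (one_add_ne_neg_natCast_of_sin_ne_zero hs)
  have hsk := sin_pi_mul_intCast_sub (k : ℤ) q
  have hck : Complex.cos (π * ((k : ℤ) : ℂ)) = (-1) ^ k := by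
    rw [Int.cast_natCast, mul_comm]
    exact_mod_cast congrArg Complex.ofReal (Real.cos_nat_mul_pi k)
  rw [hck, Int.cast_natCast] at hsk
  have hsq : Complex.sin (π * q) ≠ 0 := sin_pi_mul_ne_zero_of_re (by simpa using hq)
  have h1 : ((-1 : ℂ) ^ k) * (-1) ^ k = 1 := by rw [← mul_pow]; simp
  have h2 : ((-1 : ℂ) ^ k) ≠ 0 := pow_ne_zero _ (by norm_num)
  rw [neg_sub, hsk, show (1 : ℂ) + (k - q) = 1 - q + k by ring] at h
  rw [h]
  field_simp
  linear_combination -(Complex.Gamma (1 - q + k))⁻¹ * h1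

/-- The residues at k < N take the same form as those collected by moving the line, so that both fit
into a single series. -/
theorem Gamma_mul_Gamma_neg_residue {a d q : ℝ} (hq : ∀ k : ℤ, q ≠ k) (k : ℕ) :
    Complex.Gamma (d + k) * (-1) ^ k / (Nat.factorial k : ℂ) *
      (Complex.Gamma (a + 1 + k) * Complex.Gamma (q - k)) =
    π / Complex.sin (π * q) * residueCoeff a d q k := by
  have h1 : ((-1 : ℂ) ^ k) * (-1) ^ k = 1 := by rw [← mul_pow]; simp
  rw [Gamma_sub_natCast_eq hq, residueCoeff, add_comm (1 : ℂ) k, Complex.Gamma_nat_eq_factorial]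
  linear_combination (Complex.Gamma (d + k) / (Nat.factorial k : ℂ) * Complex.Gamma (a + 1 + k) *
    (π / Complex.sin (π * q)) * (Complex.Gamma (1 - q + k))⁻¹) * h1

/-- The connection formula for the Euler integral of a Gauss hypergeometric function. -/
theorem Gamma_mul_euler_integral_eq_tsum {a c d w t : ℝ} (ha : -1 < a) (hc : -1 < c)
    (hat : -(a + 1) < t) (ht : t < c - d + 1) (hd : ∀ k : ℕ, d ≠ -(k : ℝ))
    (hq : ∀ k : ℤ, c - d + 1 ≠ k) (hw0 : 0 < w) (hw1 : w < 1) :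
    Complex.Gamma d * Complex.Gamma (a + c - d + 2) *
      ((∫ z in Ioo (0 : ℝ) 1, z ^ a * (1 - z) ^ c / (1 - (1 - w) * z) ^ d : ℝ) : ℂ) =
    π / Complex.sin (π * (c - d + 1 : ℝ)) *
      (∑' k : ℕ, residueCoeff a d (c - d + 1) k * (w : ℂ) ^ (k : ℂ) -
        ∑' k : ℕ, residueCoeff a d (c - d + 1) ((c - d + 1 : ℝ) + k) *
          (w : ℂ) ^ (((c - d + 1 : ℝ) : ℂ) + k)) := by
  have hN1 : -d < ⌈-d⌉₊ := lt_of_le_of_ne (Nat.le_ceil _) fun h => hd _ (by linarith)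
  have hN2 : ⌈-d⌉₊ = 0 ∨ (⌈-d⌉₊ : ℝ) - 1 < -d := by
    rcases le_or_gt (-d) 0 with h | h
    · exact Or.inl (Nat.ceil_eq_zero.2 h)
    · exact Or.inr (by linarith [Nat.ceil_lt_add_one h.le])
  set N := ⌈-d⌉₊ with hN
  set q := c - d + 1 with hqdef
  have hN0 : (0 : ℝ) ≤ N := N.cast_nonneg
  -- σ has to avoid ℤ and q + ℤ so that no translate of the line by an integer meets a pole; the
  -- union is countable.
  have hdense : Dense (range (fun m : ℤ => (m : ℝ)) ∪ range (fun m : ℤ => q + m))ᶜ :=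
    ((countable_range _).union (countable_range _)).dense_compl ℝ
  obtain ⟨σ, hσm, hσ1, hσ2⟩ : ∃ σ ∈ (range (fun m : ℤ => (m : ℝ)) ∪ range (fun m : ℤ => q + m))ᶜ,
      max (-d) (-(a + 1)) < σ ∧ σ < min (N : ℝ) q := by
    refine hdense.exists_between ?_
    simp only [max_lt_iff, lt_min_iff]
    refine ⟨⟨?_, ?_⟩, ?_, ?_⟩ <;> linarith
  simp only [mem_compl_iff, mem_union, mem_range, not_or, not_exists] at hσm
  simp only [max_lt_iff, lt_min_iff] at hσ1 hσ2
  have h1 : ∀ m : ℤ, σ ≠ m := fun m h => hσm.1 m h.symm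
  have h2 : ∀ m : ℤ, σ - q ≠ m := fun m h => hσm.2 m (by linarith)
  have hK := Gamma_mul_euler_integral hσ1.1 hσ2.1 hN2 ha hσ1.2 hσ2.2 hw0
  have hL := integral_fourGamma_line_eq_tsum hw0 hw1 hσ1.1 hσ1.2 hq h1 h2
  have hqc : (c : ℂ) - d + 1 = (q : ℝ) := by simp only [hqdef]; push_cast; ring
  rw [hqc] at hK
  rw [hK]
  have hline : (1 / (2 * π) * ∫ y : ℝ, Complex.Gamma (d + (σ + y * Complex.I)) *
        Complex.Gamma (-(σ + y * Complex.I)) * (Complex.Gamma (a + 1 + (σ + y * Complex.I)) *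
          Complex.Gamma (q - (σ + y * Complex.I))) * (w : ℂ) ^ (σ + y * Complex.I)) = _ := hL
  rw [hline]
  have hsum : ∑ k ∈ Finset.range N, Complex.Gamma (d + k) * (-1) ^ k / (Nat.factorial k : ℂ) *
        (Complex.Gamma (a + 1 + k) * Complex.Gamma (q - k)) * (w : ℂ) ^ (k : ℂ) =
      π / Complex.sin (π * q) *
        ∑ k ∈ Finset.range N, residueCoeff a d q k * (w : ℂ) ^ (k : ℂ) := by
    rw [Finset.mul_sum]
    refine Finset.sum_congr rfl fun k _ => ?_
    rw [Gamma_mul_Gamma_neg_residue hq]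
    ring
  have hsumm : ∀ x : ℝ, Summable fun n : ℕ => residueCoeff a d q ((x : ℂ) + n) *
      (w : ℂ) ^ ((x : ℂ) + n) := fun x => summable_residueCoeff hw0 hw1
  have hsB : ∑' i : ℕ, residueCoeff a d q ((q + ⌈σ - q⌉ : ℝ) + i : ℂ) *
      (w : ℂ) ^ ((q + ⌈σ - q⌉ : ℝ) + i : ℂ) =
      ∑' k : ℕ, residueCoeff a d q ((q : ℝ) + k) * (w : ℂ) ^ ((q : ℂ) + k) := by
    have h := tsum_intCast_add_eq_tsum (u := fun m : ℤ => residueCoeff a d q (q + m) *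
      (w : ℂ) ^ ((q : ℂ) + m)) (m₀ := ⌈σ - q⌉) (fun m hm => by
        rw [residueCoeff_add_negInt hm, zero_mul]) (Int.ceil_le.2 (by push_cast; linarith)) (by
        have := hsumm (q + ⌈σ - q⌉)
        push_cast at this ⊢
        simpa only [add_assoc] using this)
    push_cast at h ⊢
    simpa only [add_assoc] using h
  have hsA : ∑ k ∈ Finset.range N, residueCoeff a d q k * (w : ℂ) ^ (k : ℂ) +
      ∑' i : ℕ, residueCoeff a d q ((⌈σ⌉ : ℝ) + i : ℂ) * (w : ℂ) ^ ((⌈σ⌉ : ℝ) + i : ℂ) =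
      ∑' k : ℕ, residueCoeff a d q k * (w : ℂ) ^ (k : ℂ) := by
    -- If N = 0, then ⌈σ⌉ ≤ 0 and the surplus terms vanish. Otherwise N − 1 < σ < N, so ⌈σ⌉ = N and
    -- the series continues where the finite sum stops.
    rcases hN2 with h0 | h0
    · have h := tsum_intCast_add_eq_tsum (u := fun m : ℤ => residueCoeff a d q m *
        (w : ℂ) ^ (m : ℂ)) (m₀ := ⌈σ⌉) (fun m hm => by
          rw [residueCoeff_negInt hm, zero_mul]) (Int.ceil_le.2 (by
            have := hσ2.1
            rw [h0] at this
            push_cast at this ⊢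
            exact this.le)) (by
          have := hsumm ⌈σ⌉
          push_cast at this ⊢
          exact this)
      rw [h0]
      push_cast at h ⊢
      simpa using h
    · have hc : ⌈σ⌉ = (N : ℤ) := by
        rw [Int.ceil_eq_iff]
        push_cast
        exact ⟨by linarith, hσ2.1.le⟩
      have hs := hsumm 0
      simp only [Complex.ofReal_zero, zero_add] at hs
      rw [← hs.sum_add_tsum_nat_add N, hc]
      push_cast
      simp only [add_comm]
  rw [hsum, hsB, ← hsA]
  ring

/-- At d = −n the factor Γ(d) has a pole, so the previous formula is not available. But (1 + X)^n is
a polynomial, and the binomial theorem with Beta integrals gives a finite sum. -/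
theorem Gamma_mul_euler_integral_of_neg_natCast {a c w : ℝ} (n : ℕ) (ha : -1 < a) (hc : -1 < c)
    (hw : 0 < w) : Complex.Gamma (a + c + n + 2) *
      ((∫ z in Ioo (0 : ℝ) 1, z ^ a * (1 - z) ^ c / (1 - (1 - w) * z) ^ (-(n : ℝ)) : ℝ) : ℂ) =
    ∑ k ∈ Finset.range (n + 1), (n.choose k : ℂ) *
      (Complex.Gamma (a + 1 + k) * Complex.Gamma (c + n + 1 - k)) * (w : ℂ) ^ (k : ℂ) := by
  have hn : (0 : ℝ) ≤ n := n.cast_nonneg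
  have hG : Complex.Gamma (a + c + n + 2) ≠ 0 :=
    Complex.Gamma_ne_zero_of_re_pos (by simp; linarith)
  have hB : ∀ k ∈ Finset.range (n + 1), _ := fun (k : ℕ) (hk : k ∈ Finset.range (n + 1)) =>
    integral_weight_mul_cpow_div (a := a) (r := c + n) (w := w) (s := k) hw
      (by simp; linarith [k.cast_nonneg (α := ℝ)]) (by
        have : (k : ℝ) ≤ n := by exact_mod_cast Nat.lt_succ_iff.1 (Finset.mem_range.1 hk)
        simp only [Complex.natCast_re]
        linarith)
  have hpt : EqOn (fun z : ℝ =>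
      ((z ^ a * (1 - z) ^ c / (1 - (1 - w) * z) ^ (-(n : ℝ)) : ℝ) : ℂ))
      (fun z : ℝ => ∑ k ∈ Finset.range (n + 1), (n.choose k : ℂ) *
        (((z ^ a * (1 - z) ^ (c + n) : ℝ) : ℂ) * ((w * z / (1 - z) : ℝ) : ℂ) ^ (k : ℂ)))
      (Ioo 0 1) := by
    intro z hz
    simp only
    rw [rpow_mul_one_sub_rpow_div_eq hw hz, neg_neg, sub_neg_eq_add, Real.rpow_natCast,
      add_comm 1, add_pow, Complex.ofReal_mul, Complex.ofReal_sum, Finset.mul_sum]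
    refine Finset.sum_congr rfl fun k _ => ?_
    rw [Complex.cpow_natCast]
    push_cast
    ring
  rw [← integral_complex_ofReal, setIntegral_congr_fun measurableSet_Ioo hpt, integral_finsetSum]
  · rw [Finset.mul_sum]
    refine Finset.sum_congr rfl fun k hk => ?_
    rw [integral_const_mul, (hB k hk).2]
    push_cast
    rw [← add_assoc (a : ℂ) c n]
    field_simp
  · exact fun k hk => (hB k hk).1.const_mul _

/-! ### Termwise integration over x and y -/

/-- For a real exponent the integrand is nonnegative, so absolute integrals are known exactly; this
makes summability of the integrated terms enough for the interchange. -/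
theorem integral_norm_square_weight_mul_cpow {a b c e x : ℝ} (ha : -1 < a) (hc : -1 < c)
    (hb : 0 < b + 1 + x) (he : 0 < e + 1 + x) :
    ∫ w in Ioo (0 : ℝ) 1 ×ˢ Ioo (0 : ℝ) 1,
      ‖((w.1 ^ b * (1 - w.1) ^ c * (w.2 ^ e * (1 - w.2) ^ a) : ℝ) : ℂ) *
        ((w.1 * w.2 : ℝ) : ℂ) ^ (x : ℂ)‖ = ‖betaProd a b c e x‖ := by
  rw [← (integral_square_weight_mul_cpow (s := x) ha hc (by simpa using hb) (by simpa using he)).2]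
  have hms : MeasurableSet (Ioo (0 : ℝ) 1 ×ˢ Ioo (0 : ℝ) 1) := measurableSet_Ioo.prod measurableSet_Ioo
  have hpt : EqOn (fun w : ℝ × ℝ => ((w.1 ^ b * (1 - w.1) ^ c * (w.2 ^ e * (1 - w.2) ^ a) : ℝ) : ℂ) *
        ((w.1 * w.2 : ℝ) : ℂ) ^ (x : ℂ)) (fun w : ℝ × ℝ =>
        ((‖((w.1 ^ b * (1 - w.1) ^ c * (w.2 ^ e * (1 - w.2) ^ a) : ℝ) : ℂ) *
        ((w.1 * w.2 : ℝ) : ℂ) ^ (x : ℂ)‖ : ℝ) : ℂ)) (Ioo (0 : ℝ) 1 ×ˢ Ioo (0 : ℝ) 1) := by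
    rintro ⟨u, v⟩ ⟨⟨hu0, hu1⟩, hv0, hv1⟩
    simp only at hu0 hu1 hv0 hv1
    have hu1' : 0 < 1 - u := by linarith
    have hv1' : 0 < 1 - v := by linarith
    simp only
    rw [← Complex.ofReal_cpow (by positivity), ← Complex.ofReal_mul, Complex.norm_real,
      Real.norm_eq_abs, abs_of_nonneg (by positivity)]
  conv_rhs => rw [setIntegral_congr_fun hms hpt, integral_complex_ofReal, Complex.norm_real,
    Real.norm_eq_abs, abs_of_nonneg (integral_nonneg fun _ => norm_nonneg _)]

/-- Termwise integration over `x` and `y` of a series expansion of the integral over `z`. -/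
theorem Gamma_mul_J3_eq_tsum {a b c d e q : ℝ} {A B : ℕ → ℂ} (ha : -1 < a) (hb : -1 < b)
    (hc : -1 < c) (he : -1 < e) (hqb : 0 < b + 1 + q) (hqe : 0 < e + 1 + q)
    (hint : IntegrableOn (beukersIntegrand a b c d e 0) unitCube) (G : ℂ)
    (hK : ∀ w : ℝ, 0 < w → w < 1 → HasSum (fun k : ℕ => A k * (w : ℂ) ^ (k : ℂ) -
      B k * (w : ℂ) ^ ((q : ℂ) + k)) (G *
      ((∫ z in Ioo (0 : ℝ) 1, z ^ a * (1 - z) ^ c / (1 - (1 - w) * z) ^ d : ℝ) : ℂ)))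
    (hA : Summable fun k : ℕ => A k * betaProd a b c e k)
    (hB : Summable fun k : ℕ => B k * betaProd a b c e (q + k)) :
    G * (J3 a b c d e 0 : ℂ) =
      ∑' k : ℕ, A k * betaProd a b c e k - ∑' k : ℕ, B k * betaProd a b c e (q + k) := by
  set S : Set (ℝ × ℝ) := Ioo (0 : ℝ) 1 ×ˢ Ioo (0 : ℝ) 1 with hS
  have hSm : MeasurableSet S := measurableSet_Ioo.prod measurableSet_Ioo
  set W : ℝ × ℝ → ℂ := fun w =>
    ((w.1 ^ b * (1 - w.1) ^ c * (w.2 ^ e * (1 - w.2) ^ a) : ℝ) : ℂ) with hW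
  have hk0 : ∀ k : ℕ, (0 : ℝ) ≤ k := fun k => k.cast_nonneg
  have i1 : ∀ k : ℕ, _ := fun k : ℕ => integral_square_weight_mul_cpow (a := a) (b := b) (c := c)
    (e := e) (s := k) ha hc (by simp; linarith [hk0 k]) (by simp; linarith [hk0 k])
  have i2 : ∀ k : ℕ, _ := fun k : ℕ => integral_square_weight_mul_cpow (a := a) (b := b) (c := c)
    (e := e) (s := (q : ℂ) + k) ha hc (by simp; linarith [hk0 k]) (by simp; linarith [hk0 k])
  have n1 : ∀ k : ℕ, ∫ w in S, ‖W w * ((w.1 * w.2 : ℝ) : ℂ) ^ (k : ℂ)‖ = ‖betaProd a b c e k‖ := by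
    intro k
    have := integral_norm_square_weight_mul_cpow (a := a) (b := b) (c := c) (e := e) (x := k) ha hc
      (by linarith [hk0 k]) (by linarith [hk0 k])
    simpa only [Complex.ofReal_natCast] using this
  have n2 : ∀ k : ℕ, ∫ w in S, ‖W w * ((w.1 * w.2 : ℝ) : ℂ) ^ ((q : ℂ) + k)‖ =
      ‖betaProd a b c e (q + k)‖ := by
    intro k
    have := integral_norm_square_weight_mul_cpow (a := a) (b := b) (c := c) (e := e) (x := q + k)
      ha hc (by linarith [hk0 k]) (by linarith [hk0 k])
    simpa only [Complex.ofReal_add, Complex.ofReal_natCast] using this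
  set F : ℕ → ℝ × ℝ → ℂ := fun k w => A k * (W w * ((w.1 * w.2 : ℝ) : ℂ) ^ (k : ℂ)) -
    B k * (W w * ((w.1 * w.2 : ℝ) : ℂ) ^ ((q : ℂ) + k)) with hF
  have hFi : ∀ k, Integrable (F k) (volume.restrict S) := fun k =>
    ((i1 k).1.const_mul (A k)).sub ((i2 k).1.const_mul (B k))
  -- The L¹ norm of each term is at most the sum of the moduli of its two integrated parts, which
  -- are summable by hypothesis.
  have hFs : Summable fun k => ∫ w in S, ‖F k w‖ := by
    refine Summable.of_nonneg_of_le (fun k => integral_nonneg fun _ => norm_nonneg _) (fun k => ?_)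
      (hA.norm.add hB.norm)
    rw [norm_mul, norm_mul, ← n1, ← n2, ← integral_const_mul, ← integral_const_mul,
      ← integral_add ((i1 k).1.norm.const_mul _) ((i2 k).1.norm.const_mul _)]
    refine integral_mono (hFi k).norm
      (((i1 k).1.norm.const_mul _).add ((i2 k).1.norm.const_mul _)) fun w => ?_
    refine (norm_sub_le _ _).trans_eq ?_
    rw [norm_mul, norm_mul (B k)]
  have hsum := hasSum_integral_of_summable_integral_norm hFi hFs
  have hFint : ∀ k, ∫ w in S, F k w = A k * betaProd a b c e k - B k * betaProd a b c e (q + k) := by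
    intro k
    simp only [hF]
    rw [integral_sub ((i1 k).1.const_mul (A k)) ((i2 k).1.const_mul (B k)), integral_const_mul,
      integral_const_mul, (i1 k).2, (i2 k).2]
  simp only [hFint] at hsum
  rw [← hA.tsum_sub hB, hsum.tsum_eq, J3_eq_integral hint, ← integral_complex_ofReal,
    ← integral_const_mul]
  refine setIntegral_congr_fun hSm fun w hw => ?_
  have hw0 : 0 < w.1 * w.2 := mul_pos hw.1.1 hw.2.1
  have hw1 : w.1 * w.2 < 1 := by nlinarith [hw.1.1, hw.1.2, hw.2.1, hw.2.2]
  have h := (hK _ hw0 hw1).mul_left (W w)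
  simp only [hF]
  rw [Complex.ofReal_mul, mul_left_comm]
  rw [← h.tsum_eq]
  exact tsum_congr fun k => by ring

/-! ### Convergence at 1 and the two ₄F₃ series -/

theorem ascPochhammer_eval_eq_prod_range (x : ℝ) (n : ℕ) :
    (ascPochhammer ℝ n).eval x = ∏ j ∈ Finset.range n, (x + j) := by
  induction n with
  | zero => simp
  | succ n ih => rw [ascPochhammer_succ_eval, ih, Finset.prod_range_succ]

theorem ascPochhammer_eval_eq_inv_GammaSeq (x : ℝ) {n : ℕ} (hn : n ≠ 0) :
    (ascPochhammer ℝ (n + 1)).eval x = (GammaSeq x n)⁻¹ * ((n : ℝ) ^ x * (n.factorial : ℝ)) := by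
  have h1 : ((n : ℝ) ^ x) ≠ 0 := (Real.rpow_pos_of_pos (by positivity) x).ne'
  have h2 : (n.factorial : ℝ) ≠ 0 := by positivity
  rw [GammaSeq, inv_div, ← ascPochhammer_eval_eq_prod_range]
  field_simp

theorem tendsto_inv_GammaSeq (x : ℝ) :
    Tendsto (fun n => (GammaSeq x n)⁻¹) atTop (𝓝 (Gamma x)⁻¹) := by
  by_cases hx : ∃ m : ℕ, x = -m
  · obtain ⟨m, rfl⟩ := hx
    rw [Real.Gamma_neg_nat_eq_zero, inv_zero]
    refine tendsto_const_nhds.congr' ?_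
    filter_upwards [eventually_ge_atTop m] with n hn
    -- For n ≥ m the denominator contains −m + m = 0; with division by zero equal to 0, the sequence
    -- and its inverse vanish, in agreement with 1/Γ(−m) = 0.
    rw [GammaSeq, Finset.prod_eq_zero (i := m) (by simp; omega) (by simp)]
    simp
  · push Not at hx
    exact (Real.GammaSeq_tendsto_Gamma x).inv₀ (Real.Gamma_ne_zero hx)

/-- Euler's limit for Γ gives (x)_(n+1) ≈ n^x n!/Γ(x). The single numerator parameter in excess
cancels n! against (n + 1)!, so the terms are O(n^(r−1)), where r < 0 is the sum of the α minus the
sum of the β. -/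
theorem summable_pFqTerm_one {p : ℕ} {α : Fin (p + 1) → ℝ} {β : Fin p → ℝ}
    (h : ∑ i, α i < ∑ j, β j) : Summable (pFqTerm α β 1) := by
  rw [← summable_nat_add_iff 1]
  set r := ∑ i, α i - ∑ j, β j with hr
  set u : ℕ → ℝ := fun n => (∏ i, (GammaSeq (α i) n)⁻¹) * ∏ j, GammaSeq (β j) n with hu
  have hT : Tendsto u atTop (𝓝 ((∏ i, (Gamma (α i))⁻¹) * ∏ j, Gamma (β j))) :=
    (tendsto_finsetProd _ fun i _ => tendsto_inv_GammaSeq _).mul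
      (tendsto_finsetProd _ fun j _ => Real.GammaSeq_tendsto_Gamma _)
  have key : ∀ n : ℕ, n ≠ 0 →
      pFqTerm α β 1 (n + 1) = u n * ((n : ℝ) ^ r * (1 / ((n : ℝ) + 1))) := by
    intro n hn
    have hn0 : (0 : ℝ) < n := by positivity
    have hf : (n.factorial : ℝ) ≠ 0 := by positivity
    have e1 : ∏ i, (n : ℝ) ^ α i = (n : ℝ) ^ ∑ i, α i :=
      (Real.rpow_sum_of_pos hn0 _ _).symm
    have e2 : ∏ j, (n : ℝ) ^ β j = (n : ℝ) ^ ∑ j, β j :=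
      (Real.rpow_sum_of_pos hn0 _ _).symm
    have e3 : ((n : ℝ) ^ ∑ j, β j) ≠ 0 := (Real.rpow_pos_of_pos hn0 _).ne'
    simp only [pFqTerm, ascPochhammer_eval_eq_inv_GammaSeq _ hn, Finset.prod_mul_distrib, e1, e2,
      Finset.prod_inv_distrib, Finset.prod_const, Finset.card_univ, Fintype.card_fin, hu,
      Nat.factorial_succ, one_pow, Nat.cast_mul, Nat.cast_succ, hr, Real.rpow_sub hn0]
    rw [pow_succ]
    simp only [mul_inv, inv_inv, div_eq_mul_inv]
    field_simp
  refine summable_of_isBigO_nat (g := fun n : ℕ => (n : ℝ) ^ (r - 1))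
    (Real.summable_nat_rpow.2 (by linarith)) ?_
  have h1 : (fun n => pFqTerm α β 1 (n + 1)) =ᶠ[atTop]
      fun n : ℕ => u n * ((n : ℝ) ^ r * (1 / ((n : ℝ) + 1))) :=
    (eventually_ne_atTop 0).mono key
  refine h1.trans_isBigO ?_
  have h2 : (fun n : ℕ => (n : ℝ) ^ r * (1 / ((n : ℝ) + 1))) =O[atTop]
      fun n : ℕ => (n : ℝ) ^ (r - 1) := by
    refine Asymptotics.IsBigO.of_bound 1 ((eventually_gt_atTop 0).mono fun n hn => ?_)
    have hn0 : (0 : ℝ) < n := by exact_mod_cast hn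
    rw [one_mul, Real.norm_of_nonneg (by positivity), Real.norm_of_nonneg (by positivity),
      Real.rpow_sub_one hn0.ne', div_eq_mul_one_div ((n : ℝ) ^ r)]
    gcongr
    linarith
  simpa using (hT.isBigO_one ℝ).mul h2

theorem Gamma_add_natCast_eq {x : ℝ} (hx : ∀ m : ℕ, x ≠ -m) (k : ℕ) :
    Gamma (x + k) = Gamma x * (ascPochhammer ℝ k).eval x := by
  induction k with
  | zero => simp
  | succ k ih =>
    rw [Nat.cast_succ, ← add_assoc, Real.Gamma_add_one fun h => hx k (by linarith), ih,
      ascPochhammer_succ_eval]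
    ring

theorem betaProd_ofReal (a b c e x : ℝ) : betaProd a b c e x =
    ((Gamma (b + 1 + x) * Gamma (c + 1) / Gamma (b + c + 2 + x) *
      (Gamma (e + 1 + x) * Gamma (a + 1) / Gamma (e + a + 2 + x)) : ℝ) : ℂ) := by
  simp only [betaProd, Complex.ofReal_mul, Complex.ofReal_div, ← Complex.Gamma_ofReal]
  push_cast
  rfl

theorem residueCoeff_ofReal (a d q x : ℝ) : residueCoeff a d q x =
    ((Gamma (d + x) * Gamma (a + 1 + x) * (Gamma (1 + x))⁻¹ * (Gamma (1 - q + x))⁻¹ : ℝ) : ℂ) := by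
  simp only [residueCoeff, Complex.ofReal_mul, Complex.ofReal_inv, ← Complex.Gamma_ofReal]
  push_cast
  rfl

/-- The coefficient of `w ^ k` in the expansion of the Euler integral, up to `π / sin (π q)`. -/
noncomputable def integerCoeff (a d q : ℝ) (k : ℕ) : ℝ :=
  (ascPochhammer ℝ k).eval d * Gamma (a + 1 + k) / (k.factorial * Gamma (1 - q + k))

/-- The coefficient of `w ^ (q + k)` in the expansion of the Euler integral, up to
`π / sin (π q)`. -/
noncomputable def shiftedCoeff (a d q : ℝ) (k : ℕ) : ℝ :=
  Gamma (d + (q + k)) * Gamma (a + 1 + (q + k)) / (Gamma d * Gamma (1 + (q + k)) * k.factorial)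

theorem ascPochhammer_eval_neg_natCast (n k : ℕ) :
    (ascPochhammer ℝ k).eval (-(n : ℝ)) = (-1) ^ k * (k.factorial * n.choose k) := by
  rw [ascPochhammer_eval_neg_eq_descPochhammer, descPochhammer_eval_eq_descFactorial,
    Nat.descFactorial_eq_factorial_mul_choose]
  push_cast
  ring

/-- Dividing the connection formula by Γ(d) replaces Γ(d + k)/Γ(d) by a Pochhammer symbol, which
makes sense for every d and agrees with the binomial expansion when d = −n. -/
theorem hasSum_euler_integral {a c d w t : ℝ} (ha : -1 < a) (hc : -1 < c)
    (hat : -(a + 1) < t) (ht : t < c - d + 1)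
    (hq : ∀ k : ℤ, c - d + 1 ≠ k) (hw0 : 0 < w) (hw1 : w < 1) :
    HasSum (fun k : ℕ =>
      ((π / sin (π * (c - d + 1)) * integerCoeff a d (c - d + 1) k : ℝ) : ℂ) * (w : ℂ) ^ (k : ℂ) -
      ((π / sin (π * (c - d + 1)) * shiftedCoeff a d (c - d + 1) k : ℝ) : ℂ) *
        (w : ℂ) ^ (((c - d + 1 : ℝ) : ℂ) + k))
      (Complex.Gamma (a + c - d + 2) *
        ((∫ z in Ioo (0 : ℝ) 1, z ^ a * (1 - z) ^ c / (1 - (1 - w) * z) ^ d : ℝ) : ℂ)) := by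
  by_cases hd : ∃ n : ℕ, d = -(n : ℝ)
  · obtain ⟨n, rfl⟩ := hd
    -- Here `Gamma (-n) = 0` and division by zero gives 0, which is the correct reading of 1/Γ(d):
    -- the second series is absent.
    have hB : ∀ k, shiftedCoeff a (-(n : ℝ)) (c - -(n : ℝ) + 1) k = 0 := fun k => by
      simp [shiftedCoeff, Real.Gamma_neg_nat_eq_zero]
    have hs : ((a : ℂ) + c - ((-(n : ℝ) : ℝ) : ℂ) + 2) = a + c + n + 2 := by push_cast; ring
    rw [hs, Gamma_mul_euler_integral_of_neg_natCast n ha hc hw0]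
    have hA : ∀ k : ℕ, ((π / sin (π * (c - -(n : ℝ) + 1)) *
        integerCoeff a (-(n : ℝ)) (c - -(n : ℝ) + 1) k : ℝ) : ℂ) =
        (n.choose k : ℂ) * (Complex.Gamma (a + 1 + k) * Complex.Gamma (c + n + 1 - k)) := by
      intro k
      have h1 := Gamma_sub_natCast_eq hq k
      have h2 : ((-1 : ℂ) ^ k) * (-1) ^ k = 1 := by rw [← mul_pow]; simp
      have h3 : (k.factorial : ℂ) ≠ 0 := by exact_mod_cast k.factorial_ne_zero
      rw [show (((c - -(n : ℝ) + 1 : ℝ) : ℂ) - k) = c + n + 1 - k by push_cast; ring] at h1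
      rw [h1, integerCoeff, ascPochhammer_eval_neg_natCast]
      push_cast [← Complex.Gamma_ofReal]
      field_simp
    simp only [hA, hB, mul_zero, Complex.ofReal_zero, zero_mul, sub_zero]
    refine hasSum_sum_of_ne_finset_zero fun k hk => ?_
    rw [Nat.choose_eq_zero_of_lt (by simpa using hk)]
    simp
  · push Not at hd
    have hG : Complex.Gamma d ≠ 0 := Complex.Gamma_ne_zero fun m hm => hd m (by exact_mod_cast hm)
    have hGr : Gamma d ≠ 0 := Real.Gamma_ne_zero hd
    have key := Gamma_mul_euler_integral_eq_tsum ha hc hat ht hd hq hw0 hw1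
    have s1 : Summable fun k : ℕ => residueCoeff a d (c - d + 1) k * (w : ℂ) ^ (k : ℂ) := by
      simpa using summable_residueCoeff (a := a) (d := d) (q := c - d + 1) (x := 0) hw0 hw1
    have s2 := summable_residueCoeff (a := a) (d := d) (q := c - d + 1) (x := c - d + 1) hw0 hw1
    have h := (s1.hasSum.sub s2.hasSum).mul_left
      ((Complex.Gamma d)⁻¹ * (π / Complex.sin (π * (c - d + 1 : ℝ))))
    rw [mul_assoc, ← key, ← mul_assoc, ← mul_assoc, inv_mul_cancel₀ hG, one_mul] at h
    refine h.congr_fun fun k => ?_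
    have e1 := residueCoeff_ofReal a d (c - d + 1) k
    have e2 := residueCoeff_ofReal a d (c - d + 1) (c - d + 1 + k)
    have f1 : Gamma (1 + (k : ℝ)) = k.factorial := by
      rw [add_comm, Real.Gamma_nat_eq_factorial]
    rw [f1, Gamma_add_natCast_eq hd, Complex.ofReal_natCast] at e1
    rw [show 1 - (c - d + 1) + (c - d + 1 + (k : ℝ)) = 1 + k by ring, f1, Complex.ofReal_add,
      Complex.ofReal_natCast] at e2
    simp only [e1, e2, integerCoeff, shiftedCoeff, Complex.Gamma_ofReal]
    have hGc : ((Gamma d : ℝ) : ℂ) ≠ 0 := by exact_mod_cast hGr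
    push_cast
    field_simp

/-- Γ(x + k) = Γ(x)(x)_k in every factor. The arguments are positive except d − c, which avoids the
poles because c − d is not an integer. -/
theorem integerCoeff_mul_betaProd {a b c d e : ℝ} (ha : -1 < a) (hb : -1 < b) (hc : -1 < c)
    (he : -1 < e) (hq : ∀ k : ℤ, c - d ≠ k) (s : ℝ) (k : ℕ) :
    ((s * integerCoeff a d (c - d + 1) k : ℝ) : ℂ) * betaProd a b c e k =
      ((s * (Gamma (a + 1) ^ 2 * Gamma (b + 1) * Gamma (c + 1) * Gamma (e + 1) /
        (Gamma (d - c) * Gamma (a + e + 2) * Gamma (b + c + 2))) *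
        pFqTerm ![a + 1, b + 1, d, e + 1] ![d - c, a + e + 2, b + c + 2] 1 k : ℝ) : ℂ) := by
  have pos : ∀ x : ℝ, 0 < x → ∀ m : ℕ, x ≠ -m := fun x hx m h => by
    linarith [m.cast_nonneg (α := ℝ)]
  have h := betaProd_ofReal a b c e k
  rw [Complex.ofReal_natCast] at h
  rw [h, ← Complex.ofReal_mul, integerCoeff, Gamma_add_natCast_eq (pos (a + 1) (by linarith)),
    Gamma_add_natCast_eq (pos (b + 1) (by linarith)),
    Gamma_add_natCast_eq (pos (e + 1) (by linarith)),
    Gamma_add_natCast_eq (pos (b + c + 2) (by linarith)),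
    Gamma_add_natCast_eq (pos (e + a + 2) (by linarith)),
    show 1 - (c - d + 1) = d - c by ring,
    Gamma_add_natCast_eq (x := d - c) fun m hm => hq m (by push_cast; linarith), add_comm e a]
  simp only [pFqTerm, Fin.prod_univ_succ, Fin.prod_univ_zero, one_pow, Matrix.cons_val_zero,
    Matrix.cons_val_succ, div_eq_mul_inv, mul_inv]
  congr 1
  ring

/-- As in the previous lemma, with the exponent shifted by q = c − d + 1. The factor Γ(a + c − d +
2) is kept apart since it cancels the prefactor of J₃. -/
theorem shiftedCoeff_mul_betaProd {a b c d e : ℝ} (hc : -1 < c) (he : -1 < e) (hq : ∀ k : ℤ, c - d ≠ k)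
    (hqa : 0 < a + c - d + 2) (hqb : 0 < b + c - d + 2) (hqe : 0 < e + c - d + 2) (s : ℝ) (k : ℕ) :
    ((s * shiftedCoeff a d (c - d + 1) k : ℝ) : ℂ) * betaProd a b c e ((c - d + 1 : ℝ) + k) =
      ((s * (Gamma (a + c - d + 2) * (Gamma (a + 1) * Gamma (c + 1) ^ 2 * Gamma (b + c - d + 2) *
        Gamma (e + c - d + 2) / (Gamma d * Gamma (c - d + 2) * Gamma (a + e + c - d + 3) *
          Gamma (b + 2 * c - d + 3)))) *
        pFqTerm ![a + c - d + 2, b + c - d + 2, c + 1, e + c - d + 2]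
          ![c - d + 2, a + e + c - d + 3, b + 2 * c - d + 3] 1 k : ℝ) : ℂ) := by
  have pos : ∀ x : ℝ, 0 < x → ∀ m : ℕ, x ≠ -m := fun x hx m h => by
    linarith [m.cast_nonneg (α := ℝ)]
  have h := betaProd_ofReal a b c e (c - d + 1 + k)
  rw [Complex.ofReal_add, Complex.ofReal_natCast] at h
  rw [h, ← Complex.ofReal_mul, shiftedCoeff,
    show d + (c - d + 1 + (k : ℝ)) = c + 1 + k by ring,
    show a + 1 + (c - d + 1 + (k : ℝ)) = a + c - d + 2 + k by ring,
    show 1 + (c - d + 1 + (k : ℝ)) = c - d + 2 + k by ring,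
    show b + 1 + (c - d + 1 + (k : ℝ)) = b + c - d + 2 + k by ring,
    show b + c + 2 + (c - d + 1 + (k : ℝ)) = b + 2 * c - d + 3 + k by ring,
    show e + 1 + (c - d + 1 + (k : ℝ)) = e + c - d + 2 + k by ring,
    show e + a + 2 + (c - d + 1 + (k : ℝ)) = a + e + c - d + 3 + k by ring,
    Gamma_add_natCast_eq (pos (c + 1) (by linarith)), Gamma_add_natCast_eq (pos _ hqa),
    Gamma_add_natCast_eq (x := c - d + 2) fun m hm => hq (-m - 2) (by push_cast; linarith), Gamma_add_natCast_eq (pos _ hqb),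
    Gamma_add_natCast_eq (pos _ hqe),
    Gamma_add_natCast_eq (pos (b + 2 * c - d + 3) (by linarith)),
    Gamma_add_natCast_eq (pos (a + e + c - d + 3) (by linarith))]
  simp only [pFqTerm, Fin.prod_univ_succ, Fin.prod_univ_zero, one_pow, Matrix.cons_val_zero,
    Matrix.cons_val_succ, div_eq_mul_inv, mul_inv]
  congr 1
  ring

/-- The two hypergeometric series at `1` for the triple integral. -/
theorem J3_eq_pFq {a b c d e t : ℝ} (ha : -1 < a) (hb : -1 < b) (hc : -1 < c) (he : -1 < e)
    (hat : -(a + 1) < t) (hbt : -(b + 1) < t) (het : -(e + 1) < t)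
    (ht : t < c - d + 1) (hq : ∀ k : ℤ, c - d ≠ k) :
    Summable (pFqTerm ![a + 1, b + 1, d, e + 1] ![d - c, a + e + 2, b + c + 2] 1) ∧
      Summable (pFqTerm ![a + c - d + 2, b + c - d + 2, c + 1, e + c - d + 2]
        ![c - d + 2, a + e + c - d + 3, b + 2 * c - d + 3] 1) ∧
      J3 a b c d e 0 =
        π / sin (π * (d - c)) *
          (Gamma (a + 1) ^ 2 * Gamma (b + 1) * Gamma (c + 1) * Gamma (e + 1)
              / (Gamma (d - c) * Gamma (a + e + 2) * Gamma (b + c + 2) * Gamma (a + c - d + 2))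
              * pFq ![a + 1, b + 1, d, e + 1] ![d - c, a + e + 2, b + c + 2] 1
            - Gamma (a + 1) * Gamma (c + 1) ^ 2 * Gamma (b + c - d + 2) * Gamma (e + c - d + 2)
              / (Gamma d * Gamma (c - d + 2) * Gamma (a + e + c - d + 3)
                  * Gamma (b + 2 * c - d + 3))
              * pFq ![a + c - d + 2, b + c - d + 2, c + 1, e + c - d + 2]
                  ![c - d + 2, a + e + c - d + 3, b + 2 * c - d + 3] 1) := by
  -- In both series the lower parameters exceed the upper ones by exactly 1 in total.
  have s1 : Summable (pFqTerm ![a + 1, b + 1, d, e + 1] ![d - c, a + e + 2, b + c + 2] 1) :=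
    summable_pFqTerm_one (by simp [Fin.sum_univ_succ]; linarith)
  have s2 : Summable (pFqTerm ![a + c - d + 2, b + c - d + 2, c + 1, e + c - d + 2]
      ![c - d + 2, a + e + c - d + 3, b + 2 * c - d + 3] 1) :=
    summable_pFqTerm_one (by simp [Fin.sum_univ_succ]; linarith)
  refine ⟨s1, s2, ?_⟩
  set σ := π / sin (π * (c - d + 1)) with hσ
  -- π(c − d + 1) = π − π(d − c), so the two sines agree.
  have hsin : π / sin (π * (d - c)) = σ := by
    rw [hσ, ← Real.sin_pi_sub]
    congr 2
    ring
  have hA := integerCoeff_mul_betaProd ha hb hc he hq σ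
  have hB := shiftedCoeff_mul_betaProd (a := a) (b := b) (e := e) hc he hq (by linarith)
    (by linarith) (by linarith) σ
  have key := Gamma_mul_J3_eq_tsum (q := c - d + 1) ha hb hc he (by linarith) (by linarith)
    (integrableOn_beukersIntegrand ha hb hc he hat hbt het ht) (Complex.Gamma (a + c - d + 2))
    (fun w hw0 hw1 => hasSum_euler_integral ha hc hat ht
      (fun k hk => hq (k - 1) (by push_cast; linarith)) hw0 hw1)
    (by simp only [← hσ, hA]; exact Complex.ofRealCLM.summable (s1.mul_left _))
    (by simp only [← hσ, hB]; exact Complex.ofRealCLM.summable (s2.mul_left _))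
  simp only [← hσ, hA, hB, ← Complex.ofReal_tsum, tsum_mul_left] at key
  rw [show ((a : ℂ) + c - d + 2) = ((a + c - d + 2 : ℝ) : ℂ) by push_cast; ring,
    Complex.Gamma_ofReal, ← Complex.ofReal_mul, ← Complex.ofReal_sub, Complex.ofReal_inj] at key
  have hG : Gamma (a + c - d + 2) ≠ 0 := (Real.Gamma_pos_of_pos (by linarith)).ne'
  rw [hsin, ← mul_right_inj' hG, key]
  simp only [pFq]
  field_simp

/-! ### The theorem -/

theorem mainTheorem1 (a b c d e : ℝ) (ha : -1 < a) (hb : -1 < b) (hc : -1 < c) (he : -1 < e)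
    (hd : ∃ t : ℝ, -min (min (a + 1) (b + 1)) (min d (e + 1)) < t ∧ t < c - d + 1) :
    IntegrableOn (beukersIntegrand a b c d e 0) unitCube ∧
    ((∀ k : ℕ, d ≠ -(k : ℝ)) →
      ∃ g : ℂ,
        IsMeijerG 2 4 1
          ![1 - (d : ℂ), -(a : ℂ), -(b : ℂ), -(e : ℂ)]
          ![1 - (d : ℂ) + c, 0, -1 - (b : ℂ) - c, -1 - (e : ℂ) - a] g ∧
        (J3 a b c d e 0 : ℂ) =
          ((Gamma (1 + a) * Gamma (1 + c) / (Gamma d * Gamma (2 + a + c - d)) : ℝ) : ℂ) * g) ∧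
    ((∀ k : ℤ, c - d ≠ (k : ℝ)) →
      Summable (pFqTerm ![a + 1, b + 1, d, e + 1] ![d - c, a + e + 2, b + c + 2] 1) ∧
      Summable (pFqTerm ![a + c - d + 2, b + c - d + 2, c + 1, e + c - d + 2]
        ![c - d + 2, a + e + c - d + 3, b + 2 * c - d + 3] 1) ∧
      -- for `d = 0, -1, -2, …` one has `Gamma d = 0` in Mathlib, so `1 / Γ(d)` is `0`, as it should
      J3 a b c d e 0 =
        π / sin (π * (d - c)) *
          (Gamma (a + 1) ^ 2 * Gamma (b + 1) * Gamma (c + 1) * Gamma (e + 1)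
              / (Gamma (d - c) * Gamma (a + e + 2) * Gamma (b + c + 2) * Gamma (a + c - d + 2))
              * pFq ![a + 1, b + 1, d, e + 1] ![d - c, a + e + 2, b + c + 2] 1
            - Gamma (a + 1) * Gamma (c + 1) ^ 2 * Gamma (b + c - d + 2) * Gamma (e + c - d + 2)
              / (Gamma d * Gamma (c - d + 2) * Gamma (a + e + c - d + 3)
                  * Gamma (b + 2 * c - d + 3))
              * pFq ![a + c - d + 2, b + c - d + 2, c + 1, e + c - d + 2]
                  ![c - d + 2, a + e + c - d + 3, b + 2 * c - d + 3] 1)) := by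
  obtain ⟨t, ht0, ht⟩ := hd
  simp only [neg_lt, lt_min_iff] at ht0
  obtain ⟨⟨hat, hbt⟩, hdt, het⟩ := ht0
  rw [neg_lt] at hat hbt hdt het
  exact ⟨integrableOn_beukersIntegrand ha hb hc he hat hbt het ht,
    exists_isMeijerG ha hb hc he hat hbt het ht,
    J3_eq_pFq ha hb hc he hat hbt het ht⟩
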